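/- **Setting.** Let $\Omega\subset\mathbb R^2$ be a bounded polygonal domain (connected, open, equal to the interior of its closure), let $\mathcal T_h$ be a conforming triangulation of $\Omega$, $h_K$ the length of the longest edge of $K\in\mathcal T_h$ and $h=\max_K h_K$. Let $\partial\Omega=\Gamma_D\cup\Gamma_N$, where each boundary edge of $\mathcal T_h$ belongs to exactly one of $\Gamma_D$, $\Gamma_N$ (either may be empty). Let $f\in L^2(\Omega)$, let $g_N$ be constant on each edge in $\Gamma_N$ and $g_D$ a function on $\Gamma_D$ (continuous and linear on each edge in $\Gamma_D$). Write $\|\cdot\|_A$ for the $L^2(A)$ norm, $(\cdot,\cdot)$ for the $L^2(\Omega)$ inner product, $(g_N,v)_{\Gamma_N}=\int_{\Gamma_N}g_Nv\,ds$. If $\Gamma_D\neq\emptyset$, let $V=\{v\in H^1(\Omega): v=g_D\text{ on }\Gamma_D\}$ and $V_0=\{v\in H^1(\Omega): v=0\text{ on }\Gamma_D\}$ (in the sense of traces); if $\Gamma_D=\emptyset$, let $V=V_0=\{v\in H^1(\Omega):\int_\Omega v\,dx=0\}$. Let $V_h$, $V_{h,0}$ be the spaces of continuous functions on $\overline\Omega$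 that are linear on each $K\in\mathcal T_h$ and satisfy the conditions of $V$, $V_0$ respectively. Let $X_h$ be the space of functions that are constant on each $K$, with $\int_\Omega v\,dx=0$ required in addition if $\Gamma_D=\emptyset$, and let $\pi_h:L^2(\Omega)\to X_h$ be the $L^2(\Omega)$-orthogonal projection. Let $RT_h$ be the space of $\mathbf p\in H(\mathrm{div};\Omega)$ that have the form $\mathbf p(x)=(a_K+c_Kx_1,\;b_K+c_Kx_2)$ on each $K$, and $RT_{h,0}=\{\mathbf q\in RT_h:\mathbf q\cdot\mathbf n=0\text{ on }\Gamma_N\}$, with $\mathbf n$ the unit outer normal. **Constants.** For each $K\in\mathcal T_h$ let $C_0(K)$ be a constant with $\|v-\frac1{|K|}\int_Kv\,dx\|_K\le C_0(K)\|\nabla v\|_K$ for all $v\in H^1(K)$. Put $$C_0=\max_{K\in\mathcal T_h}\frac{C_0(K)}h,\qquad \kappa_h=\max_{0\ne f_h\in X_h}\ \min_{\substack{v_h\in V_{h,0},\ \mathbf q_h\in RT_{h,0}\\ \mathrm{div}\,\mathbf q_h+f_h=0}}\frac{\|\nabla v_h-\mathbf q_h\|_\Omega}{\|f_h\|_\Omega},\qquad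 C(h)=\sqrt{\kappa_h^2+(C_0h)^2}$$ (with $\kappa_h=0$ if $X_h=\{0\}$). **Weight.** Let $S\subseteq\Omega$ be open, $\varepsilon>0$, $\Omega'=\{x\in\Omega:\mathrm{dist}(x,S)<\varepsilon\}$ (if $S=\emptyset$, put $\Omega'=\Omega$), and let $\alpha\in W^{1,\infty}(\Omega)$ satisfy $\alpha=1$ on $S$, $\alpha=0$ on $\Omega\setminus\Omega'$ and $0\le\alpha\le1$ on $\Omega'\setminus S$. Put $\|\mathbf q\|_\alpha=\big(\int_{\Omega'}\alpha|\mathbf q|^2dx\big)^{1/2}$ and $\|\nabla\alpha\|_\infty=\max_{i=1,2}\|\partial\alpha/\partial x_i\|_{L^\infty(\Omega)}$. **Theorem.** Let $u\in V$ satisfy $(\nabla u,\nabla v)=(f,v)+(g_N,v)_{\Gamma_N}$ for all $v\in V_0$, let $\bar u_h\in V_h$ satisfy $(\nabla\bar u_h,\nabla v_h)=(\pi_hf,v_h)+(g_N,v_h)_{\Gamma_N}$ for all $v_h\in V_{h,0}$, and let $\mathbf p_h\in RT_h$ satisfy $\mathrm{div}\,\mathbf p_h+\pi_hf=0$ in $\Omega$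 and $\mathbf p_h\cdot\mathbf n=g_N$ on $\Gamma_N$. Then $$\|\nabla u-\nabla\bar u_h\|_S\le\sqrt{\bar E_1^2+\bar E_2^2}+C_0h\,\|f-\pi_hf\|_\Omega,$$ where $$\bar E_1=\|\nabla\bar u_h-\mathbf p_h\|_\alpha,\qquad \bar E_2=\big(2\sqrt2\,C(h)\,\|\nabla\alpha\|_\infty\big)^{1/2}\,\|\nabla\bar u_h-\mathbf p_h\|_\Omega.$$ -/

import Mathlib

open MeasureTheory Filter Topology
open scoped ENNReal ContDiff

noncomputable section

namespace LocalFEM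

/-- The Euclidean plane. -/
abbrev Plane := EuclideanSpace ℝ (Fin 2)

/-! ### Lebesgue norms, weak derivatives and Sobolev spaces -/

/-- The `L²(A)` norm of a scalar or vector valued function (used for `L²` functions only). -/
def l2norm {F : Type*} [NormedAddCommGroup F] (A : Set Plane) (q : Plane → F) : ℝ :=
  √(∫ x in A, ‖q x‖ ^ 2)

/-- The `L²(A)` inner product of scalar functions. -/
def l2inner (A : Set Plane) (u v : Plane → ℝ) : ℝ := ∫ x in A, u x * v x

/-- The `L²(A)²` inner product of vector fields. -/
def l2innerVec (A : Set Plane) (p q : Plane → Plane) : ℝ := ∫ x in A, inner ℝ (p x) (q x)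

/-- Test functions: smooth functions with compact support in `U`. -/
def IsTestFunction (U : Set Plane) (φ : Plane → ℝ) : Prop :=
  ContDiff ℝ ∞ φ ∧ HasCompactSupport φ ∧ tsupport φ ⊆ U

/-- `G` is the weak (distributional) gradient of `u` on the open set `U`. -/
def HasWeakGrad (U : Set Plane) (u : Plane → ℝ) (G : Plane → Plane) : Prop :=
  LocallyIntegrableOn u U ∧ LocallyIntegrableOn G U ∧
    ∀ φ : Plane → ℝ, IsTestFunction U φ →
      ∫ x in U, u x • gradient φ x = - ∫ x in U, φ x • G x

/-- `d` is the weak (distributional) divergence of the vector field `p` on the open set `U`. -/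
def HasWeakDiv (U : Set Plane) (p : Plane → Plane) (d : Plane → ℝ) : Prop :=
  LocallyIntegrableOn p U ∧ LocallyIntegrableOn d U ∧
    ∀ φ : Plane → ℝ, IsTestFunction U φ →
      ∫ x in U, inner ℝ (p x) (gradient φ x) = - ∫ x in U, d x * φ x

open scoped Classical in
/-- The weak gradient of `u` on `U` (unique almost everywhere on `U` when it exists). -/
def weakGrad (U : Set Plane) (u : Plane → ℝ) : Plane → Plane :=
  if h : ∃ G, HasWeakGrad U u G then h.choose else 0

/-- `u ∈ H¹(U)`. -/
def MemH1 (U : Set Plane) (u : Plane → ℝ) : Prop :=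
  MemLp u 2 (volume.restrict U) ∧
    ∃ G : Plane → Plane, MemLp G 2 (volume.restrict U) ∧ HasWeakGrad U u G

/-- `u ∈ W^{1,∞}(U)`. -/
def MemW1Inf (U : Set Plane) (u : Plane → ℝ) : Prop :=
  MemLp u ∞ (volume.restrict U) ∧
    ∃ G : Plane → Plane, MemLp G ∞ (volume.restrict U) ∧ HasWeakGrad U u G

/-- `p ∈ H(div; U)`. -/
def MemHdiv (U : Set Plane) (p : Plane → Plane) : Prop :=
  MemLp p 2 (volume.restrict U) ∧
    ∃ d : Plane → ℝ, MemLp d 2 (volume.restrict U) ∧ HasWeakDiv U p d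

/-- `‖∇ a‖_{L^∞(U)}`, the larger of the two numbers `‖∂a/∂x_i‖_{L^∞(U)}`. -/
def gradSupNorm (U : Set Plane) (a : Plane → ℝ) : ℝ :=
  ⨆ i : Fin 2, (eLpNorm (fun x => weakGrad U a x i) ∞ (volume.restrict U)).toReal

/-- `g ∈ L²(Γ)` is the trace on `Γ ⊆ ∂U` of `u ∈ H¹(U)`: the limit in `L²(Γ)`, with respect to
arc length, of the restrictions to `Γ` of smooth functions on the plane that converge to `u`
in `H¹(U)`. -/
def HasTrace (U Γ : Set Plane) (u g : Plane → ℝ) : Prop :=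
  MemH1 U u ∧ MemLp g 2 ((μH[1] : Measure Plane).restrict Γ) ∧
    ∃ φ : ℕ → Plane → ℝ, (∀ n, ContDiff ℝ ∞ (φ n)) ∧
      Tendsto (fun n => eLpNorm (fun x => φ n x - u x) 2 (volume.restrict U)) atTop (𝓝 0) ∧
      Tendsto (fun n => eLpNorm (fun x => gradient (φ n) x - weakGrad U u x) 2
        (volume.restrict U)) atTop (𝓝 0) ∧
      Tendsto (fun n => eLpNorm (fun x => φ n x - g x) 2
        ((μH[1] : Measure Plane).restrict Γ)) atTop (𝓝 0)

/-! ### Triangulations -/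

/-- The closed triangle or segment with the given vertices. -/
def hull (K : Finset Plane) : Set Plane := convexHull ℝ (K : Set Plane)

/-- The open triangle with the given vertices. -/
def openTri (K : Finset Plane) : Set Plane := interior (hull K)

/-- A proper (conforming) triangulation of `Ω`: finitely many nondegenerate closed triangles,
given by their vertex sets, that cover the closure of `Ω` and any two of which meet exactly in
the hull of their common vertices (so in nothing, a vertex, or an edge, unless they are equal). -/
structure Mesh (Ω : Set Plane) where
  tri : Finset (Finset Plane)
  card_tri : ∀ K ∈ tri, K.card = 3
  affineIndependent : ∀ K ∈ tri, AffineIndependent ℝ ((↑) : K → Plane)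
  inter : ∀ K ∈ tri, ∀ K' ∈ tri,
    hull K ∩ hull K' = convexHull ℝ ((K : Set Plane) ∩ (K' : Set Plane))
  cover : closure Ω = ⋃ K ∈ tri, hull K

variable {Ω : Set Plane}

/-- The mesh size: the maximum over the triangles of the length of the longest edge (which is the
diameter of the set of the three vertices). -/
def Mesh.size (M : Mesh Ω) : ℝ := ⨆ K : M.tri, Metric.diam ((K : Finset Plane) : Set Plane)

/-- An edge of the triangulation (given by its two end points) that lies on `∂Ω`. -/
def Mesh.IsBoundaryEdge (M : Mesh Ω) (e : Finset Plane) : Prop :=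
  (∃ K ∈ M.tri, e ⊆ K) ∧ e.card = 2 ∧ hull e ⊆ frontier Ω

/-- A partition of `∂Ω` into a Dirichlet part and a Neumann part, each being a union of
boundary edges of the triangulation. -/
structure BoundarySplit (M : Mesh Ω) where
  ΓD : Finset (Finset Plane)
  ΓN : Finset (Finset Plane)
  disjoint : Disjoint ΓD ΓN
  cover : ∀ e, M.IsBoundaryEdge e ↔ e ∈ ΓD ∨ e ∈ ΓN

/-- `n` is the unit outer normal of the triangle `K` on its edge `e`. -/
def IsOuterNormal (K e : Finset Plane) (n : Plane) : Prop :=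
  ‖n‖ = 1 ∧ ∀ x ∈ e, ∀ y ∈ K, inner ℝ n (y - x) ≤ 0

/-- `v ∈ H¹(Ω)` has the trace `t` on the boundary edges in `Γ`. The trace on a boundary edge is
that of the restriction of `v` to the triangle having this edge. -/
def HasTraceOn (M : Mesh Ω) (Γ : Finset (Finset Plane)) (v t : Plane → ℝ) : Prop :=
  ∀ e ∈ Γ, ∀ K ∈ M.tri, e ⊆ K → HasTrace (openTri K) (hull e) v t

/-- `∫_{Γ_N} g_N t ds` for `g_N` constant on every edge. -/
def edgePairing (Γ : Finset (Finset Plane)) (gN : Finset Plane → ℝ) (t : Plane → ℝ) : ℝ :=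
  ∑ e ∈ Γ, gN e * ∫ x in hull e, t x ∂(μH[1] : Measure Plane)

/-! ### The continuous problem -/

/-- `v ∈ V`: `v ∈ H¹(Ω)` with `v = g_D` on `Γ_D`, or with mean value zero if `Γ_D` is empty. For
`g_D = 0` this is the space `V₀`. -/
def MemV (M : Mesh Ω) (B : BoundarySplit M) (gD v : Plane → ℝ) : Prop :=
  MemH1 Ω v ∧ HasTraceOn M B.ΓD v gD ∧ (B.ΓD = ∅ → ∫ x in Ω, v x = 0)

/-- `u ∈ V` and `(∇u, ∇v) = (f, v) + (g_N, v)_{Γ_N}` for all `v ∈ V₀`; here `t` is the trace of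
`v` on `Γ_N`. -/
def IsWeakSolution (M : Mesh Ω) (B : BoundarySplit M) (f gD : Plane → ℝ)
    (gN : Finset Plane → ℝ) (u : Plane → ℝ) : Prop :=
  MemV M B gD u ∧
    ∀ v t : Plane → ℝ, MemV M B 0 v → HasTraceOn M B.ΓN v t →
      l2innerVec Ω (weakGrad Ω u) (weakGrad Ω v) = l2inner Ω f v + edgePairing B.ΓN gN t

/-! ### Finite element spaces -/

/-- `v ∈ V_h`: continuous piecewise linear, with `v = g_D` on `Γ_D`, or with mean value zero if
`Γ_D` is empty. For `g_D = 0` this is the space `V_{h,0}`. -/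
def MemVh (M : Mesh Ω) (B : BoundarySplit M) (gD v : Plane → ℝ) : Prop :=
  ContinuousOn v (closure Ω) ∧
    (∀ K ∈ M.tri, ∃ (a : Plane) (b : ℝ), ∀ x ∈ hull K, v x = inner ℝ a x + b) ∧
    (∀ e ∈ B.ΓD, ∀ x ∈ hull e, v x = gD x) ∧ (B.ΓD = ∅ → ∫ x in Ω, v x = 0)

/-- The conforming piecewise linear finite element solution with right-hand side `f`. -/
def IsFEMSolution (M : Mesh Ω) (B : BoundarySplit M) (f gD : Plane → ℝ)
    (gN : Finset Plane → ℝ) (uh : Plane → ℝ) : Prop :=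
  MemVh M B gD uh ∧
    ∀ vh : Plane → ℝ, MemVh M B 0 vh →
      l2innerVec Ω (weakGrad Ω uh) (weakGrad Ω vh) = l2inner Ω f vh + edgePairing B.ΓN gN vh

/-- `v ∈ X_h`: piecewise constant, with mean value zero if `Γ_D` is empty. -/
def MemXh (M : Mesh Ω) (B : BoundarySplit M) (v : Plane → ℝ) : Prop :=
  MemLp v 2 (volume.restrict Ω) ∧
    (∀ K ∈ M.tri, ∃ c : ℝ, ∀ᵐ x ∂(volume.restrict (hull K)), v x = c) ∧
    (B.ΓD = ∅ → ∫ x in Ω, v x = 0)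

/-- `fh = π_h f`, the `L²(Ω)` projection of `f` to `X_h`. -/
def IsProjection (M : Mesh Ω) (B : BoundarySplit M) (f fh : Plane → ℝ) : Prop :=
  MemXh M B fh ∧ ∀ η : Plane → ℝ, MemXh M B η → l2inner Ω (fun x => f x - fh x) η = 0

/-- The lowest order Raviart–Thomas form `(a₁ + c x₁, a₂ + c x₂)` of `p` on the triangle `K`. -/
def IsRTOn (K : Finset Plane) (p : Plane → Plane) (a : Plane) (c : ℝ) : Prop :=
  ∀ᵐ x ∂(volume.restrict (hull K)), p x = a + c • x

/-- `p ∈ RT_h`. -/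
def MemRT (M : Mesh Ω) (p : Plane → Plane) : Prop :=
  MemHdiv Ω p ∧ ∀ K ∈ M.tri, ∃ (a : Plane) (c : ℝ), IsRTOn K p a c

/-- `p · n = g` on `Γ_N`, for `p ∈ RT_h` and `g` constant on every edge. -/
def NormalEq (M : Mesh Ω) (B : BoundarySplit M) (p : Plane → Plane)
    (g : Finset Plane → ℝ) : Prop :=
  ∀ e ∈ B.ΓN, ∀ K ∈ M.tri, e ⊆ K → ∀ n : Plane, IsOuterNormal K e n →
    ∀ (a : Plane) (c : ℝ), IsRTOn K p a c → ∀ x ∈ hull e, inner ℝ (a + c • x) n = g e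

/-! ### The constants in the estimate -/

/-- `c` is an admissible value of `C₀(K)`: it bounds the error of the projection to constants,
`‖v - π v‖_K ≤ c |v|_{H¹(K)}` for all `v ∈ H¹(K)`. -/
def IsProjectionConstant (K : Finset Plane) (c : ℝ) : Prop :=
  ∀ v : Plane → ℝ, MemH1 (openTri K) v →
    l2norm (openTri K) (fun x => v x - ⨍ y in openTri K, v y) ≤
      c * l2norm (openTri K) (weakGrad (openTri K) v)

/-- `C₀ = max_K C₀(K) / h`. -/
def Mesh.C0 (M : Mesh Ω) (C0K : Finset Plane → ℝ) : ℝ := ⨆ K : M.tri, C0K K / M.size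

/-- `κ_h`, the maximum over `f_h ∈ X_h`, `f_h ≠ 0`, of the minimum of
`‖∇v_h - q_h‖ / ‖f_h‖` over `v_h ∈ V_{h,0}` and `q_h ∈ RT_{h,0}` with `div q_h + f_h = 0`. -/
def kappa (M : Mesh Ω) (B : BoundarySplit M) : ℝ :=
  sSup {m : ℝ | ∃ fh : Plane → ℝ, MemXh M B fh ∧ l2norm Ω fh ≠ 0 ∧
    m = sInf {r : ℝ | ∃ (vh : Plane → ℝ) (qh : Plane → Plane),
      MemVh M B 0 vh ∧ MemRT M qh ∧ NormalEq M B qh 0 ∧ HasWeakDiv Ω qh (fun x => -fh x) ∧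
      r = l2norm Ω (fun x => weakGrad Ω vh x - qh x) / l2norm Ω fh}}

/-- `C(h) = √(κ_h² + (C₀ h)²)`. -/
def Ch (M : Mesh Ω) (B : BoundarySplit M) (C0K : Finset Plane → ℝ) : ℝ :=
  √(kappa M B ^ 2 + (M.C0 C0K * M.size) ^ 2)

/-! ### The weight function -/

/-- `Ω' = {x ∈ Ω ; dist(x, S) < ε}`. -/
def extendedDomain (Ω S : Set Plane) (ε : ℝ) : Set Plane := {x ∈ Ω | Metric.infDist x S < ε}

/-- `α ∈ W^{1,∞}(Ω)` is a weight function for `S` and the band width `ε`. -/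
def IsWeight (Ω S : Set Plane) (ε : ℝ) (α : Plane → ℝ) : Prop :=
  MemW1Inf Ω α ∧ (∀ x ∈ S, α x = 1) ∧ (∀ x ∈ Ω \ extendedDomain Ω S ε, α x = 0) ∧
    ∀ x ∈ extendedDomain Ω S ε \ S, 0 ≤ α x ∧ α x ≤ 1

/-- The weighted norm `‖q‖_α = (∫_{Ω'} α |q|² dx)^{1/2}`. -/
def weightedNorm (Ω S : Set Plane) (ε : ℝ) (α : Plane → ℝ) (q : Plane → Plane) : ℝ :=
  √(∫ x in extendedDomain Ω S ε, α x * ‖q x‖ ^ 2)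

/-- `Ē₁ = ‖∇ū_h - p_h‖_α`. -/
def E1 (Ω S : Set Plane) (ε : ℝ) (α uh : Plane → ℝ) (p : Plane → Plane) : ℝ :=
  weightedNorm Ω S ε α (fun x => weakGrad Ω uh x - p x)

/-- `Ē₂ = (2√2 C(h) ‖∇α‖_∞)^{1/2} ‖∇ū_h - p_h‖_Ω`. -/
def E2 (M : Mesh Ω) (B : BoundarySplit M) (C0K : Finset Plane → ℝ)
    (α uh : Plane → ℝ) (p : Plane → Plane) : ℝ :=
  √(2 * √2 * Ch M B C0K * gradSupNorm Ω α) * l2norm Ω (fun x => weakGrad Ω uh x - p x)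

end LocalFEM

end

namespace LocalFEM

/-! ### Weak gradients -/

/-! Write `u_h` for the finite element solution. Let `v₀ ∈ V₀` be the function whose gradient `G` is
the orthogonal projection of `∇u - p` to the gradients of `V₀`. Then `u - v₀` is the weak solution
with `π_h f` in place of `f`, and the error `∇u - ∇u_h` is the sum of `G` and of `E = ∇e`, where `e
= u - u_h - v₀`.

The data term is `G`. Green's formula for `p` gives `‖G‖² = (f - π_h f, v₀)`. Since `f - π_h f` is
orthogonal to the piecewise means of `v₀`, the Poincaré constants of the triangles
(`Mesh.l2norm_sub_avg_le`) yield `‖G‖ ≤ C₀ h ‖f - π_h f‖`.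

The local term is `E`. Put `D = ∇u - p - G` and `Q = ∇u_h - p`, so that `D - E = Q` and `D` is
orthogonal to all gradients of `V₀`. This gives the hypercircle identity `‖D‖² + ‖E‖² = ‖Q‖²`. It is
localized by testing `D` with the gradient `α E + e ∇α` of `α e`, which lies in `V₀` up to a
constant: `∫ α|E|² ≤ ∫ α|Q|² + 2 |(D, e ∇α)|` (`integral_weight_le`). As `|∇α| ≤ √2 ‖∇α‖_∞` and both
`‖D‖` and `‖E‖` are at most `‖Q‖`, it remains to know that `‖e‖ ≤ C(h) ‖E‖`.

That bound is a duality argument (`Mesh.InV0.l2norm_le_Ch`). The distance of `e` to its piecewise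
mean `m` is controlled by `C₀ h ‖E‖`. For `m` itself take `v_h` and `q_h` admissible in `κ_h` with
`div q_h = -m`. Then `‖m‖² = (q_h, E) = -(∇v_h - q_h, E)`, because `E` is orthogonal to the
gradients of `V_{h,0}`; passing to the infimum gives `‖m‖ ≤ κ_h ‖E‖`.

Three foundations carry this. Green's formula for Raviart–Thomas fields reduces on one triangle to
the fields `x - P`, whose flux leaves only through the edge opposite to `P`; the formula on `Ω` is
the sum over pairs (triangle, vertex), where the two sides of each interior edge cancel. A bounded
right inverse of the divergence (`Mesh.exists_bounded_rt`), built by sending fluxes along chains of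
adjacent triangles, makes `κ_h` a finite supremum and gives a global Poincaré inequality, hence
closedness of the space of gradients. Density of smooth functions, by contraction followed by
mollification, gives the traces and the product rule for `α e`. -/

theorem IsTestFunction.continuous {U : Set Plane} {φ : Plane → ℝ} (h : IsTestFunction U φ) :
    Continuous φ := h.1.continuous

theorem IsTestFunction.mono {U V : Set Plane} (hUV : U ⊆ V) {φ : Plane → ℝ}
    (h : IsTestFunction U φ) : IsTestFunction V φ := ⟨h.1, h.2.1, h.2.2.trans hUV⟩

theorem IsTestFunction.eq_zero {U : Set Plane} {φ : Plane → ℝ} (h : IsTestFunction U φ)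
    {x : Plane} (hx : x ∉ U) : φ x = 0 :=
  image_eq_zero_of_notMem_tsupport fun h' => hx (h.2.2 h')

theorem contDiff_gradient {φ : Plane → ℝ} (h : ContDiff ℝ ∞ φ) : ContDiff ℝ ∞ (gradient φ) := by
  unfold gradient
  exact (InnerProductSpace.toDual ℝ Plane).symm.toContinuousLinearEquiv.contDiff.comp
    (h.fderiv_right (m := ∞) le_rfl)

theorem continuous_gradient {φ : Plane → ℝ} (h : ContDiff ℝ ∞ φ) : Continuous (gradient φ) :=
  (contDiff_gradient h).continuous

theorem gradient_eq_zero_of_notMem_tsupport {φ : Plane → ℝ} {x : Plane} (hx : x ∉ tsupport φ) :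
    gradient φ x = 0 := by
  have : fderiv ℝ φ x = 0 := by
    by_contra h
    exact hx (support_fderiv_subset ℝ h)
  simp [gradient, this]

theorem hasCompactSupport_gradient {φ : Plane → ℝ} (h : HasCompactSupport φ) :
    HasCompactSupport (gradient φ) :=
  HasCompactSupport.of_support_subset_isCompact (K := tsupport φ) h fun x hx => by
    by_contra h'
    exact hx (gradient_eq_zero_of_notMem_tsupport h')

theorem IsTestFunction.gradient_eq_zero {U : Set Plane} {φ : Plane → ℝ} (h : IsTestFunction U φ)
    {x : Plane} (hx : x ∉ U) : gradient φ x = 0 :=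
  gradient_eq_zero_of_notMem_tsupport fun h' => hx (h.2.2 h')

theorem gradient_mul {φ ψ : Plane → ℝ} {x : Plane} (hφ : DifferentiableAt ℝ φ x)
    (hψ : DifferentiableAt ℝ ψ x) :
    gradient (fun y => φ y * ψ y) x = φ x • gradient ψ x + ψ x • gradient φ x := by
  unfold gradient
  rw [fderiv_fun_mul hφ hψ]
  simp

theorem gradient_smul {φ : Plane → ℝ} {x : Plane} (hφ : DifferentiableAt ℝ φ x) (r : ℝ) :
    gradient (fun y => r * φ y) x = r • gradient φ x := by
  unfold gradient
  rw [fderiv_const_mul hφ]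
  simp

theorem gradient_add {φ ψ : Plane → ℝ} {x : Plane} (hφ : DifferentiableAt ℝ φ x)
    (hψ : DifferentiableAt ℝ ψ x) :
    gradient (fun y => φ y + ψ y) x = gradient φ x + gradient ψ x := by
  unfold gradient
  rw [fderiv_fun_add hφ hψ]
  simp

theorem gradient_affine (a : Plane) (b : ℝ) (x : Plane) :
    gradient (fun y => inner ℝ a y + b) x = a := by
  have : HasGradientAt (fun y => inner ℝ a y + b) a x := by
    rw [hasGradientAt_iff_hasFDerivAt]
    exact ((InnerProductSpace.toDual ℝ Plane a).hasFDerivAt).add_const b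
  exact this.gradient

theorem contDiff_affine (a : Plane) (b : ℝ) : ContDiff ℝ ∞ (fun y : Plane => inner ℝ a y + b) :=
  (contDiff_const.inner ℝ contDiff_id).add contDiff_const

theorem IsTestFunction.integrableOn_smul {F : Type*} [NormedAddCommGroup F] [NormedSpace ℝ F]
    {U : Set Plane} {φ : Plane → ℝ} (h : IsTestFunction U φ) {G : Plane → F}
    (hG : LocallyIntegrableOn G U) : IntegrableOn (fun x => φ x • G x) U := by
  have h1 : IntegrableOn G (tsupport φ) := hG.integrableOn_compact_subset h.2.2 h.2.1
  have h2 : IntegrableOn (fun x => φ x • G x) (tsupport φ) :=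
    h1.continuousOn_smul h.continuous.continuousOn h.2.1
  refine (h2.integrable_of_forall_notMem_eq_zero fun x hx => ?_).integrableOn
  simp [image_eq_zero_of_notMem_tsupport hx]

theorem IsTestFunction.integrableOn_smul_gradient
    {U : Set Plane} {φ : Plane → ℝ} (h : IsTestFunction U φ) {v : Plane → ℝ}
    (hv : LocallyIntegrableOn v U) : IntegrableOn (fun x => v x • gradient φ x) U := by
  have h1 : IntegrableOn v (tsupport φ) := hv.integrableOn_compact_subset h.2.2 h.2.1
  have h2 : IntegrableOn (fun x => v x • gradient φ x) (tsupport φ) :=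
    h1.smul_continuousOn (continuous_gradient h.1).continuousOn h.2.1
  refine (h2.integrable_of_forall_notMem_eq_zero fun x hx => ?_).integrableOn
  simp [gradient_eq_zero_of_notMem_tsupport hx]

/-- The difference of the two gradients integrates to zero against every test function. This makes
the choice in `weakGrad` harmless: it may be replaced by any explicit weak gradient. -/
theorem HasWeakGrad.ae_eq {U : Set Plane} (hU : IsOpen U) {u : Plane → ℝ} {G G' : Plane → Plane}
    (h : HasWeakGrad U u G) (h' : HasWeakGrad U u G') : G =ᵐ[volume.restrict U] G' := by
  have key : ∀ᵐ x ∂volume, x ∈ U → G x - G' x = 0 := by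
    refine hU.ae_eq_zero_of_integral_contDiff_smul_eq_zero (h.2.1.sub h'.2.1) ?_
    intro φ h1 h2 h3
    have hφ : IsTestFunction U φ := ⟨h1, h2, h3⟩
    have e1 : ∫ x, φ x • (G x - G' x) = ∫ x in U, φ x • (G x - G' x) := by
      rw [setIntegral_eq_integral_of_forall_compl_eq_zero]
      intro x hx; simp [hφ.eq_zero hx]
    have e2 := h.2.2 φ hφ
    have e3 := h'.2.2 φ hφ
    have i1 := hφ.integrableOn_smul h.2.1
    have i2 := hφ.integrableOn_smul h'.2.1
    rw [e1]
    simp only [smul_sub]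
    rw [integral_sub i1 i2, sub_eq_zero]
    rw [e2] at e3
    exact neg_injective e3
  rw [EventuallyEq, ae_restrict_iff' hU.measurableSet]
  filter_upwards [key] with x hx hxU
  exact sub_eq_zero.1 (hx hxU)

theorem HasWeakGrad.weakGrad {U : Set Plane} {u : Plane → ℝ} {G : Plane → Plane}
    (h : HasWeakGrad U u G) : HasWeakGrad U u (weakGrad U u) := by
  have : ∃ G, HasWeakGrad U u G := ⟨G, h⟩
  rw [LocalFEM.weakGrad, dif_pos this]
  exact this.choose_spec

theorem HasWeakGrad.weakGrad_ae_eq {U : Set Plane} (hU : IsOpen U) {u : Plane → ℝ}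
    {G : Plane → Plane} (h : HasWeakGrad U u G) : LocalFEM.weakGrad U u =ᵐ[volume.restrict U] G :=
  h.weakGrad.ae_eq hU h

theorem locallyIntegrableOn_of_memLp {F : Type*} [NormedAddCommGroup F] {U : Set Plane}
    {v : Plane → F} {p : ℝ≥0∞} (hp : 1 ≤ p) (hv : MemLp v p (volume.restrict U)) :
    LocallyIntegrableOn v U :=
  locallyIntegrableOn_of_locallyIntegrable_restrict (hv.locallyIntegrable hp)

/-- `v ∈ H¹(U)` with weak gradient `G`. -/
structure InH1 (U : Set Plane) (v : Plane → ℝ) (G : Plane → Plane) : Prop where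
  memLp : MemLp v 2 (volume.restrict U)
  memLp_grad : MemLp G 2 (volume.restrict U)
  weak : ∀ φ : Plane → ℝ, IsTestFunction U φ →
      ∫ x in U, v x • gradient φ x = - ∫ x in U, φ x • G x

theorem InH1.hasWeakGrad {U : Set Plane} {v : Plane → ℝ} {G : Plane → Plane}
    (h : InH1 U v G) : HasWeakGrad U v G :=
  ⟨locallyIntegrableOn_of_memLp one_le_two h.memLp,
    locallyIntegrableOn_of_memLp one_le_two h.memLp_grad, h.weak⟩

theorem InH1.memH1 {U : Set Plane} {v : Plane → ℝ} {G : Plane → Plane}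
    (h : InH1 U v G) : MemH1 U v := ⟨h.memLp, G, h.memLp_grad, h.hasWeakGrad⟩

theorem InH1.weakGrad_ae_eq {U : Set Plane} (hU : IsOpen U) {v : Plane → ℝ} {G : Plane → Plane}
    (h : InH1 U v G) : weakGrad U v =ᵐ[volume.restrict U] G := h.hasWeakGrad.weakGrad_ae_eq hU

theorem MemH1.inH1 {U : Set Plane} (hU : IsOpen U) {v : Plane → ℝ} (h : MemH1 U v) :
    InH1 U v (weakGrad U v) := by
  obtain ⟨h1, G, h2, h3⟩ := h
  exact ⟨h1, h2.ae_eq (h3.weakGrad_ae_eq hU).symm, h3.weakGrad.2.2⟩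

theorem InH1.congr {U : Set Plane} {v w : Plane → ℝ} {G H : Plane → Plane}
    (h : InH1 U v G) (hv : v =ᵐ[volume.restrict U] w) (hG : G =ᵐ[volume.restrict U] H) :
    InH1 U w H := by
  refine ⟨h.memLp.ae_eq hv, h.memLp_grad.ae_eq hG, fun φ hφ => ?_⟩
  have e1 : ∫ x in U, w x • gradient φ x = ∫ x in U, v x • gradient φ x := by
    refine integral_congr_ae ?_
    filter_upwards [hv] with x hx; rw [hx]
  have e2 : ∫ x in U, φ x • H x = ∫ x in U, φ x • G x := by
    refine integral_congr_ae ?_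
    filter_upwards [hG] with x hx; rw [hx]
  rw [e1, e2, h.weak φ hφ]

theorem InH1.mono {U V : Set Plane} (hVU : V ⊆ U) {v : Plane → ℝ} {G : Plane → Plane}
    (h : InH1 U v G) : InH1 V v G := by
  refine ⟨h.memLp.mono_measure (Measure.restrict_mono hVU le_rfl),
    h.memLp_grad.mono_measure (Measure.restrict_mono hVU le_rfl), fun φ hφ => ?_⟩
  have := h.weak φ (hφ.mono hVU)
  rw [setIntegral_eq_integral_of_forall_compl_eq_zero,
    setIntegral_eq_integral_of_forall_compl_eq_zero] at this ⊢
  · exact this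
  · intro x hx; simp [hφ.eq_zero hx]
  · intro x hx; simp [(hφ.mono hVU).eq_zero hx]
  · intro x hx; simp [hφ.gradient_eq_zero hx]
  · intro x hx; simp [(hφ.mono hVU).gradient_eq_zero hx]

theorem InH1.add {U : Set Plane} {v w : Plane → ℝ} {G H : Plane → Plane}
    (hv : InH1 U v G) (hw : InH1 U w H) :
    InH1 U (fun x => v x + w x) (fun x => G x + H x) := by
  refine ⟨hv.memLp.add hw.memLp, hv.memLp_grad.add hw.memLp_grad, fun φ hφ => ?_⟩
  simp only [add_smul, smul_add]
  rw [integral_add (hφ.integrableOn_smul_gradient hv.hasWeakGrad.1)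
      (hφ.integrableOn_smul_gradient hw.hasWeakGrad.1),
    integral_add (hφ.integrableOn_smul hv.hasWeakGrad.2.1)
      (hφ.integrableOn_smul hw.hasWeakGrad.2.1), hv.weak φ hφ, hw.weak φ hφ, neg_add]

theorem InH1.const_mul {U : Set Plane} {v : Plane → ℝ} {G : Plane → Plane}
    (hv : InH1 U v G) (r : ℝ) : InH1 U (fun x => r * v x) (fun x => r • G x) := by
  refine ⟨hv.memLp.const_mul r, hv.memLp_grad.const_smul r, fun φ hφ => ?_⟩
  have e1 : ∀ x, (r * v x) • gradient φ x = r • (v x • gradient φ x) := fun x => mul_smul _ _ _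
  have e2 : ∀ x, φ x • r • G x = r • (φ x • G x) := fun x => smul_comm _ _ _
  simp only [e1, e2, integral_smul, hv.weak φ hφ, smul_neg]

theorem InH1.sub {U : Set Plane} {v w : Plane → ℝ} {G H : Plane → Plane}
    (hv : InH1 U v G) (hw : InH1 U w H) :
    InH1 U (fun x => v x - w x) (fun x => G x - H x) := by
  have := hv.add (hw.const_mul (-1))
  simpa only [neg_smul, one_smul, neg_mul, one_mul, ← sub_eq_add_neg] using this

/-- Paired with a fixed vector `a`, this is integration by parts for the derivative in direction
`a`; the compact support of `φ` removes boundary terms. -/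
theorem integral_gradient_smul_eq {φ ψ : Plane → ℝ} (hφ : ContDiff ℝ ∞ φ) (hψ : ContDiff ℝ ∞ ψ)
    (hc : HasCompactSupport φ) :
    ∫ x, ψ x • gradient φ x = - ∫ x, φ x • gradient ψ x := by
  have i1 : Integrable (fun x => ψ x • gradient φ x) :=
    (hψ.continuous.smul (continuous_gradient hφ)).integrable_of_hasCompactSupport
      ((hasCompactSupport_gradient hc).smul_left)
  have i2 : Integrable (fun x => φ x • gradient ψ x) :=
    (hφ.continuous.smul (continuous_gradient hψ)).integrable_of_hasCompactSupport hc.smul_right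
  have dφ := hφ.differentiable (by simp)
  have dψ := hψ.differentiable (by simp)
  refine ext_inner_left ℝ fun a => ?_
  rw [inner_neg_right, ← integral_inner i1, ← integral_inner i2]
  have e1 : ∀ x, inner ℝ a (ψ x • gradient φ x) = ψ x * fderiv ℝ φ x a := fun x => by
    rw [inner_smul_right, inner_gradient_right]; simp
  have e2 : ∀ x, inner ℝ a (φ x • gradient ψ x) = fderiv ℝ ψ x a * φ x := fun x => by
    rw [inner_smul_right, inner_gradient_right, mul_comm]; simp
  simp only [e1, e2]
  refine integral_mul_fderiv_eq_neg_fderiv_mul_of_integrable ?_ ?_ ?_ (fun x _ => dψ x)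
    (fun x _ => dφ x)
  · simp only [← e2]; exact i2.const_inner a
  · simp only [← e1]; exact i1.const_inner a
  · exact (hψ.continuous.mul hφ.continuous).integrable_of_hasCompactSupport hc.mul_left

theorem memLp_of_continuous_of_isBounded {F : Type*} [NormedAddCommGroup F]
    {U : Set Plane} (hU : Bornology.IsBounded U) {φ : Plane → F} (hφ : Continuous φ) (p : ℝ≥0∞) :
    MemLp φ p (volume.restrict U) := by
  have hc : IsCompact (closure U) := hU.isCompact_closure
  obtain ⟨C, hC⟩ := (hc.image hφ).isBounded.exists_norm_le
  have : IsFiniteMeasure (volume.restrict (closure U)) :=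
    ⟨by simpa using hc.measure_lt_top⟩
  refine (MemLp.of_bound (μ := volume.restrict (closure U)) hφ.aestronglyMeasurable C
    ?_).mono_measure (Measure.restrict_mono subset_closure le_rfl)
  rw [ae_restrict_iff' isClosed_closure.measurableSet]
  exact Eventually.of_forall fun x hx => hC _ ⟨x, hx, rfl⟩

theorem inH1_of_contDiff {U : Set Plane} (hb : Bornology.IsBounded U) {ψ : Plane → ℝ}
    (hψ : ContDiff ℝ ∞ ψ) : InH1 U ψ (gradient ψ) := by
  refine ⟨memLp_of_continuous_of_isBounded hb hψ.continuous 2,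
    memLp_of_continuous_of_isBounded hb (continuous_gradient hψ) 2, fun φ hφ => ?_⟩
  rw [setIntegral_eq_integral_of_forall_compl_eq_zero,
    setIntegral_eq_integral_of_forall_compl_eq_zero]
  · exact integral_gradient_smul_eq hφ.1 hψ hφ.2.1
  · intro x hx; simp [hφ.eq_zero hx]
  · intro x hx; simp [hφ.gradient_eq_zero hx]

theorem inH1_const {U : Set Plane} (hb : Bornology.IsBounded U) (r : ℝ) :
    InH1 U (fun _ => r) (fun _ => 0) := by
  have := inH1_of_contDiff hb (ψ := fun _ => r) contDiff_const
  simpa [gradient_fun_const'] using this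

/-! ### Density of smooth functions -/

/-- Jensen's inequality for the probability measure `ν` bounds the square of the average by the
average of the squares, and Tonelli exchanges the integrations. -/
theorem eLpNorm_integral_le_of_forall {X T E : Type*} [MeasurableSpace X] [MeasurableSpace T]
    [NormedAddCommGroup E] [NormedSpace ℝ E] {μ : Measure X} {ν : Measure T} [SFinite μ]
    [IsProbabilityMeasure ν] {F : X × T → E} (hF : AEStronglyMeasurable F (μ.prod ν)) {ε : ℝ≥0∞}
    (h : ∀ᵐ t ∂ν, eLpNorm (fun x => F (x, t)) 2 μ ≤ ε) :
    eLpNorm (fun x => ∫ t, F (x, t) ∂ν) 2 μ ≤ ε := by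
  have two : (2 : ℝ≥0∞).toReal = 2 := by simp
  have hE : ∀ {Y : Type _} [MeasurableSpace Y] (m : Measure Y) (f : Y → E),
      eLpNorm f 2 m = (∫⁻ y, ‖f y‖ₑ ^ (2 : ℝ) ∂m) ^ (1 / 2 : ℝ) := fun m f => by
    rw [eLpNorm_eq_lintegral_rpow_enorm_toReal (by simp) (by simp), two]
  have hE' : ∀ (f : T → E),
      eLpNorm f 2 ν = (∫⁻ y, ‖f y‖ₑ ^ (2 : ℝ) ∂ν) ^ (1 / 2 : ℝ) := fun f => by
    rw [eLpNorm_eq_lintegral_rpow_enorm_toReal (by simp) (by simp), two]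
  have cancel : ∀ a : ℝ≥0∞, (a ^ (1 / 2 : ℝ)) ^ (2 : ℝ) = a := fun a => by
    rw [← ENNReal.rpow_mul]; norm_num
  have cancel' : ∀ a : ℝ≥0∞, (a ^ (2 : ℝ)) ^ (1 / 2 : ℝ) = a := fun a => by
    rw [← ENNReal.rpow_mul]; norm_num
  have hpt : ∀ᵐ x ∂μ, ‖∫ t, F (x, t) ∂ν‖ₑ ^ (2 : ℝ) ≤ ∫⁻ t, ‖F (x, t)‖ₑ ^ (2 : ℝ) ∂ν := by
    filter_upwards [hF.prodMk_left] with x hx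
    have h1 : ‖∫ t, F (x, t) ∂ν‖ₑ ≤ eLpNorm (fun t => F (x, t)) 2 ν := by
      calc ‖∫ t, F (x, t) ∂ν‖ₑ ≤ ∫⁻ t, ‖F (x, t)‖ₑ ∂ν := enorm_integral_le_lintegral_enorm _
        _ = eLpNorm (fun t => F (x, t)) 1 ν := eLpNorm_one_eq_lintegral_enorm.symm
        _ ≤ _ := eLpNorm_le_eLpNorm_of_exponent_le one_le_two hx
    calc _ ≤ (eLpNorm (fun t => F (x, t)) 2 ν) ^ (2 : ℝ) := by gcongr
      _ = _ := by rw [hE', cancel]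
  have hm : AEMeasurable (fun z : X × T => ‖F z‖ₑ ^ (2 : ℝ)) (μ.prod ν) := hF.enorm.pow_const _
  rw [hE]
  calc (∫⁻ x, ‖∫ t, F (x, t) ∂ν‖ₑ ^ (2 : ℝ) ∂μ) ^ (1 / 2 : ℝ)
      ≤ (∫⁻ x, ∫⁻ t, ‖F (x, t)‖ₑ ^ (2 : ℝ) ∂ν ∂μ) ^ (1 / 2 : ℝ) := by
        gcongr ?_ ^ _
        exact lintegral_mono_ae hpt
    _ = (∫⁻ t, ∫⁻ x, ‖F (x, t)‖ₑ ^ (2 : ℝ) ∂μ ∂ν) ^ (1 / 2 : ℝ) := by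
        rw [lintegral_lintegral_swap hm]
    _ ≤ (∫⁻ _, ε ^ (2 : ℝ) ∂ν) ^ (1 / 2 : ℝ) := by
        gcongr ?_ ^ _
        refine lintegral_mono_ae ?_
        filter_upwards [h] with t ht
        rw [hE] at ht
        calc _ = ((∫⁻ x, ‖F (x, t)‖ₑ ^ (2 : ℝ) ∂μ) ^ (1 / 2 : ℝ)) ^ (2 : ℝ) := (cancel _).symm
          _ ≤ _ := by gcongr
    _ = ε := by simp only [lintegral_const, measure_univ, mul_one]; exact cancel' ε

section

variable {F : Type*} [NormedAddCommGroup F]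

theorem map_affine_volume {r : ℝ} (hr : r ≠ 0) (c : Plane) :
    Measure.map (fun x : Plane => r • x + c) volume
      = ENNReal.ofReal |(r ^ 2)⁻¹| • (volume : Measure Plane) := by
  have h1 : (fun x : Plane => r • x + c) = (fun y => y + c) ∘ (fun x => r • x) := rfl
  rw [h1, ← Measure.map_map (measurable_add_const c) (measurable_const_smul r),
    Measure.map_addHaar_smul _ hr, Measure.map_smul]
  simp [map_add_right_eq_self]

/-- In the plane the substitution costs the factor `r⁻²` in the integral, hence `r⁻¹ ≤ 2` in the
norm. -/
theorem eLpNorm_comp_affine_le {f : Plane → F} (hf : AEStronglyMeasurable f volume) {r : ℝ}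
    (hr : 1 / 2 ≤ r) (c : Plane) :
    eLpNorm (fun x => f (r • x + c)) 2 volume ≤ 2 * eLpNorm f 2 volume := by
  have hr0 : r ≠ 0 := by linarith
  have hm : AEMeasurable (fun x : Plane => r • x + c) volume := by fun_prop
  have hf' : AEStronglyMeasurable f (Measure.map (fun x : Plane => r • x + c) volume) := by
    rw [map_affine_volume hr0]; exact hf.smul_measure _
  have := eLpNorm_map_measure (p := 2) hf' hm
  rw [show (fun x => f (r • x + c)) = f ∘ (fun x => r • x + c) from rfl, ← this,
    map_affine_volume hr0, eLpNorm_smul_measure_of_ne_top (by simp)]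
  rw [smul_eq_mul]
  gcongr
  have h4 : |(r ^ 2)⁻¹| ≤ 4 := by
    rw [abs_of_nonneg (by positivity), inv_le_comm₀ (by positivity) (by norm_num)]
    nlinarith
  calc ENNReal.ofReal |(r ^ 2)⁻¹| ^ (1 / (2 : ℝ≥0∞)).toReal
      ≤ ENNReal.ofReal 4 ^ (1 / (2 : ℝ≥0∞)).toReal := by gcongr
    _ = 2 := by
      rw [show (1 / (2 : ℝ≥0∞)).toReal = 1 / 2 by simp,
        ENNReal.ofReal_rpow_of_pos (by norm_num),
        show (4 : ℝ) = 2 ^ (2 : ℝ) by norm_num, ← Real.rpow_mul (by norm_num)]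
      norm_num

/-- `g` is uniformly continuous, and the difference lives on a fixed ball of finite measure. -/
theorem exists_comp_affine_sub_le_of_hasCompactSupport {g : Plane → F} (hg : Continuous g)
    (hc : HasCompactSupport g) {ε : ℝ≥0∞} (hε : ε ≠ 0) :
    ∃ δ > 0, ∀ (r : ℝ) (c : Plane), |r - 1| < δ → ‖c‖ < δ →
      eLpNorm (fun x => g (r • x + c) - g x) 2 volume ≤ ε := by
  obtain ⟨R, hR⟩ := hc.isBounded.subset_closedBall (0 : Plane)
  have hR' : ∀ x, R < ‖x‖ → g x = 0 := fun x hx => image_eq_zero_of_notMem_tsupport fun h => by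
    have := hR h; simp at this; linarith
  set R' : ℝ := max R 0 with hR'def
  -- Outside this ball `‖x‖ > 2R' + 2`. With `|r| > 1/2` and `‖c‖ < 1/2` this forces `‖r • x + c‖ >
  -- R'`, so both terms vanish.
  set D : Set Plane := Metric.closedBall 0 (2 * R' + 2) with hD
  have hDfin : volume D ≠ ⊤ := (isCompact_closedBall _ _).measure_lt_top.ne
  obtain ⟨ρ, hρ, hρε⟩ : ∃ ρ : ℝ, 0 < ρ ∧ volume D ^ (2 : ℝ≥0∞).toReal⁻¹ * ENNReal.ofReal ρ ≤ ε := by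
    have hlim : Tendsto (fun ρ : ℝ => volume D ^ (2 : ℝ≥0∞).toReal⁻¹ * ENNReal.ofReal ρ)
        (𝓝[>] 0) (𝓝 0) := by
      have : Tendsto (fun ρ : ℝ => ENNReal.ofReal ρ) (𝓝[>] 0) (𝓝 0) := by
        have := (ENNReal.continuous_ofReal.tendsto 0).mono_left (nhdsWithin_le_nhds (s := Set.Ioi 0))
        simpa using this
      have := ENNReal.Tendsto.const_mul (a := volume D ^ (2 : ℝ≥0∞).toReal⁻¹) this
        (Or.inr (ENNReal.rpow_ne_top_of_nonneg (by positivity) hDfin))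
      simpa using this
    have h1 := hlim.eventually (ge_mem_nhds (pos_iff_ne_zero.2 hε))
    obtain ⟨ρ, h2, h3⟩ := (h1.and self_mem_nhdsWithin).exists
    exact ⟨ρ, h3, h2⟩
  obtain ⟨δ₀, hδ₀, hu⟩ := Metric.uniformContinuous_iff.1
    (hg.uniformContinuous_of_tendsto_cocompact (x := 0) hc.is_zero_at_infty) ρ hρ
  -- On `D` the point moves by at most `|r - 1| (2R' + 2) + ‖c‖`, which this choice keeps below
  -- `δ₀`.
  refine ⟨min (1 / 2) (δ₀ / (2 * (2 * R' + 4))), by positivity, fun r c hr hcn => ?_⟩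
  have hR'0 : 0 ≤ R' := le_max_right _ _
  have hr1 : |r - 1| < 1 / 2 := hr.trans_le (min_le_left _ _)
  have hc1 : ‖c‖ < 1 / 2 := hcn.trans_le (min_le_left _ _)
  have hr2 : |r - 1| < δ₀ / (2 * (2 * R' + 4)) := hr.trans_le (min_le_right _ _)
  have hc2 : ‖c‖ < δ₀ / (2 * (2 * R' + 4)) := hcn.trans_le (min_le_right _ _)
  have hzero : ∀ x ∉ D, g (r • x + c) - g x = 0 := by
    intro x hx
    have hx' : 2 * R' + 2 < ‖x‖ := by simpa [hD] using hx
    have hRR : R ≤ R' := le_max_left _ _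
    rw [hR' x (by linarith), hR' (r • x + c), sub_zero]
    have h1 : ‖r • x‖ ≤ ‖r • x + c‖ + ‖c‖ := by
      simpa using norm_sub_le (r • x + c) c
    rw [norm_smul, Real.norm_eq_abs] at h1
    have : 1 / 2 < |r| := by
      rw [abs_lt] at hr1
      exact lt_of_lt_of_le (by linarith) (le_abs_self r)
    nlinarith [norm_nonneg x]
  have hbd : ∀ x ∈ D, ‖g (r • x + c) - g x‖ ≤ ρ := by
    intro x hx
    have hx' : ‖x‖ ≤ 2 * R' + 2 := by simpa [hD] using hx
    rw [← dist_eq_norm]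
    refine (hu ?_).le
    rw [dist_eq_norm]
    have : r • x + c - x = (r - 1) • x + c := by rw [sub_smul, one_smul]; abel
    rw [this]
    have hpos : 0 < 2 * (2 * R' + 4) := by positivity
    rw [lt_div_iff₀ hpos] at hr2 hc2
    calc ‖(r - 1) • x + c‖ ≤ |r - 1| * ‖x‖ + ‖c‖ := by
          refine (norm_add_le _ _).trans ?_; rw [norm_smul, Real.norm_eq_abs]
      _ < δ₀ := by nlinarith [abs_nonneg (r - 1), norm_nonneg c, norm_nonneg x]
  have hsupp : Function.support (fun x => g (r • x + c) - g x) ⊆ D := fun x hx => by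
    by_contra h; exact hx (hzero x h)
  rw [← eLpNorm_restrict_eq_of_support_subset hsupp]
  refine (eLpNorm_le_of_ae_bound (C := ρ) ?_).trans ?_
  · rw [ae_restrict_iff' Metric.isClosed_closedBall.measurableSet]
    exact Eventually.of_forall hbd
  · simpa using hρε

variable [NormedSpace ℝ F]

/-- Approximate `f` by a continuous `g` with compact support up to `ε / 4`. Composition with the
affine map doubles this error at most, so the three terms add up to `2 * (ε / 4) + ε / 4 + ε / 4`.
-/
theorem exists_comp_affine_sub_le {f : Plane → F} (hf : MemLp f 2 volume) {ε : ℝ≥0∞}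
    (hε : ε ≠ 0) :
    ∃ δ > 0, ∀ (r : ℝ) (c : Plane), |r - 1| < δ → ‖c‖ < δ →
      eLpNorm (fun x => f (r • x + c) - f x) 2 volume ≤ ε := by
  have hε4 : ε / 4 ≠ 0 := by simp [hε]
  obtain ⟨g, hgc, hfg, hg, hgm⟩ := hf.exists_hasCompactSupport_eLpNorm_sub_le (by simp) hε4
  obtain ⟨δ, hδ, h⟩ := exists_comp_affine_sub_le_of_hasCompactSupport hg hgc hε4
  refine ⟨min δ (1 / 2), by positivity, fun r c hr hc => ?_⟩
  have hr1 : 1 / 2 ≤ r := by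
    have := abs_lt.1 (hr.trans_le (min_le_right _ _)); linarith
  have hr0 : r ≠ 0 := by linarith
  have hm : AEMeasurable (fun x : Plane => r • x + c) volume := by fun_prop
  have hq : Measure.QuasiMeasurePreserving (fun x : Plane => r • x + c) volume volume := by
    refine ⟨by fun_prop, ?_⟩
    rw [map_affine_volume hr0]
    exact Measure.smul_absolutelyContinuous
  have m1 : AEStronglyMeasurable (fun x => (f - g) (r • x + c)) volume :=
    (hf.1.sub hgm.1).comp_quasiMeasurePreserving hq
  have m2 : AEStronglyMeasurable (fun x => g (r • x + c) - g x) volume :=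
    (hgm.1.comp_quasiMeasurePreserving hq).sub hgm.1
  have e : (fun x => f (r • x + c) - f x) = ((fun x => (f - g) (r • x + c)) +
      fun x => g (r • x + c) - g x) - (f - g) := by
    funext x; simp only [Pi.sub_apply, Pi.add_apply]; abel
  have hthird : 2 * (ε / 4) + ε / 4 + ε / 4 = ε := by
    rw [show 2 * (ε / 4) + ε / 4 + ε / 4 = 4 * (ε / 4) by ring]
    exact ENNReal.mul_div_cancel (by simp) (by simp)
  rw [e]
  calc _ ≤ eLpNorm (fun x => (f - g) (r • x + c)) 2 volume +
        eLpNorm (fun x => g (r • x + c) - g x) 2 volume + eLpNorm (f - g) 2 volume := by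
        refine (eLpNorm_sub_le (m1.add m2) (hf.1.sub hgm.1) one_le_two).trans ?_
        gcongr
        exact eLpNorm_add_le m1 m2 one_le_two
    _ ≤ 2 * (ε / 4) + ε / 4 + ε / 4 := by
        gcongr
        · exact (eLpNorm_comp_affine_le (hf.1.sub hgm.1) hr1 c).trans (by gcongr)
        · exact h r c (hr.trans_le (min_le_left _ _)) (hc.trans_le (min_le_left _ _))
    _ = ε := hthird

/-- A mollifier composed with an affine map close to the identity changes an `L²` function little
in the mean. -/
theorem exists_mollify_sub_le [CompleteSpace F] {f : Plane → F} (hf : MemLp f 2 volume) {ε : ℝ≥0∞}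
    (hε : ε ≠ 0) :
    ∃ δ > 0, ∀ (r : ℝ) (c : Plane) (η : ContDiffBump (0 : Plane)),
      |r - 1| < δ → ‖c‖ < δ → η.rOut < δ →
      eLpNorm (fun x => (∫ t, η.normed volume t • f (r • x + c - t)) - f x) 2 volume ≤ ε := by
  obtain ⟨δ, hδ, h⟩ := exists_comp_affine_sub_le hf hε
  refine ⟨min (δ / 2) (1 / 2), by positivity, fun r c η hr hc hη => ?_⟩
  have hr0 : r ≠ 0 := by
    have := abs_lt.1 (hr.trans_le (min_le_right _ _)); linarith
  set w : Plane → ℝ := η.normed volume with hw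
  have hw0 : ∀ t, 0 ≤ w t := fun t => η.nonneg_normed t
  set W : Plane → NNReal := fun t => (w t).toNNReal with hW
  have hwc : Continuous w := η.continuous_normed
  have hWm : Measurable W := hwc.measurable.real_toNNReal
  -- Convolution with the normalized bump is averaging over the probability measure `ν` with density
  -- `w`.
  set ν : Measure Plane := volume.withDensity (fun t => (W t : ℝ≥0∞)) with hν
  have hwi : Integrable w := η.integrable_normed
  have hprob : IsProbabilityMeasure ν := by
    refine ⟨?_⟩
    rw [hν, withDensity_apply _ MeasurableSet.univ, Measure.restrict_univ]
    have : ∫⁻ t, (W t : ℝ≥0∞) = ENNReal.ofReal (∫ t, w t) := by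
      rw [ofReal_integral_eq_lintegral_ofReal hwi (Eventually.of_forall hw0)]
      rfl
    rw [this, hw, η.integral_normed]
    simp
  have hac : ν ≪ volume := withDensity_absolutelyContinuous _ _
  have hint : ∀ g : Plane → F, ∫ t, g t ∂ν = ∫ t, w t • g t := fun g => by
    rw [hν, integral_withDensity_eq_integral_smul hWm]
    refine integral_congr_ae (Eventually.of_forall fun t => ?_)
    simp only [hW, NNReal.smul_def]
    rw [Real.coe_toNNReal _ (hw0 t)]
  -- `f` is measurable only up to null sets, so joint measurability of `f (r • x + c - t)` requires
  -- that preimages of null sets be null.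
  have hqm : Measure.QuasiMeasurePreserving (fun z : Plane × Plane => r • z.1 + c - z.2)
      (volume.prod ν) volume := by
    have h1 : Measure.QuasiMeasurePreserving (fun z : Plane × Plane => r • z.1 + c - z.2)
        (volume.prod volume) volume := by
      refine QuasiMeasurePreserving.prod_of_right (by fun_prop)
        (Eventually.of_forall fun x => ?_)
      exact (Measure.measurePreserving_sub_left volume (r • x + c)).quasiMeasurePreserving
    exact h1.mono_left (Measure.AbsolutelyContinuous.rfl.prod hac)
  have hF : AEStronglyMeasurable (fun z : Plane × Plane => f (r • z.1 + c - z.2) - f z.1)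
      (volume.prod ν) :=
    (hf.1.comp_quasiMeasurePreserving hqm).sub hf.1.comp_fst
  have hsupp : ∀ᵐ t ∂ν, ‖t‖ < η.rOut := by
    rw [hν, ae_withDensity_iff (by fun_prop)]
    refine Eventually.of_forall fun t ht => ?_
    have : w t ≠ 0 := fun h0 => ht (by simp [hW, h0])
    have : t ∈ Function.support (η.normed volume) := this
    rw [η.support_normed_eq] at this
    simpa using this
  -- For each fixed `t` in the support, the shift `c - t` is still small enough for the estimate
  -- without mollifier.
  have key := eLpNorm_integral_le_of_forall (ε := ε) hF (by
    filter_upwards [hsupp] with t ht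
    have := h r (c - t) (hr.trans_le ((min_le_left _ _).trans (by linarith))) (by
      have h1 := hc.trans_le (min_le_left _ _)
      have h2 := ht.trans (hη.trans_le (min_le_left _ _))
      exact (norm_sub_le _ _).trans_lt (by linarith))
    simpa only [add_sub_assoc] using this)
  refine (eLpNorm_congr_ae ?_).trans_le key
  have hfl : LocallyIntegrable f volume := hf.locallyIntegrable one_le_two
  refine Eventually.of_forall fun x => ?_
  simp only
  have i1 : Integrable (fun t => f (r • x + c - t)) ν := by
    rw [hν, integrable_withDensity_iff_integrable_smul hWm]
    have i0 : Integrable (fun t => w t • f (r • x + c - t)) volume :=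
      η.hasCompactSupport_normed.convolutionExists_left (ContinuousLinearMap.lsmul ℝ ℝ)
        hwc hfl (r • x + c)
    refine i0.congr (Eventually.of_forall fun t => ?_)
    simp only [hW, NNReal.smul_def]
    rw [Real.coe_toNNReal _ (hw0 t)]
  rw [integral_sub i1 (integrable_const _), integral_const, hint]
  simp

end

/-- `C` is mapped by affine maps arbitrarily close to the identity into the interior of `U`, with a
positive distance to the complement of `U`. -/
def ShrinksInto (C U : Set Plane) : Prop :=
  ∀ ε > 0, ∃ (r : ℝ) (c : Plane) (δ : ℝ), 0 < δ ∧ |r - 1| < ε ∧ ‖c‖ < ε ∧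
    ∀ x ∈ C, Metric.closedBall (r • x + c) δ ⊆ U

theorem memLp_indicator_of_restrict {F : Type*} [NormedAddCommGroup F] {U : Set Plane}
    (hU : IsOpen U) {v : Plane → F} {p : ℝ≥0∞}
    (hv : MemLp v p (volume.restrict U)) : MemLp (U.indicator v) p volume :=
  (memLp_indicator_iff_restrict hU.measurableSet).2 hv

open scoped Convolution in
-- The kernel `s ↦ k (w - s)` is supported in the closed ball around `w`, hence is a test function
-- on `U`; the definition of the weak gradient moves the derivative from the kernel to `v`.
theorem InH1.gradient_mollify {U : Set Plane} (hU : IsOpen U) {v : Plane → ℝ} {G : Plane → Plane}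
    (h : InH1 U v G) (η : ContDiffBump (0 : Plane)) {w : Plane}
    (hw : Metric.closedBall w η.rOut ⊆ U) :
    HasGradientAt (fun y => ∫ t, η.normed volume t • U.indicator v (y - t))
      (∫ t, η.normed volume t • U.indicator G (w - t)) w := by
  set k : Plane → ℝ := η.normed volume with hk
  have hkd : ContDiff ℝ ∞ k := η.contDiff_normed
  have hkc : HasCompactSupport k := η.hasCompactSupport_normed
  have hvl : LocallyIntegrable (U.indicator v) volume :=
    (memLp_indicator_of_restrict hU h.memLp).locallyIntegrable one_le_two
  have hGl : LocallyIntegrable (U.indicator G) volume :=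
    (memLp_indicator_of_restrict hU h.memLp_grad).locallyIntegrable one_le_two
  have hd := hkc.hasFDerivAt_convolution_left (ContinuousLinearMap.lsmul ℝ ℝ)
    (hkd.of_le (by exact_mod_cast le_top)) hvl w
  rw [hasGradientAt_iff_hasFDerivAt]
  refine HasFDerivAt.congr_fderiv hd ?_
  ext a
  have hpre : ((fderiv ℝ k ⋆[(ContinuousLinearMap.lsmul ℝ ℝ : ℝ →L[ℝ] ℝ →L[ℝ] ℝ).precompL Plane, volume]
      U.indicator v) w) a =
      ((fun t => fderiv ℝ k t a) ⋆[ContinuousLinearMap.lsmul ℝ ℝ, volume] U.indicator v) w := by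
    have := (hkc.fderiv ℝ).convolutionExists_left ((ContinuousLinearMap.lsmul ℝ ℝ : ℝ →L[ℝ] ℝ →L[ℝ] ℝ).precompL Plane :)
      (hkd.continuous_fderiv (by simp)) hvl w
    simp_rw [convolution_def, ContinuousLinearMap.integral_apply this]
    rfl
  rw [hpre]
  have iG : Integrable (fun t => k t • U.indicator G (w - t)) :=
    hkc.convolutionExists_left (ContinuousLinearMap.lsmul ℝ ℝ) hkd.continuous hGl w
  rw [InnerProductSpace.toDual_apply_apply]
  set φ : Plane → ℝ := fun s => k (w - s) with hφ
  have hφd : ContDiff ℝ ∞ φ := hkd.comp (contDiff_const.sub contDiff_id)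
  have hφt : IsTestFunction U φ := by
    refine ⟨hφd, hkc.comp_homeomorph (Homeomorph.subLeft w), ?_⟩
    refine (closure_minimal ?_ Metric.isClosed_closedBall).trans hw
    intro s hs
    have : w - s ∈ Function.support (η.normed volume) := hs
    rw [η.support_normed_eq] at this
    rw [Metric.mem_closedBall, dist_comm, dist_eq_norm]
    simpa using (le_of_lt (by simpa using this : ‖w - s‖ < η.rOut))
  have hfd : ∀ s, fderiv ℝ φ s a = - fderiv ℝ k (w - s) a := fun s => by
    have h1 : HasFDerivAt k (fderiv ℝ k (w - s)) (w - s) :=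
      (hkd.differentiable (by simp) _).hasFDerivAt
    have h2 : HasFDerivAt (fun s : Plane => w - s) (-(ContinuousLinearMap.id ℝ Plane)) s :=
      (hasFDerivAt_id s).const_sub w
    have h3 : HasFDerivAt φ _ s := h1.comp s h2
    rw [h3.fderiv]; simp
  have hweak := h.weak φ hφt
  have hv' := hφt.integrableOn_smul_gradient h.hasWeakGrad.1
  have hG' := hφt.integrableOn_smul h.hasWeakGrad.2.1
  have hw2 := congrArg (fun z => inner ℝ z a) hweak
  simp only [inner_neg_left] at hw2
  rw [real_inner_comm, ← integral_inner hv', real_inner_comm, ← integral_inner hG'] at hw2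
  rw [real_inner_comm, ← integral_inner iG]
  have eL : ((fun t => fderiv ℝ k t a) ⋆[ContinuousLinearMap.lsmul ℝ ℝ, volume] U.indicator v) w
      = - ∫ x in U, inner ℝ a (v x • gradient φ x) := by
    rw [convolution_def, ← integral_sub_left_eq_self _ volume w, ← integral_indicator hU.measurableSet,
      ← integral_neg]
    refine integral_congr_ae (Eventually.of_forall fun s => ?_)
    by_cases hs : s ∈ U
    · simp [hs, inner_smul_right, inner_gradient_right, hfd, mul_comm]
    · simp [hs]
  have eR : ∫ t, inner ℝ a (k t • U.indicator G (w - t)) = ∫ x in U, inner ℝ a (φ x • G x) := by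
    rw [← integral_sub_left_eq_self _ volume w, ← integral_indicator hU.measurableSet]
    refine integral_congr_ae (Eventually.of_forall fun s => ?_)
    by_cases hs : s ∈ U
    · simp [hs, hφ]
    · simp [hs]
  rw [eL, eR, hw2, neg_neg]

/-- Compose with an affine map that pushes `C` into `U` with some room, and mollify at a smaller
scale: at points of `C` the kernel then sees only values inside `U`, so the approximation holds up
to the boundary of `C`. The kernel is nonnegative with integral one, which preserves bounds on
`|v|`; products with the weight need this. -/
theorem InH1.exists_smooth_approx {U C : Set Plane} (hU : IsOpen U) (hC : MeasurableSet C)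
    (hCU : C ⊆ U) (hs : ShrinksInto C U) {v : Plane → ℝ} {G : Plane → Plane}
    (h : InH1 U v G) {ε : ℝ≥0∞} (hε : ε ≠ 0) :
    ∃ φ : Plane → ℝ, ContDiff ℝ ∞ φ ∧
      eLpNorm (fun x => φ x - v x) 2 (volume.restrict C) ≤ ε ∧
      eLpNorm (fun x => gradient φ x - G x) 2 (volume.restrict C) ≤ ε ∧
      ∀ B : ℝ, 0 ≤ B → (∀ x ∈ U, |v x| ≤ B) → ∀ x, |φ x| ≤ B := by
  have hvm := memLp_indicator_of_restrict hU h.memLp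
  have hGm := memLp_indicator_of_restrict hU h.memLp_grad
  have hε4 : ε / 4 ≠ 0 := by simp [hε]
  obtain ⟨δ₁, hδ₁, h₁⟩ := exists_mollify_sub_le hvm hε
  obtain ⟨δ₂, hδ₂, h₂⟩ := exists_mollify_sub_le hGm hε4
  -- The chain rule multiplies the mollified gradient by `r`. The resulting error `(r - 1) • G` is
  -- what `δ₃` controls.
  obtain ⟨δ₃, hδ₃, h₃⟩ : ∃ δ₃ : ℝ, 0 < δ₃ ∧
      ENNReal.ofReal δ₃ * eLpNorm (U.indicator G) 2 volume ≤ ε / 4 := by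
    have hlim : Tendsto (fun ρ : ℝ => ENNReal.ofReal ρ * eLpNorm (U.indicator G) 2 volume)
        (𝓝[>] 0) (𝓝 0) := by
      have : Tendsto (fun ρ : ℝ => ENNReal.ofReal ρ) (𝓝[>] 0) (𝓝 0) := by
        have := (ENNReal.continuous_ofReal.tendsto 0).mono_left (nhdsWithin_le_nhds (s := Set.Ioi 0))
        simpa using this
      have := ENNReal.Tendsto.mul_const (b := eLpNorm (U.indicator G) 2 volume) this
        (Or.inr hGm.2.ne)
      simpa using this
    obtain ⟨ρ, h2, h3⟩ := ((hlim.eventually (ge_mem_nhds (pos_iff_ne_zero.2 hε4))).and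
      self_mem_nhdsWithin).exists
    exact ⟨ρ, h3, h2⟩
  obtain ⟨r, c, δ, hδ, hr, hc, hsub⟩ := hs (min (min δ₁ δ₂) (min δ₃ 1)) (by positivity)
  have hr1 : |r - 1| < δ₁ := hr.trans_le ((min_le_left _ _).trans (min_le_left _ _))
  have hr2 : |r - 1| < δ₂ := hr.trans_le ((min_le_left _ _).trans (min_le_right _ _))
  have hr3 : |r - 1| < δ₃ := hr.trans_le ((min_le_right _ _).trans (min_le_left _ _))
  have hr4 : |r - 1| < 1 := hr.trans_le ((min_le_right _ _).trans (min_le_right _ _))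
  have hc1 : ‖c‖ < δ₁ := hc.trans_le ((min_le_left _ _).trans (min_le_left _ _))
  have hc2 : ‖c‖ < δ₂ := hc.trans_le ((min_le_left _ _).trans (min_le_right _ _))
  set d : ℝ := min δ (min δ₁ δ₂) with hd
  have hdpos : 0 < d := by positivity
  let η : ContDiffBump (0 : Plane) := ⟨d / 4, d / 2, by positivity, by linarith⟩
  have hη : η.rOut = d / 2 := rfl
  have hη1 : η.rOut < δ₁ := by
    have : d ≤ δ₁ := (min_le_right _ _).trans (min_le_left _ _)
    rw [hη]; linarith
  have hη2 : η.rOut < δ₂ := by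
    have : d ≤ δ₂ := (min_le_right _ _).trans (min_le_right _ _)
    rw [hη]; linarith
  have hηδ : η.rOut ≤ δ := by
    have : d ≤ δ := min_le_left _ _
    rw [hη]; linarith
  set k : Plane → ℝ := η.normed volume with hk
  set ψ : Plane → ℝ := fun y => ∫ t, k t • U.indicator v (y - t) with hψ
  set Ψ : Plane → Plane := fun y => ∫ t, k t • U.indicator G (y - t) with hΨ
  have hvl : LocallyIntegrable (U.indicator v) volume := hvm.locallyIntegrable one_le_two
  have hψd : ContDiff ℝ ∞ ψ :=
    HasCompactSupport.contDiff_convolution_left (ContinuousLinearMap.lsmul ℝ ℝ)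
      η.hasCompactSupport_normed (η.contDiff_normed (n := ⊤)) hvl
  have hgr : ∀ x ∈ C, gradient (fun x => ψ (r • x + c)) x = r • Ψ (r • x + c) := by
    intro x hx
    have hg := h.gradient_mollify hU η (w := r • x + c)
      ((Metric.closedBall_subset_closedBall hηδ).trans (hsub x hx))
    rw [hasGradientAt_iff_hasFDerivAt] at hg
    have hl : HasFDerivAt (fun x : Plane => r • x + c) (r • ContinuousLinearMap.id ℝ Plane) x :=
      ((hasFDerivAt_id x).const_smul r).add_const c
    refine HasGradientAt.gradient ?_
    rw [hasGradientAt_iff_hasFDerivAt]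
    refine (hg.comp x hl).congr_fderiv ?_
    ext a
    simp [hΨ, hk]
  have b1 := h₁ r c η hr1 hc1 hη1
  have b2 := h₂ r c η hr2 hc2 hη2
  refine ⟨fun x => ψ (r • x + c), hψd.comp (by fun_prop), ?_, ?_, ?_⟩
  · calc _ = eLpNorm (fun x => ψ (r • x + c) - U.indicator v x) 2 (volume.restrict C) := by
          refine eLpNorm_congr_ae ((ae_restrict_iff' hC).2 (Eventually.of_forall fun x hx => ?_))
          simp [hCU hx]
      _ ≤ _ := (eLpNorm_mono_measure _ Measure.restrict_le_self).trans b1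
  · have mΨ : AEStronglyMeasurable (fun x => Ψ (r • x + c) - U.indicator G x) volume := by
      have : Continuous Ψ :=
        HasCompactSupport.continuous_convolution_left (ContinuousLinearMap.lsmul ℝ ℝ)
          η.hasCompactSupport_normed η.continuous_normed
          (hGm.locallyIntegrable one_le_two)
      exact (this.comp (by fun_prop)).aestronglyMeasurable.sub hGm.1
    have hr2' : ‖r‖ₑ ≤ 2 := by
      rw [← ofReal_norm, Real.norm_eq_abs]
      refine ENNReal.ofReal_le_of_le_toReal ?_
      have := abs_lt.1 hr4
      rw [abs_le]
      simp only [ENNReal.toReal_ofNat]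
      constructor <;> linarith
    have hr3' : ‖r - 1‖ₑ ≤ ENNReal.ofReal δ₃ := by
      rw [← ofReal_norm, Real.norm_eq_abs]
      exact ENNReal.ofReal_le_ofReal hr3.le
    calc _ = eLpNorm ((r • fun x => (Ψ (r • x + c) - U.indicator G x)) +
            ((r - 1) • U.indicator G)) 2 (volume.restrict C) := by
          refine eLpNorm_congr_ae ((ae_restrict_iff' hC).2 (Eventually.of_forall fun x hx => ?_))
          simp only [hgr x hx, Pi.add_apply, Pi.smul_apply, hCU hx, Set.indicator_of_mem]
          rw [smul_sub, sub_smul, one_smul]; abel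
      _ ≤ eLpNorm ((r • fun x => (Ψ (r • x + c) - U.indicator G x)) +
            ((r - 1) • U.indicator G)) 2 volume := eLpNorm_mono_measure _ Measure.restrict_le_self
      _ ≤ eLpNorm (r • fun x => (Ψ (r • x + c) - U.indicator G x)) 2 volume +
            eLpNorm ((r - 1) • U.indicator G) 2 volume :=
          eLpNorm_add_le (mΨ.const_smul r) (hGm.1.const_smul _) one_le_two
      _ ≤ 2 * (ε / 4) + ε / 4 := by
          rw [eLpNorm_const_smul, eLpNorm_const_smul]
          gcongr
          exact (mul_le_mul_left hr3' _).trans h₃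
      _ ≤ 4 * (ε / 4) := by
          rw [show 2 * (ε / 4) + ε / 4 = 3 * (ε / 4) by ring]
          gcongr; norm_num
      _ = ε := ENNReal.mul_div_cancel (by simp) (by simp)
  · intro B hB hvB x
    have hb : ∀ y, ‖U.indicator v y‖ ≤ B := fun y => by
      by_cases hy : y ∈ U
      · simpa [hy] using hvB y hy
      · simpa [hy] using hB
    have : ‖ψ (r • x + c)‖ ≤ ∫ t, k t * B := by
      refine norm_integral_le_of_norm_le (η.integrable_normed.mul_const B)
        (Eventually.of_forall fun t => ?_)
      rw [norm_smul, Real.norm_of_nonneg (η.nonneg_normed t)]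
      exact mul_le_mul_of_nonneg_left (hb _) (η.nonneg_normed t)
    rw [integral_mul_const, η.integral_normed, one_mul] at this
    exact this

/-! ### The space `L²` -/

section

variable {X F : Type*} [MeasurableSpace X] {μ : Measure X} [NormedAddCommGroup F]

theorem norm_toLp_eq_sqrt {f : X → F} (hf : MemLp f 2 μ) : ‖hf.toLp f‖ = √(∫ x, ‖f x‖ ^ 2 ∂μ) := by
  rw [Lp.norm_toLp, hf.eLpNorm_eq_integral_rpow_norm (by simp) (by simp),
    ENNReal.toReal_ofReal (by positivity), Real.sqrt_eq_rpow]
  simp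

theorem sqrt_integral_add_le {f g : X → F} (hf : MemLp f 2 μ) (hg : MemLp g 2 μ) :
    √(∫ x, ‖f x + g x‖ ^ 2 ∂μ) ≤ √(∫ x, ‖f x‖ ^ 2 ∂μ) + √(∫ x, ‖g x‖ ^ 2 ∂μ) := by
  have := norm_toLp_eq_sqrt (hf.add hg)
  simp only [Pi.add_apply] at this
  rw [← this, ← norm_toLp_eq_sqrt hf, ← norm_toLp_eq_sqrt hg, MemLp.toLp_add]
  exact norm_add_le _ _

theorem tendsto_toLp {g : ℕ → X → F} {g' : X → F}
    (hg : ∀ n, MemLp (g n) 2 μ) (hg' : MemLp g' 2 μ)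
    (h : Tendsto (fun n => eLpNorm (fun x => g n x - g' x) 2 μ) atTop (𝓝 0)) :
    Tendsto (fun n => (hg n).toLp (g n)) atTop (𝓝 (hg'.toLp g')) := by
  rw [tendsto_iff_norm_sub_tendsto_zero]
  have h2 := (ENNReal.tendsto_toReal ENNReal.zero_ne_top).comp h
  refine h2.congr fun n => ?_
  rw [← MemLp.toLp_sub, Lp.norm_toLp]
  rfl

variable [InnerProductSpace ℝ F]

theorem inner_toLp_eq {f g : X → F} (hf : MemLp f 2 μ) (hg : MemLp g 2 μ) :
    inner ℝ (hf.toLp f) (hg.toLp g) = ∫ x, inner ℝ (f x) (g x) ∂μ := by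
  rw [L2.inner_def]
  refine integral_congr_ae ?_
  filter_upwards [hf.coeFn_toLp, hg.coeFn_toLp] with x h1 h2
  rw [h1, h2]

theorem integrable_inner_of_memLp {f g : X → F} (hf : MemLp f 2 μ) (hg : MemLp g 2 μ) :
    Integrable (fun x => inner ℝ (f x) (g x)) μ := by
  refine (L2.integrable_inner (𝕜 := ℝ) (hf.toLp f) (hg.toLp g)).congr ?_
  filter_upwards [hf.coeFn_toLp, hg.coeFn_toLp] with x h1 h2
  rw [h1, h2]

theorem abs_integral_inner_le {f g : X → F} (hf : MemLp f 2 μ) (hg : MemLp g 2 μ) :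
    |∫ x, inner ℝ (f x) (g x) ∂μ| ≤ √(∫ x, ‖f x‖ ^ 2 ∂μ) * √(∫ x, ‖g x‖ ^ 2 ∂μ) := by
  rw [← inner_toLp_eq hf hg, ← norm_toLp_eq_sqrt hf, ← norm_toLp_eq_sqrt hg]
  exact abs_real_inner_le_norm _ _

theorem integrable_norm_sq_of_memLp {f : X → F} (hf : MemLp f 2 μ) :
    Integrable (fun x => ‖f x‖ ^ 2) μ := by
  simpa only [real_inner_self_eq_norm_sq] using integrable_inner_of_memLp hf hf

theorem tendsto_integral_inner {f : X → F} {g : ℕ → X → F} {g' : X → F} (hf : MemLp f 2 μ)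
    (hg : ∀ n, MemLp (g n) 2 μ) (hg' : MemLp g' 2 μ)
    (h : Tendsto (fun n => eLpNorm (fun x => g n x - g' x) 2 μ) atTop (𝓝 0)) :
    Tendsto (fun n => ∫ x, inner ℝ (f x) (g n x) ∂μ) atTop (𝓝 (∫ x, inner ℝ (f x) (g' x) ∂μ)) := by
  have h3 := (tendsto_const_nhds (x := hf.toLp f)).inner (𝕜 := ℝ) (tendsto_toLp hg hg' h)
  simpa only [inner_toLp_eq] using h3

end

theorem integrable_smul_of_memLp {X F : Type*} [MeasurableSpace X] {μ : Measure X}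
    [NormedAddCommGroup F] [NormedSpace ℝ F] {f : X → ℝ} {g : X → F}
    (hf : MemLp f 2 μ) (hg : MemLp g 2 μ) : Integrable (fun x => f x • g x) μ :=
  memLp_one_iff_integrable.1 (hg.smul hf)

theorem exists_ne_zero_mul_le {ε : ℝ≥0∞} (hε : ε ≠ 0) (C : ℝ) :
    ∃ δ : ℝ≥0∞, δ ≠ 0 ∧ δ ≤ ε ∧ ENNReal.ofReal C * δ ≤ ε := by
  have hC : ENNReal.ofReal C + 1 ≠ ⊤ := by simp
  refine ⟨ε / (ENNReal.ofReal C + 1), ENNReal.div_ne_zero.2 ⟨hε, hC⟩, ?_, ?_⟩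
  · exact ENNReal.div_le_of_le_mul (le_mul_of_one_le_right' le_add_self)
  · calc _ ≤ (ENNReal.ofReal C + 1) * (ε / (ENNReal.ofReal C + 1)) := by
          gcongr; exact le_self_add
      _ ≤ ε := ENNReal.mul_div_le

theorem tendsto_zero_of_le_inv {f : ℕ → ℝ≥0∞} (h : ∀ n, f n ≤ ((n : ℝ≥0∞) + 1)⁻¹) :
    Tendsto f atTop (𝓝 0) := by
  refine tendsto_of_tendsto_of_tendsto_of_le_of_le tendsto_const_nhds ?_ (fun _ => zero_le) h
  have := (ENNReal.tendsto_inv_nat_nhds_zero).comp (tendsto_add_atTop_nat 1)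
  refine this.congr fun n => ?_
  simp

theorem inv_natCast_add_one_ne_zero (n : ℕ) : ((n : ℝ≥0∞) + 1)⁻¹ ≠ 0 := by
  simp

theorem exists_norm_le_of_memLp_top {F : Type*} [NormedAddCommGroup F] {U : Set Plane}
    {A : Plane → F} (hA : MemLp A ⊤ (volume.restrict U)) :
    ∃ c : ℝ, 0 ≤ c ∧ ∀ᵐ x ∂(volume.restrict U), ‖A x‖ ≤ c := by
  refine ⟨(eLpNorm A ⊤ (volume.restrict U)).toReal, ENNReal.toReal_nonneg, ?_⟩
  have h := ae_le_eLpNormEssSup (f := A) (μ := volume.restrict U)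
  filter_upwards [h] with x hx
  rw [← eLpNorm_exponent_top] at hx
  have := ENNReal.toReal_mono hA.2.ne hx
  simpa using this

theorem memLp_mul_of_bound {F : Type*} [NormedAddCommGroup F] [NormedSpace ℝ F] {X : Type*}
    [MeasurableSpace X] {μ : Measure X} {a : X → ℝ} {G : X → F}
    (ha : AEStronglyMeasurable a μ) {c : ℝ} (hc : ∀ᵐ x ∂μ, ‖a x‖ ≤ c) {p : ℝ≥0∞}
    (hG : MemLp G p μ) : MemLp (fun x => a x • G x) p μ := by
  refine hG.of_le_mul (c := c) (ha.smul hG.1) ?_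
  filter_upwards [hc] with x hx
  rw [norm_smul]
  gcongr

theorem memLp_smul_of_bound {F : Type*} [NormedAddCommGroup F] [NormedSpace ℝ F] {X : Type*}
    [MeasurableSpace X] {μ : Measure X} {a : X → ℝ} {G : X → F}
    (hG : AEStronglyMeasurable G μ) {c : ℝ} (hc : ∀ᵐ x ∂μ, ‖G x‖ ≤ c) {p : ℝ≥0∞}
    (ha : MemLp a p μ) : MemLp (fun x => a x • G x) p μ := by
  refine ha.of_le_mul (c := c) (ha.1.smul hG) ?_
  filter_upwards [hc] with x hx
  rw [norm_smul, mul_comm]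
  gcongr

/-- The identity map suffices, since a compact subset of an open set has positive distance to the
complement. -/
theorem shrinksInto_of_isCompact {C U : Set Plane} (hC : IsCompact C) (hU : IsOpen U)
    (hCU : C ⊆ U) : ShrinksInto C U := by
  obtain ⟨δ, hδ, h⟩ := hC.exists_cthickening_subset_open hU hCU
  refine fun ε hε => ⟨1, 0, δ, hδ, by simpa using hε, by simpa using hε, fun x hx => ?_⟩
  rw [one_smul, add_zero]
  exact (Metric.closedBall_subset_cthickening hx δ).trans h

/-! ### Products with `W^{1,∞}` functions -/

/-- `α ∈ W^{1,∞}(U)` with `|α| ≤ 1` on `U` and weak gradient `A`, on a bounded set `U`. -/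
structure InW1 (U : Set Plane) (α : Plane → ℝ) (A : Plane → Plane) : Prop where
  inH1 : InH1 U α A
  abs_le : ∀ x ∈ U, |α x| ≤ 1
  memLp_grad : MemLp A ⊤ (volume.restrict U)

theorem InW1.mono {U V : Set Plane} (hVU : V ⊆ U) {α : Plane → ℝ} {A : Plane → Plane}
    (h : InW1 U α A) : InW1 V α A :=
  ⟨h.inH1.mono hVU, fun x hx => h.abs_le x (hVU hx),
    h.memLp_grad.mono_measure (Measure.restrict_mono hVU le_rfl)⟩

theorem InW1.ae_norm_le {U : Set Plane} (hU : IsOpen U) {α : Plane → ℝ} {A : Plane → Plane}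
    (h : InW1 U α A) : ∀ᵐ x ∂(volume.restrict U), ‖α x‖ ≤ 1 :=
  (ae_restrict_iff' hU.measurableSet).2 (Eventually.of_forall fun x hx => h.abs_le x hx)

/-- The sequential form of the density result, with errors below `1 / (n + 1)`. -/
theorem InH1.exists_seq {U C : Set Plane} (hU : IsOpen U) (hC : MeasurableSet C)
    (hCU : C ⊆ U) (hs : ShrinksInto C U) {v : Plane → ℝ} {G : Plane → Plane}
    (h : InH1 U v G) :
    ∃ φ : ℕ → Plane → ℝ, (∀ n, ContDiff ℝ ∞ (φ n)) ∧
      Tendsto (fun n => eLpNorm (fun x => φ n x - v x) 2 (volume.restrict C)) atTop (𝓝 0) ∧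
      Tendsto (fun n => eLpNorm (fun x => gradient (φ n) x - G x) 2 (volume.restrict C))
        atTop (𝓝 0) := by
  choose φ h1 h2 h3 _ using fun n : ℕ =>
    h.exists_smooth_approx hU hC hCU hs (inv_natCast_add_one_ne_zero n)
  exact ⟨φ, h1, tendsto_zero_of_le_inv h2, tendsto_zero_of_le_inv h3⟩

theorem setIntegral_eq_of_subset {F : Type*} [NormedAddCommGroup F] [NormedSpace ℝ F]
    {C U : Set Plane} (hCU : C ⊆ U) {f : Plane → F}
    (hf : ∀ x ∉ C, f x = 0) : ∫ x in U, f x = ∫ x in C, f x := by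
  rw [setIntegral_eq_integral_of_forall_compl_eq_zero (fun x hx => hf x fun h => hx (hCU h)),
    setIntegral_eq_integral_of_forall_compl_eq_zero hf]

/-- `φ w` is itself a test function, and its gradient splits by the product rule. With all three
terms on one side, every term can be passed to the limit in `w`. -/
theorem InW1.weak_mul_smooth {U : Set Plane} {α : Plane → ℝ} {A : Plane → Plane}
    (hα : InW1 U α A) {φ w : Plane → ℝ} (hφ : IsTestFunction U φ) (hw : ContDiff ℝ ∞ w) :
    (∫ x in U, (α x * w x) • gradient φ x) +
      ((∫ x in U, (φ x * α x) • gradient w x) + ∫ x in U, (φ x * w x) • A x) = 0 := by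
  have ht : IsTestFunction U (fun x => φ x * w x) :=
    ⟨hφ.1.mul hw, hφ.2.1.mul_right, (tsupport_mul_subset_left).trans hφ.2.2⟩
  have h1 := hα.inH1.weak _ ht
  have hαl := hα.inH1.hasWeakGrad.1
  have dφ := hφ.1.differentiable (by simp)
  have dw := hw.differentiable (by simp)
  have e : ∀ x, α x • gradient (fun x => φ x * w x) x =
      (α x * w x) • gradient φ x + (φ x * α x) • gradient w x := fun x => by
    rw [gradient_mul (dφ x) (dw x), smul_add, smul_smul, smul_smul, mul_comm (φ x), add_comm]
  have hle : volume.restrict (tsupport φ) ≤ volume.restrict U := Measure.restrict_mono hφ.2.2 le_rfl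
  have hb := hφ.2.1.isBounded
  have mα : MemLp α 2 (volume.restrict (tsupport φ)) := hα.inH1.memLp.mono_measure hle
  have q1 : IntegrableOn (fun x => (α x * w x) • gradient φ x) U := by
    have h2 : IntegrableOn (fun x => (α x * w x) • gradient φ x) (tsupport φ) := by
      refine (integrable_smul_of_memLp mα (memLp_of_continuous_of_isBounded hb
        (hw.continuous.smul (continuous_gradient hφ.1)) 2)).congr
        (Eventually.of_forall fun x => ?_)
      simp only [Pi.smul_apply', smul_smul]
    refine (h2.integrable_of_forall_notMem_eq_zero fun x hx => ?_).integrableOn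
    simp [gradient_eq_zero_of_notMem_tsupport hx]
  have q2 : IntegrableOn (fun x => (φ x * α x) • gradient w x) U := by
    have h2 : IntegrableOn (fun x => (φ x * α x) • gradient w x) (tsupport φ) := by
      refine (integrable_smul_of_memLp mα (memLp_of_continuous_of_isBounded hb
        (hφ.continuous.smul (continuous_gradient hw)) 2)).congr
        (Eventually.of_forall fun x => ?_)
      simp only [Pi.smul_apply', smul_smul, mul_comm]
    refine (h2.integrable_of_forall_notMem_eq_zero fun x hx => ?_).integrableOn
    simp [image_eq_zero_of_notMem_tsupport hx]
  simp only [e] at h1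
  rw [integral_add q1 q2] at h1
  rw [← add_assoc, h1, neg_add_cancel]

/-- The pairing of `(f, H)` with the coefficients of the product rule, tested with `a`. -/
theorem inner_product_rule {X : Type*} [MeasurableSpace X] {μ : Measure X} {α φ f : X → ℝ}
    {A H g : X → Plane} (p1 : MemLp (fun x => α x • g x) 2 μ)
    (p2 : MemLp (fun x => φ x • A x) 2 μ) (p3 : MemLp (fun x => φ x * α x) 2 μ) (a : Plane)
    (hf : MemLp f 2 μ) (hH : MemLp H 2 μ) :
    inner ℝ a ((∫ x, (α x * f x) • g x ∂μ) +
      ((∫ x, (φ x * α x) • H x ∂μ) + ∫ x, (φ x * f x) • A x ∂μ)) =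
    (∫ x, inner ℝ (inner ℝ a (α x • g x) + inner ℝ a (φ x • A x)) (f x) ∂μ) +
      ∫ x, inner ℝ ((φ x * α x) • a) (H x) ∂μ := by
  have q1 : Integrable (fun x => (α x * f x) • g x) μ := by
    refine (integrable_smul_of_memLp hf p1).congr (Eventually.of_forall fun x => ?_)
    simp only [smul_smul, mul_comm]
  have q2 : Integrable (fun x => (φ x * f x) • A x) μ := by
    refine (integrable_smul_of_memLp hf p2).congr (Eventually.of_forall fun x => ?_)
    simp only [smul_smul, mul_comm]
  have q3 : Integrable (fun x => (φ x * α x) • H x) μ := integrable_smul_of_memLp p3 hH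
  rw [inner_add_right, inner_add_right, ← integral_inner q1,
    ← integral_inner q2, ← integral_inner q3]
  have e1 : ∀ x, inner ℝ (inner ℝ a (α x • g x) + inner ℝ a (φ x • A x)) (f x) =
      inner ℝ a ((α x * f x) • g x) + inner ℝ a ((φ x * f x) • A x) := fun x => by
    simp only [inner_smul_right, RCLike.inner_apply, conj_trivial]; ring
  have e2 : ∀ x, inner ℝ ((φ x * α x) • a) (H x) = inner ℝ a ((φ x * α x) • H x) := fun x => by
    simp only [inner_smul_right, real_inner_smul_left]
  simp only [e1, e2]
  rw [integral_add (q1.const_inner a) (q2.const_inner a)]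
  ring

/-- For a smooth factor the identity is `InW1.weak_mul_smooth`. On the compact support of `φ` the
function `v` is a limit of smooth functions together with the gradients, and after pairing with a
fixed vector each term is a continuous functional of the pair in `L²`. -/
theorem InH1.mul_inW1 {U : Set Plane} (hU : IsOpen U)
    {v α : Plane → ℝ} {G A : Plane → Plane} (hv : InH1 U v G) (hα : InW1 U α A) :
    InH1 U (fun x => α x * v x) (fun x => α x • G x + v x • A x) := by
  obtain ⟨c, hc0, hc⟩ := exists_norm_le_of_memLp_top hα.memLp_grad
  have hα1 := hα.ae_norm_le hU
  have mv : MemLp (fun x => α x * v x) 2 (volume.restrict U) :=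
    memLp_mul_of_bound hα.inH1.memLp.1 hα1 hv.memLp
  have m1 : MemLp (fun x => α x • G x) 2 (volume.restrict U) :=
    memLp_mul_of_bound hα.inH1.memLp.1 hα1 hv.memLp_grad
  have m2 : MemLp (fun x => v x • A x) 2 (volume.restrict U) :=
    memLp_smul_of_bound hα.memLp_grad.1 hc hv.memLp
  refine ⟨mv, m1.add m2, fun φ hφ => ?_⟩
  obtain ⟨C, hC⟩ : ∃ C, C = tsupport φ := ⟨_, rfl⟩
  have hCm : MeasurableSet C := hC ▸ (isClosed_tsupport φ).measurableSet
  have hCU : C ⊆ U := hC ▸ hφ.2.2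
  have hCb : Bornology.IsBounded C := hC ▸ hφ.2.1.isBounded
  have hz1 : ∀ x ∉ C, φ x = 0 := fun x hx => image_eq_zero_of_notMem_tsupport (hC ▸ hx)
  have hz2 : ∀ x ∉ C, gradient φ x = 0 := fun x hx =>
    gradient_eq_zero_of_notMem_tsupport (hC ▸ hx)
  obtain ⟨w, hw, hwv, hwG⟩ := hv.exists_seq hU hCm hCU
    (shrinksInto_of_isCompact (hC ▸ hφ.2.1) hU hCU)
  have hle : volume.restrict C ≤ volume.restrict U := Measure.restrict_mono hCU le_rfl
  have mφ : MemLp φ 2 (volume.restrict C) :=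
    memLp_of_continuous_of_isBounded hCb hφ.continuous 2
  have mgφ : MemLp (gradient φ) 2 (volume.restrict C) :=
    memLp_of_continuous_of_isBounded hCb (continuous_gradient hφ.1) 2
  have hcC : ∀ᵐ x ∂(volume.restrict C), ‖A x‖ ≤ c := ae_mono hle hc
  have hα1C : ∀ᵐ x ∂(volume.restrict C), ‖α x‖ ≤ 1 := ae_mono hle hα1
  have mαC : AEStronglyMeasurable α (volume.restrict C) := hα.inH1.memLp.1.mono_measure hle
  have mAC : AEStronglyMeasurable A (volume.restrict C) := hα.memLp_grad.1.mono_measure hle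
  have p1 : MemLp (fun x => α x • gradient φ x) 2 (volume.restrict C) :=
    memLp_mul_of_bound mαC hα1C mgφ
  have p2 : MemLp (fun x => φ x • A x) 2 (volume.restrict C) :=
    memLp_smul_of_bound mAC hcC mφ
  have p3 : MemLp (fun x => φ x * α x) 2 (volume.restrict C) := by
    refine (memLp_mul_of_bound mαC hα1C mφ).ae_eq (Eventually.of_forall fun x => ?_)
    exact mul_comm _ _
  have mwn : ∀ n, MemLp (w n) 2 (volume.restrict C) := fun n =>
    memLp_of_continuous_of_isBounded hCb (hw n).continuous 2
  have mgwn : ∀ n, MemLp (gradient (w n)) 2 (volume.restrict C) := fun n =>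
    memLp_of_continuous_of_isBounded hCb (continuous_gradient (hw n)) 2
  have mvC : MemLp v 2 (volume.restrict C) := hv.memLp.mono_measure hle
  have mGC : MemLp G 2 (volume.restrict C) := hv.memLp_grad.mono_measure hle
  have hzero : ∀ n, (∫ x in C, (α x * w n x) • gradient φ x) +
      ((∫ x in C, (φ x * α x) • gradient (w n) x) + ∫ x in C, (φ x * w n x) • A x) = 0 := by
    intro n
    rw [← hα.weak_mul_smooth hφ (hw n),
      setIntegral_eq_of_subset hCU fun x hx => by rw [hz2 x hx, smul_zero],
      setIntegral_eq_of_subset hCU fun x hx => by rw [hz1 x hx, zero_mul, zero_smul],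
      setIntegral_eq_of_subset hCU fun x hx => by rw [hz1 x hx, zero_mul, zero_smul]]
  have q2 : Integrable (fun x => (φ x * v x) • A x) (volume.restrict C) := by
    refine (integrable_smul_of_memLp mvC p2).congr (Eventually.of_forall fun x => ?_)
    simp only [smul_smul, mul_comm]
  have q3 : Integrable (fun x => (φ x * α x) • G x) (volume.restrict C) :=
    integrable_smul_of_memLp p3 mGC
  rw [setIntegral_eq_of_subset hCU fun x hx => by rw [hz2 x hx, smul_zero],
    setIntegral_eq_of_subset hCU fun x hx => by rw [hz1 x hx, zero_smul],
    ← add_eq_zero_iff_eq_neg]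
  simp only [smul_add, smul_smul]
  rw [integral_add q3 q2]
  refine ext_inner_left ℝ fun a => ?_
  rw [inner_product_rule p1 p2 p3 a mvC mGC, inner_zero_right]
  have mL : MemLp (fun x => inner ℝ a (α x • gradient φ x) + inner ℝ a (φ x • A x)) 2
      (volume.restrict C) := by
    have l1 : MemLp (fun x => inner ℝ a (α x • gradient φ x)) 2 (volume.restrict C) :=
      p1.const_inner (𝕜 := ℝ) a
    have l2 : MemLp (fun x => inner ℝ a (φ x • A x)) 2 (volume.restrict C) :=
      p2.const_inner (𝕜 := ℝ) a
    exact l1.add l2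
  have mR : MemLp (fun x => (φ x * α x) • a) 2 (volume.restrict C) :=
    memLp_smul_of_bound aestronglyMeasurable_const (c := ‖a‖) (Eventually.of_forall fun _ => le_rfl)
      p3
  have t1 := tendsto_integral_inner mL mwn mvC hwv
  have t2 := tendsto_integral_inner mR mgwn mGC hwG
  refine tendsto_nhds_unique (t1.add t2) ?_
  refine tendsto_const_nhds.congr fun n => ?_
  rw [← inner_product_rule p1 p2 p3 a (mwn n) (mgwn n), hzero n, inner_zero_right]

/-! ### Traces -/

/-- Sequences are replaced by a tolerance `ε`, and the chosen `weakGrad` by any known gradient `G`;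
this form is the one that composes well. -/
theorem hasTrace_iff {U Γ : Set Plane} (hU : IsOpen U) {u g : Plane → ℝ} {G : Plane → Plane}
    (hu : InH1 U u G) : HasTrace U Γ u g ↔ MemLp g 2 ((μH[1] : Measure Plane).restrict Γ) ∧
      ∀ ε : ℝ≥0∞, ε ≠ 0 → ∃ φ : Plane → ℝ, ContDiff ℝ ∞ φ ∧
        eLpNorm (fun x => φ x - u x) 2 (volume.restrict U) ≤ ε ∧
        eLpNorm (fun x => gradient φ x - G x) 2 (volume.restrict U) ≤ ε ∧
        eLpNorm (fun x => φ x - g x) 2 ((μH[1] : Measure Plane).restrict Γ) ≤ ε := by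
  have hG : ∀ φ : Plane → ℝ,
      eLpNorm (fun x => gradient φ x - weakGrad U u x) 2 (volume.restrict U) =
      eLpNorm (fun x => gradient φ x - G x) 2 (volume.restrict U) := fun φ => by
    refine eLpNorm_congr_ae ?_
    filter_upwards [hu.weakGrad_ae_eq hU] with x hx
    rw [hx]
  constructor
  · rintro ⟨-, h1, φ, h2, h3, h4, h5⟩
    refine ⟨h1, fun ε hε => ?_⟩
    have hε' := ge_mem_nhds (pos_iff_ne_zero.2 hε)
    obtain ⟨n, h6, h7, h8⟩ := ((h3.eventually hε').and
      ((h4.eventually hε').and (h5.eventually hε'))).exists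
    exact ⟨φ n, h2 n, h6, (hG _).symm.trans_le h7, h8⟩
  · rintro ⟨h1, h2⟩
    choose φ h3 h4 h5 h6 using fun n : ℕ => h2 _ (inv_natCast_add_one_ne_zero n)
    exact ⟨hu.memH1, h1, φ, h3, tendsto_zero_of_le_inv h4,
      tendsto_zero_of_le_inv fun n => (hG _).trans_le (h5 n), tendsto_zero_of_le_inv h6⟩

theorem eLpNorm_fun_add_le {X F : Type*} [MeasurableSpace X] {μ : Measure X} [NormedAddCommGroup F]
    {f g h : X → F} (hf : AEStronglyMeasurable f μ) (hg : AEStronglyMeasurable g μ)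
    (e : ∀ x, h x = f x + g x) {ε : ℝ≥0∞} (h1 : eLpNorm f 2 μ ≤ ε / 2)
    (h2 : eLpNorm g 2 μ ≤ ε / 2) : eLpNorm h 2 μ ≤ ε := by
  rw [show h = f + g from funext e]
  calc _ ≤ _ := eLpNorm_add_le hf hg one_le_two
    _ ≤ ε / 2 + ε / 2 := add_le_add h1 h2
    _ = ε := ENNReal.add_halves ε

section

variable {U Γ : Set Plane}

theorem HasTrace.memLp {u g : Plane → ℝ} (h : HasTrace U Γ u g) :
    MemLp g 2 ((μH[1] : Measure Plane).restrict Γ) := h.2.1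

/-- Approximants of approximants: the graph of the trace is closed in `H¹ × L²`. Closedness of `V₀`
rests on it. -/
theorem hasTrace_of_approx (hU : IsOpen U) (hb : Bornology.IsBounded U) {u g : Plane → ℝ}
    {G : Plane → Plane} (hu : InH1 U u G)
    (hg : MemLp g 2 ((μH[1] : Measure Plane).restrict Γ))
    (h : ∀ ε : ℝ≥0∞, ε ≠ 0 → ∃ (w : Plane → ℝ) (H : Plane → Plane) (g' : Plane → ℝ),
      InH1 U w H ∧ HasTrace U Γ w g' ∧
      eLpNorm (fun x => w x - u x) 2 (volume.restrict U) ≤ ε ∧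
      eLpNorm (fun x => H x - G x) 2 (volume.restrict U) ≤ ε ∧
      eLpNorm (fun x => g' x - g x) 2 ((μH[1] : Measure Plane).restrict Γ) ≤ ε) :
    HasTrace U Γ u g := by
  rw [hasTrace_iff hU hu]
  refine ⟨hg, fun ε hε => ?_⟩
  have hε2 : ε / 2 ≠ 0 := by simp [hε]
  obtain ⟨w, H, g', hw, ht, h1, h2, h3⟩ := h (ε / 2) hε2
  obtain ⟨φ, hφ, k1, k2, k3⟩ := ((hasTrace_iff hU hw).1 ht).2 (ε / 2) hε2
  have mφ := memLp_of_continuous_of_isBounded hb hφ.continuous 2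
  have mgφ := memLp_of_continuous_of_isBounded hb (continuous_gradient hφ) 2
  refine ⟨φ, hφ, ?_, ?_, ?_⟩
  · exact eLpNorm_fun_add_le (mφ.1.sub hw.memLp.1) (hw.memLp.1.sub hu.memLp.1)
      (fun x => (sub_add_sub_cancel _ _ _).symm) k1 h1
  · exact eLpNorm_fun_add_le (mgφ.1.sub hw.memLp_grad.1) (hw.memLp_grad.1.sub hu.memLp_grad.1)
      (fun x => (sub_add_sub_cancel _ _ _).symm) k2 h2
  · exact eLpNorm_fun_add_le (hφ.continuous.aestronglyMeasurable.sub ht.memLp.1)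
      (ht.memLp.1.sub hg.1) (fun x => (sub_add_sub_cancel _ _ _).symm) k3 h3

theorem HasTrace.add (hU : IsOpen U) (hb : Bornology.IsBounded U) {u v g k : Plane → ℝ}
    (hu : HasTrace U Γ u g) (hv : HasTrace U Γ v k) :
    HasTrace U Γ (fun x => u x + v x) (fun x => g x + k x) := by
  have iu := hu.1.inH1 hU
  have iv := hv.1.inH1 hU
  rw [hasTrace_iff hU (iu.add iv)]
  refine ⟨hu.memLp.add hv.memLp, fun ε hε => ?_⟩
  have hε2 : ε / 2 ≠ 0 := by simp [hε]
  obtain ⟨φ, hφ, h1, h2, h3⟩ := ((hasTrace_iff hU iu).1 hu).2 _ hε2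
  obtain ⟨ψ, hψ, k1, k2, k3⟩ := ((hasTrace_iff hU iv).1 hv).2 _ hε2
  have mφ := memLp_of_continuous_of_isBounded hb hφ.continuous 2
  have mgφ := memLp_of_continuous_of_isBounded hb (continuous_gradient hφ) 2
  have mψ := memLp_of_continuous_of_isBounded hb hψ.continuous 2
  have mgψ := memLp_of_continuous_of_isBounded hb (continuous_gradient hψ) 2
  refine ⟨fun x => φ x + ψ x, hφ.add hψ, ?_, ?_, ?_⟩
  · exact eLpNorm_fun_add_le (mφ.1.sub iu.memLp.1) (mψ.1.sub iv.memLp.1)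
      (fun x => by simp only [Pi.sub_apply]; ring) h1 k1
  · refine eLpNorm_fun_add_le (mgφ.1.sub iu.memLp_grad.1) (mgψ.1.sub iv.memLp_grad.1)
      (fun x => ?_) h2 k2
    rw [gradient_add (hφ.differentiable (by simp) x) (hψ.differentiable (by simp) x)]
    simp only [Pi.sub_apply]; abel
  · exact eLpNorm_fun_add_le (hφ.continuous.aestronglyMeasurable.sub hu.memLp.1)
      (hψ.continuous.aestronglyMeasurable.sub hv.memLp.1)
      (fun x => by simp only [Pi.sub_apply]; ring) h3 k3

theorem eLpNorm_const_smul_le_of_le {X F : Type*} [MeasurableSpace X] {μ : Measure X}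
    [NormedAddCommGroup F] [NormedSpace ℝ F] {f h : X → F} {r : ℝ} {ε δ : ℝ≥0∞}
    (e : ∀ x, h x = r • f x) (hδ : ENNReal.ofReal |r| * δ ≤ ε) (h1 : eLpNorm f 2 μ ≤ δ) :
    eLpNorm h 2 μ ≤ ε := by
  rw [show h = r • f from funext e, eLpNorm_const_smul, ← ofReal_norm, Real.norm_eq_abs]
  exact (mul_le_mul_right h1 _).trans hδ

theorem HasTrace.const_mul (hU : IsOpen U) {u g : Plane → ℝ}
    (hu : HasTrace U Γ u g) (r : ℝ) :
    HasTrace U Γ (fun x => r * u x) (fun x => r * g x) := by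
  have iu := hu.1.inH1 hU
  rw [hasTrace_iff hU (iu.const_mul r)]
  refine ⟨hu.memLp.const_mul r, fun ε hε => ?_⟩
  obtain ⟨δ, hδ, -, hδε⟩ := exists_ne_zero_mul_le hε |r|
  obtain ⟨φ, hφ, h1, h2, h3⟩ := ((hasTrace_iff hU iu).1 hu).2 _ hδ
  refine ⟨fun x => r * φ x, contDiff_const.mul hφ, ?_, ?_, ?_⟩
  · exact eLpNorm_const_smul_le_of_le (fun x => by rw [smul_eq_mul]; ring) hδε h1
  · refine eLpNorm_const_smul_le_of_le (fun x => ?_) hδε h2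
    rw [gradient_smul (hφ.differentiable (by simp) x), smul_sub]
  · exact eLpNorm_const_smul_le_of_le (fun x => by rw [smul_eq_mul]; ring) hδε h3

theorem HasTrace.sub (hU : IsOpen U) (hb : Bornology.IsBounded U) {u v g k : Plane → ℝ}
    (hu : HasTrace U Γ u g) (hv : HasTrace U Γ v k) :
    HasTrace U Γ (fun x => u x - v x) (fun x => g x - k x) := by
  have := hu.add hU hb (hv.const_mul hU (-1))
  simpa only [neg_mul, one_mul, ← sub_eq_add_neg] using this

theorem hasTrace_of_contDiff (hU : IsOpen U) (hb : Bornology.IsBounded U) {ψ u g : Plane → ℝ}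
    (hψ : ContDiff ℝ ∞ ψ) (hu : ∀ x ∈ U, u x = ψ x) (hg : ∀ x ∈ Γ, g x = ψ x)
    (hΓ : MeasurableSet Γ) (hm : MemLp ψ 2 ((μH[1] : Measure Plane).restrict Γ)) :
    HasTrace U Γ u g := by
  have e1 : ψ =ᵐ[volume.restrict U] u :=
    (ae_restrict_iff' hU.measurableSet).2 (Eventually.of_forall fun x hx => (hu x hx).symm)
  have e2 : ψ =ᵐ[(μH[1] : Measure Plane).restrict Γ] g :=
    (ae_restrict_iff' hΓ).2 (Eventually.of_forall fun x hx => (hg x hx).symm)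
  have i : InH1 U u (gradient ψ) := (inH1_of_contDiff hb hψ).congr e1 EventuallyEq.rfl
  rw [hasTrace_iff hU i]
  refine ⟨hm.ae_eq e2, fun ε hε => ⟨ψ, hψ, ?_, ?_, ?_⟩⟩
  · rw [eLpNorm_congr_ae (g := fun _ => 0) (by filter_upwards [e1] with x hx; rw [hx, sub_self])]
    simp
  · simp
  · rw [eLpNorm_congr_ae (g := fun _ => 0) (by filter_upwards [e2] with x hx; rw [hx, sub_self])]
    simp

/-- The product of an `H¹` function of zero trace with a bounded `W^{1,∞}` function has zero
trace. -/
theorem HasTrace.mul_inW1 (hU : IsOpen U) (hb : Bornology.IsBounded U) (hs : ShrinksInto U U)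
    {v α : Plane → ℝ} {A : Plane → Plane} (hv : HasTrace U Γ v 0) (hα : InW1 U α A) :
    HasTrace U Γ (fun x => α x * v x) 0 := by
  have iv := hv.1.inH1 hU
  set G := weakGrad U v
  obtain ⟨c, hc0, hc⟩ := exists_norm_le_of_memLp_top hα.memLp_grad
  have hα1 := hα.ae_norm_le hU
  rw [hasTrace_iff hU (iv.mul_inW1 hU hα)]
  refine ⟨MemLp.zero, fun ε hε => ?_⟩
  have hε4 : ε / 2 / 2 ≠ 0 := by simp [hε]
  -- The order of choices matters. First `φ` approximates `v`, with a tolerance that depends on the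
  -- bound of `A`; only then does `ψ` approximate `α`, with a tolerance that depends on the bounds
  -- of `φ` and its gradient.
  obtain ⟨ε₁, hε₁, hε₁le, hε₁c⟩ := exists_ne_zero_mul_le hε4 c
  obtain ⟨φ, hφ, k1, k2, k3⟩ := ((hasTrace_iff hU iv).1 hv).2 _ hε₁
  have mφ := fun p => memLp_of_continuous_of_isBounded hb hφ.continuous p
  have mgφ := fun p => memLp_of_continuous_of_isBounded hb (continuous_gradient hφ) p
  obtain ⟨c₁, -, hc₁⟩ := exists_norm_le_of_memLp_top (mφ ⊤)
  obtain ⟨c₂, -, hc₂⟩ := exists_norm_le_of_memLp_top (mgφ ⊤)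
  obtain ⟨δ₁, hδ₁, hδ₁le, hδ₁c⟩ := exists_ne_zero_mul_le hε4 c₁
  obtain ⟨δ, hδ, hδle, hδc⟩ := exists_ne_zero_mul_le hδ₁ c₂
  obtain ⟨ψ, hψ, l1, l2, l3⟩ :=
    hα.inH1.exists_smooth_approx hU hU.measurableSet subset_rfl hs hδ
  have mψ := memLp_of_continuous_of_isBounded hb hψ.continuous 2
  have mgψ := memLp_of_continuous_of_isBounded hb (continuous_gradient hψ) 2
  have half_le : ∀ a : ℝ≥0∞, a / 2 ≤ a := fun a => ENNReal.half_le_self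
  have hmul : ∀ a b : ℝ≥0∞, ∀ r : ℝ, ENNReal.ofReal r * a ≤ b → ∀ a' ≤ a,
      ENNReal.ofReal r * a' ≤ b := fun a b r h a' ha => (mul_le_mul_right ha _).trans h
  have n1 : AEStronglyMeasurable (fun x => φ x - v x) (volume.restrict U) :=
    (mφ 2).1.sub iv.memLp.1
  have n2 : AEStronglyMeasurable (fun x => gradient φ x - G x) (volume.restrict U) :=
    (mgφ 2).1.sub iv.memLp_grad.1
  have n3 : AEStronglyMeasurable (fun x => ψ x - α x) (volume.restrict U) :=
    mψ.1.sub hα.inH1.memLp.1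
  have n4 : AEStronglyMeasurable (fun x => gradient ψ x - A x) (volume.restrict U) :=
    mgψ.1.sub hα.inH1.memLp_grad.1
  have one_le : ∀ {F : Type} [NormedAddCommGroup F] (h : Plane → F) (b : ℝ≥0∞),
      eLpNorm h 2 (volume.restrict U) ≤ b →
      ENNReal.ofReal 1 * eLpNorm h 2 (volume.restrict U) ≤ b := fun h b hb => by simpa using hb
  have b1 : eLpNorm (fun x => φ x * (ψ x - α x)) 2 (volume.restrict U) ≤ ε / 2 / 2 := by
    refine (eLpNorm_le_mul_eLpNorm_of_ae_le_mul (c := c₁) (g := fun x => ψ x - α x) ?_ 2).trans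
      (hmul _ _ _ hδ₁c _ (l1.trans hδle))
    filter_upwards [hc₁] with x hx
    rw [norm_mul]; gcongr
  have b2 : eLpNorm (fun x => α x * (φ x - v x)) 2 (volume.restrict U) ≤ ε / 2 / 2 := by
    refine (eLpNorm_le_mul_eLpNorm_of_ae_le_mul (c := 1) (g := fun x => φ x - v x) ?_ 2).trans
      (one_le _ _ (k1.trans hε₁le))
    filter_upwards [hα1] with x hx
    rw [norm_mul]; gcongr
  have b3 : eLpNorm (fun x => φ x • (gradient ψ x - A x)) 2 (volume.restrict U) ≤ ε / 2 / 2 := by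
    refine (eLpNorm_le_mul_eLpNorm_of_ae_le_mul (c := c₁) (g := fun x => gradient ψ x - A x)
      ?_ 2).trans (hmul _ _ _ hδ₁c _ (l2.trans hδle))
    filter_upwards [hc₁] with x hx
    rw [norm_smul]; gcongr
  have b4 : eLpNorm (fun x => (ψ x - α x) • gradient φ x) 2 (volume.restrict U) ≤ ε / 2 / 2 := by
    refine (eLpNorm_le_mul_eLpNorm_of_ae_le_mul (c := c₂) (g := fun x => ψ x - α x)
      ?_ 2).trans (hmul _ _ _ (hδc.trans hδ₁le) _ l1)
    filter_upwards [hc₂] with x hx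
    rw [norm_smul, mul_comm]; gcongr
  have b5 : eLpNorm (fun x => α x • (gradient φ x - G x)) 2 (volume.restrict U) ≤ ε / 2 / 2 := by
    refine (eLpNorm_le_mul_eLpNorm_of_ae_le_mul (c := 1) (g := fun x => gradient φ x - G x)
      ?_ 2).trans (one_le _ _ (k2.trans hε₁le))
    filter_upwards [hα1] with x hx
    rw [norm_smul]; gcongr
  have b6 : eLpNorm (fun x => (φ x - v x) • A x) 2 (volume.restrict U) ≤ ε / 2 / 2 := by
    refine (eLpNorm_le_mul_eLpNorm_of_ae_le_mul (c := c) (g := fun x => φ x - v x)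
      ?_ 2).trans (hmul _ _ _ hε₁c _ k1)
    filter_upwards [hc] with x hx
    rw [norm_smul, mul_comm]; gcongr
  have hδ₁4 : ε / 2 / 2 ≤ ε / 2 := half_le _
  refine ⟨fun x => φ x * ψ x, hφ.mul hψ, ?_, ?_, ?_⟩
  · exact eLpNorm_fun_add_le ((mφ 2).1.mul n3) (hα.inH1.memLp.1.mul n1)
      (fun x => by simp only [Pi.mul_apply]; ring)
      (b1.trans hδ₁4) (b2.trans hδ₁4)
  · refine eLpNorm_fun_add_le
      (f := fun x => φ x • (gradient ψ x - A x) + (ψ x - α x) • gradient φ x)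
      (g := fun x => α x • (gradient φ x - G x) + (φ x - v x) • A x)
      (((mφ 2).1.smul n4).add (n3.smul (mgφ 2).1))
      ((hα.inH1.memLp.1.smul n2).add (n1.smul hα.inH1.memLp_grad.1)) (fun x => ?_)
      (eLpNorm_fun_add_le ((mφ 2).1.smul n4) (n3.smul (mgφ 2).1) (fun _ => rfl) b3 b4)
      (eLpNorm_fun_add_le (hα.inH1.memLp.1.smul n2) (n1.smul hα.inH1.memLp_grad.1)
        (fun _ => rfl) b5 b6)
    rw [gradient_mul (hφ.differentiable (by simp) x) (hψ.differentiable (by simp) x)]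
    module
  -- Mollification keeps `|ψ| ≤ 1`, so `φ ψ` is as small on `Γ` as `φ` is, and no trace of `α`
  -- enters.
  · have hψ1 : ∀ x, ‖ψ x‖ ≤ 1 := l3 1 zero_le_one hα.abs_le
    calc _ ≤ eLpNorm (fun x => φ x - (0 : Plane → ℝ) x) 2 ((μH[1] : Measure Plane).restrict Γ) := by
          refine eLpNorm_mono fun x => ?_
          simp only [Pi.zero_apply, sub_zero, norm_mul]
          exact mul_le_of_le_one_right (norm_nonneg _) (hψ1 x)
      _ ≤ ε := k3.trans (hε₁le.trans ((half_le _).trans (half_le _)))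

end

/-! ### Triangles and barycentric coordinates -/

/-- `K` is the vertex set of a nondegenerate triangle. -/
structure IsTri (K : Finset Plane) : Prop where
  card : K.card = 3
  ind : AffineIndependent ℝ ((↑) : K → Plane)

/-- The vertices of a triangle as an affine basis. -/
noncomputable def IsTri.basis {K : Finset Plane} (hK : IsTri K) : AffineBasis K ℝ Plane where
  toFun := (↑)
  ind' := hK.ind
  tot' := by
    rw [hK.ind.affineSpan_eq_top_iff_card_eq_finrank_add_one]
    simp [hK.card]

open scoped Classical in
/-- The barycentric coordinate of the vertex `P` of the triangle `K`. -/
noncomputable def lam (K : Finset Plane) (P x : Plane) : ℝ :=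
  if h : IsTri K ∧ P ∈ K then h.1.basis.coord ⟨P, h.2⟩ x else 0

open scoped Classical in
/-- The gradient of the barycentric coordinate `lam K P`. -/
noncomputable def gr (K : Finset Plane) (P : Plane) : Plane :=
  if h : IsTri K ∧ P ∈ K then
    (InnerProductSpace.toDual ℝ Plane).symm (h.1.basis.coord ⟨P, h.2⟩).linear.toContinuousLinearMap
  else 0

section

variable {K : Finset Plane} {P Q x y : Plane}

theorem lam_sub (K : Finset Plane) (P x y : Plane) :
    lam K P x - lam K P y = inner ℝ (gr K P) (x - y) := by
  unfold lam gr
  split_ifs with h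
  · rw [InnerProductSpace.toDual_symm_apply]
    have := (h.1.basis.coord ⟨P, h.2⟩).linearMap_vsub x y
    simpa using this.symm
  · simp

theorem lam_eq (K : Finset Plane) (P x y : Plane) :
    lam K P x = lam K P y + inner ℝ (gr K P) (x - y) := by
  rw [← lam_sub]; ring

theorem lam_eq_inner_add (K : Finset Plane) (P x : Plane) :
    lam K P x = inner ℝ (gr K P) x + lam K P 0 := by
  rw [lam_eq K P x 0, sub_zero, add_comm]

theorem continuous_lam (K : Finset Plane) (P : Plane) : Continuous (lam K P) := by
  rw [show lam K P = fun x => inner ℝ (gr K P) x + lam K P 0 from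
    funext fun x => lam_eq_inner_add K P x]
  exact (contDiff_affine _ _).continuous

theorem lam_combo (K : Finset Plane) (P x y : Plane) (s t : ℝ) (h : s + t = 1) :
    lam K P (s • x + t • y) = s * lam K P x + t * lam K P y := by
  have ht : t = 1 - s := by linarith
  rw [lam_eq_inner_add, lam_eq_inner_add K P x, lam_eq_inner_add K P y, inner_add_right,
    inner_smul_right, inner_smul_right, ht]
  ring

theorem IsTri.lam_self (hK : IsTri K) (hP : P ∈ K) : lam K P P = 1 := by
  rw [lam, dif_pos ⟨hK, hP⟩]
  exact hK.basis.coord_apply_eq ⟨P, hP⟩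

theorem IsTri.lam_of_ne (hK : IsTri K) (hP : P ∈ K) (hQ : Q ∈ K) (h : P ≠ Q) : lam K P Q = 0 := by
  rw [lam, dif_pos ⟨hK, hP⟩]
  exact hK.basis.coord_apply_ne (i := ⟨P, hP⟩) (j := ⟨Q, hQ⟩) (by simpa using h)

theorem IsTri.sum_lam (hK : IsTri K) (x : Plane) : ∑ P ∈ K, lam K P x = 1 := by
  rw [← hK.basis.sum_coord_apply_eq_one x, ← Finset.sum_coe_sort K]
  refine Finset.sum_congr rfl fun i _ => ?_
  rw [lam, dif_pos ⟨hK, i.2⟩]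

theorem IsTri.sum_lam_smul (hK : IsTri K) (x : Plane) : ∑ P ∈ K, lam K P x • P = x := by
  conv_rhs => rw [← hK.basis.linear_combination_coord_eq_self x]
  rw [← Finset.sum_coe_sort K]
  refine Finset.sum_congr rfl fun i _ => ?_
  rw [lam, dif_pos ⟨hK, i.2⟩]
  rfl

theorem IsTri.ext_lam (hK : IsTri K) (h : ∀ P ∈ K, lam K P x = lam K P y) : x = y := by
  rw [← hK.sum_lam_smul x, ← hK.sum_lam_smul y]
  exact Finset.sum_congr rfl fun P hP => by rw [h P hP]

theorem IsTri.sum_gr (hK : IsTri K) : ∑ P ∈ K, gr K P = 0 := by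
  refine ext_inner_right ℝ fun v => ?_
  rw [sum_inner, inner_zero_left]
  have h1 := hK.sum_lam v
  have h2 := hK.sum_lam 0
  rw [← h2] at h1
  simp_rw [lam_eq_inner_add K _ v] at h1
  rw [Finset.sum_add_distrib] at h1
  linarith

theorem IsTri.sum_inner_gr_smul (hK : IsTri K) (v : Plane) :
    ∑ P ∈ K, inner ℝ (gr K P) v • P = v := by
  have h1 := hK.sum_lam_smul v
  simp_rw [lam_eq_inner_add K _ v, add_smul] at h1
  rw [Finset.sum_add_distrib, hK.sum_lam_smul 0, add_zero] at h1
  exact h1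

/-- The weights of a convex combination of vertices are its barycentric coordinates, so a face is
cut out by the vanishing of the remaining coordinates. -/
theorem IsTri.mem_hull_of_subset (hK : IsTri K) {s : Finset Plane} (hs : s ⊆ K) :
    x ∈ hull s ↔ (∀ P ∈ K, 0 ≤ lam K P x) ∧ ∀ P ∈ K, P ∉ s → lam K P x = 0 := by
  classical
  rw [hull, Finset.mem_convexHull']
  constructor
  · rintro ⟨w, h1, h2, rfl⟩
    have key : ∀ P ∈ K, lam K P (∑ y ∈ s, w y • y) = if P ∈ s then w P else 0 := by
      intro P hP
      have h3 : ∀ y ∈ s, w y * (inner ℝ (gr K P) y + lam K P 0) = if P = y then w y else 0 := by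
        intro y hy
        rw [← lam_eq_inner_add]
        split_ifs with h
        · rw [← h, hK.lam_self hP, mul_one]
        · rw [hK.lam_of_ne hP (hs hy) h, mul_zero]
      calc lam K P (∑ y ∈ s, w y • y) = ∑ y ∈ s, w y * (inner ℝ (gr K P) y + lam K P 0) := by
            rw [lam_eq_inner_add, inner_sum]
            simp_rw [mul_add, inner_smul_right]
            rw [Finset.sum_add_distrib, ← Finset.sum_mul, h2, one_mul]
        _ = _ := by rw [Finset.sum_congr rfl h3, Finset.sum_ite_eq]
    refine ⟨fun P hP => ?_, fun P hP hPs => ?_⟩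
    · rw [key P hP]; split_ifs with h
      · exact h1 P h
      · exact le_rfl
    · rw [key P hP, if_neg hPs]
  · rintro ⟨h1, h2⟩
    refine ⟨fun P => lam K P x, fun P hP => h1 P (hs hP), ?_, ?_⟩
    · rw [← hK.sum_lam x]
      exact Finset.sum_subset hs fun P hP hPs => h2 P hP hPs
    · conv_rhs => rw [← hK.sum_lam_smul x]
      exact Finset.sum_subset hs fun P hP hPs => by simp only [h2 P hP hPs, zero_smul]

theorem IsTri.mem_hull (hK : IsTri K) : x ∈ hull K ↔ ∀ P ∈ K, 0 ≤ lam K P x := by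
  rw [hK.mem_hull_of_subset subset_rfl]
  exact ⟨fun h => h.1, fun h => ⟨h, fun P h1 h2 => absurd h1 h2⟩⟩

theorem IsTri.mem_openTri (hK : IsTri K) : x ∈ openTri K ↔ ∀ P ∈ K, 0 < lam K P x := by
  have h := hK.basis.interior_convexHull
  have hr : Set.range hK.basis = (K : Set Plane) := by
    ext y
    constructor
    · rintro ⟨i, rfl⟩; exact i.2
    · intro hy; exact ⟨⟨y, hy⟩, rfl⟩
  rw [hr] at h
  rw [openTri, hull, h]
  constructor
  · intro h1 P hP
    rw [lam, dif_pos ⟨hK, hP⟩]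
    exact h1 ⟨P, hP⟩
  · intro h1 i
    have := h1 i i.2
    rwa [lam, dif_pos ⟨hK, i.2⟩] at this

theorem isOpen_openTri (K : Finset Plane) : IsOpen (openTri K) := isOpen_interior

theorem openTri_subset_hull (K : Finset Plane) : openTri K ⊆ hull K := interior_subset

theorem isCompact_hull (s : Finset Plane) : IsCompact (hull s) :=
  s.finite_toSet.isCompact_convexHull ℝ

theorem isBounded_openTri (K : Finset Plane) : Bornology.IsBounded (openTri K) :=
  (isCompact_hull K).isBounded.subset (openTri_subset_hull K)

theorem measurableSet_hull (s : Finset Plane) : MeasurableSet (hull s) :=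
  (isCompact_hull s).isClosed.measurableSet

/-- The frontier of a convex set is a null set. -/
theorem hull_ae_eq_openTri (K : Finset Plane) : openTri K =ᵐ[volume] hull K := by
  refine ae_eq_of_subset_of_measure_ge (openTri_subset_hull K) ?_
    (isOpen_openTri K).measurableSet.nullMeasurableSet (isCompact_hull K).measure_lt_top.ne
  have h := (convex_convexHull ℝ (K : Set Plane)).addHaar_frontier volume
  have : hull K ⊆ openTri K ∪ frontier (hull K) := by
    rw [frontier, (isCompact_hull K).isClosed.closure_eq]
    intro x hx
    by_cases h : x ∈ openTri K
    · exact Or.inl h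
    · exact Or.inr ⟨hx, h⟩
  calc volume (hull K) ≤ volume (openTri K) + volume (frontier (hull K)) :=
        (measure_mono this).trans (measure_union_le _ _)
    _ = volume (openTri K) := by rw [show frontier (hull K) = frontier (convexHull ℝ ↑K) from rfl,
        h, add_zero]

theorem restrict_hull (K : Finset Plane) :
    (volume : Measure Plane).restrict (hull K) = volume.restrict (openTri K) :=
  (Measure.restrict_congr_set (hull_ae_eq_openTri K)).symm

/-- The barycenter of a triangle. -/
noncomputable def barycenter (K : Finset Plane) : Plane := (1 / 3 : ℝ) • ∑ P ∈ K, P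

theorem IsTri.lam_barycenter (hK : IsTri K) (hP : P ∈ K) : lam K P (barycenter K) = 1 / 3 := by
  have h3 : ∑ Q ∈ K, lam K P Q = 1 := by
    rw [Finset.sum_eq_single_of_mem P hP, hK.lam_self hP]
    intro Q hQ hne
    exact hK.lam_of_ne hP hQ hne.symm
  have h1 : ∑ Q ∈ K, lam K P Q = inner ℝ (gr K P) (∑ Q ∈ K, Q) + 3 * lam K P 0 := by
    rw [Finset.sum_congr rfl fun Q _ => lam_eq_inner_add K P Q, Finset.sum_add_distrib, Finset.sum_const, hK.card, inner_sum, nsmul_eq_mul, Nat.cast_ofNat]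
  rw [barycenter, lam_eq_inner_add, inner_smul_right]
  linarith

theorem IsTri.barycenter_mem (hK : IsTri K) : barycenter K ∈ openTri K :=
  hK.mem_openTri.2 fun P hP => by rw [hK.lam_barycenter hP]; norm_num

theorem IsTri.volume_pos (hK : IsTri K) : 0 < volume.real (openTri K) := by
  refine ENNReal.toReal_pos ((isOpen_openTri K).measure_pos volume ⟨_, hK.barycenter_mem⟩).ne' ?_
  exact (isBounded_openTri K).measure_lt_top.ne

theorem volume_openTri_ne_top (K : Finset Plane) : volume (openTri K) ≠ ⊤ :=
  (isBounded_openTri K).measure_lt_top.ne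

/-- Contract towards `m` by a factor close to one. The image of `C` is a compact subset of `U`,
hence has positive distance to the complement. -/
theorem shrinksInto_of_starConvex {C U : Set Plane} (hC : IsCompact C) (hU : IsOpen U) (m : Plane)
    (h : ∀ x ∈ C, ∀ s : ℝ, 0 < s → s < 1 → (1 - s) • x + s • m ∈ U) : ShrinksInto C U := by
  intro ε hε
  obtain ⟨s, hs0, hs1, hsε, hsm⟩ : ∃ s : ℝ, 0 < s ∧ s < 1 ∧ s < ε ∧ s * ‖m‖ < ε := by
    refine ⟨min (1 / 2) (ε / (2 * (‖m‖ + 1))), by positivity,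
      (min_le_left _ _).trans_lt (by norm_num), ?_, ?_⟩
    · refine (min_le_right _ _).trans_lt ?_
      rw [div_lt_iff₀ (by positivity)]
      nlinarith [norm_nonneg m]
    · calc _ ≤ ε / (2 * (‖m‖ + 1)) * ‖m‖ := by gcongr; exact min_le_right _ _
        _ < ε := by
          rw [div_mul_eq_mul_div, div_lt_iff₀ (by positivity)]
          nlinarith [norm_nonneg m]
  have hcont : Continuous fun x : Plane => (1 - s) • x + s • m := by fun_prop
  obtain ⟨δ, hδ, hsub⟩ := (hC.image hcont).exists_cthickening_subset_open hU (by
    rintro _ ⟨x, hx, rfl⟩; exact h x hx s hs0 hs1)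
  refine ⟨1 - s, s • m, δ, hδ, ?_, ?_, fun x hx => ?_⟩
  · rw [show 1 - s - 1 = -s by ring, abs_neg, abs_of_pos hs0]; exact hsε
  · rw [norm_smul, Real.norm_of_nonneg hs0.le]; exact hsm
  · exact (Metric.closedBall_subset_cthickening (Set.mem_image_of_mem (fun x : Plane => (1 - s) • x + s • m) hx) δ).trans hsub

theorem ShrinksInto.mono {C C' U : Set Plane} (h : ShrinksInto C U) (hC : C' ⊆ C) :
    ShrinksInto C' U := by
  intro ε hε
  obtain ⟨r, c, δ, h1, h2, h3, h4⟩ := h ε hε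
  exact ⟨r, c, δ, h1, h2, h3, fun x hx => h4 x (hC hx)⟩

theorem IsTri.shrinksInto (hK : IsTri K) : ShrinksInto (openTri K) (openTri K) := by
  refine (shrinksInto_of_starConvex (isCompact_hull K) (isOpen_openTri K) (barycenter K)
    fun x hx s hs0 hs1 => ?_).mono (openTri_subset_hull K)
  rw [hK.mem_openTri]
  intro P hP
  have h1 := hK.mem_hull.1 hx P hP
  have h2 := hK.lam_barycenter hP
  rw [lam_combo K P x _ _ _ (by ring), h2]
  have : 0 ≤ (1 - s) * lam K P x := mul_nonneg (by linarith) h1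
  linarith [show 0 < s * (1 / 3) by positivity]

theorem IsTri.exists_of_mem (hK : IsTri K) (hP : P ∈ K) :
    ∃ A B : Plane, A ≠ B ∧ P ≠ A ∧ P ≠ B ∧ A ∈ K ∧ B ∈ K ∧ K.erase P = {A, B} ∧
      K = {P, A, B} := by
  have h : (K.erase P).card = 2 := by rw [Finset.card_erase_of_mem hP, hK.card]
  obtain ⟨A, B, hAB, he⟩ := Finset.card_eq_two.1 h
  have hA : A ∈ K.erase P := by rw [he]; simp
  have hB : B ∈ K.erase P := by rw [he]; simp
  refine ⟨A, B, hAB, (Finset.ne_of_mem_erase hA).symm, (Finset.ne_of_mem_erase hB).symm,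
    Finset.mem_of_mem_erase hA, Finset.mem_of_mem_erase hB, he, ?_⟩
  rw [← Finset.insert_erase hP, he]

end

/-! ### Integrals over segments -/

/-- Parametrization by arc length is an isometry of the line into the plane, so it carries Lebesgue
measure to one-dimensional Hausdorff measure; rescaling to the unit interval gives the length as a
factor. -/
theorem integral_segment {A B : Plane} (hAB : A ≠ B) (φ : Plane → ℝ) :
    ∫ x in hull {A, B}, φ x ∂(μH[1] : Measure Plane) =
      ‖B - A‖ * ∫ t in (0 : ℝ)..1, φ (A + t • (B - A)) := by
  set ℓ := ‖B - A‖ with hℓ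
  have hℓ0 : 0 < ℓ := norm_pos_iff.2 (sub_ne_zero.2 hAB.symm)
  set e : Plane := ℓ⁻¹ • (B - A) with he
  have hen : ‖e‖ = 1 := by rw [he, norm_smul, norm_inv, Real.norm_of_nonneg hℓ0.le, ← hℓ]; field_simp
  set ι : ℝ → Plane := fun s => A + s • e with hι
  have hiso : Isometry ι := by
    refine Isometry.of_dist_eq fun s t => ?_
    rw [hι, dist_add_left, dist_eq_norm, ← sub_smul, norm_smul, hen, mul_one, Real.dist_eq,
      Real.norm_eq_abs]
  have hseg : hull {A, B} = ι '' Set.Icc 0 ℓ := by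
    rw [hull, Finset.coe_insert, Finset.coe_singleton, convexHull_pair,
      segment_eq_image']
    ext x
    constructor
    · rintro ⟨t, ⟨h0, h1⟩, rfl⟩
      refine ⟨t * ℓ, ⟨by positivity, by nlinarith⟩, ?_⟩
      simp only [hι, he, smul_smul]
      rw [mul_assoc, mul_inv_cancel₀ hℓ0.ne', mul_one]
    · rintro ⟨s, ⟨h0, h1⟩, rfl⟩
      refine ⟨s * ℓ⁻¹, ⟨by positivity, ?_⟩, ?_⟩
      · rw [← div_eq_mul_inv, div_le_one hℓ0]; exact h1
      · simp only [hι, he, smul_smul]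
  have hmap : (μH[1] : Measure Plane).restrict (hull {A, B}) =
      Measure.map ι (volume.restrict (Set.Icc 0 ℓ)) := by
    have hme : MeasurableEmbedding ι := hiso.isClosedEmbedding.measurableEmbedding
    have h1 := hiso.map_hausdorffMeasure (d := 1) (Or.inl zero_le_one)
    rw [hausdorffMeasure_real] at h1
    have h2 : ι ⁻¹' (hull {A, B}) = Set.Icc 0 ℓ := by
      rw [hseg, Set.preimage_image_eq _ hiso.injective]
    rw [← h2, ← hme.restrict_map, h1, Measure.restrict_restrict (measurableSet_hull _),
      Set.inter_eq_left.2]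
    rw [hseg]; exact Set.image_subset_range _ _
  rw [hmap, hiso.isClosedEmbedding.measurableEmbedding.integral_map,
    integral_Icc_eq_integral_Ioc, ← intervalIntegral.integral_of_le hℓ0.le]
  have hs := intervalIntegral.mul_integral_comp_mul_left (a := 0) (b := 1) (f := fun s => φ (ι s)) ℓ
  rw [mul_zero, mul_one] at hs
  rw [← hs]
  congr 1
  refine intervalIntegral.integral_congr fun t _ => ?_
  simp only [hι, he, smul_smul]
  congr 2
  field_simp

theorem hausdorffMeasure_hull_pair (A B : Plane) :
    (μH[1] : Measure Plane) (hull {A, B}) = edist A B := by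
  rw [hull, Finset.coe_insert, Finset.coe_singleton, convexHull_pair, hausdorffMeasure_segment]

/-! ### Green's formula on a triangle -/

/-- The area of the parallelogram spanned by two vectors of the plane. -/
def crossAbs (u w : Plane) : ℝ := |u 0 * w 1 - u 1 * w 0|

/-- Coordinates of a triangle with vertex `P` and sides `u`, `u + w`. -/
noncomputable def coneMap (P u w : Plane) (y : Plane) : Plane := P + y 0 • u + (y 0 * y 1) • w

/-- The coordinate functional `y ↦ y i`. -/
noncomputable def coordL (i : Fin 2) : Plane →L[ℝ] ℝ := EuclideanSpace.proj i

theorem coordL_apply (i : Fin 2) (y : Plane) : coordL i y = y i := rfl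

/-- The derivative of `coneMap`. -/
noncomputable def coneMapDeriv (u w : Plane) (y : Plane) : Plane →L[ℝ] Plane :=
  (coordL 0).smulRight u + ((y 0) • (coordL 1) + (y 1) • (coordL 0)).smulRight w

theorem hasFDerivAt_coneMap (P u w y : Plane) :
    HasFDerivAt (coneMap P u w) (coneMapDeriv u w y) y := by
  have h0 : HasFDerivAt (fun y : Plane => y 0) (coordL 0) y := (coordL 0).hasFDerivAt
  have h1 : HasFDerivAt (fun y : Plane => y 1) (coordL 1) y := (coordL 1).hasFDerivAt
  exact ((h0.smul_const u).const_add P).add ((h0.mul h1).smul_const w)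

theorem det_coneMapDeriv (u w y : Plane) :
    (coneMapDeriv u w y).det = y 0 * (u 0 * w 1 - u 1 * w 0) := by
  rw [ContinuousLinearMap.det, ← LinearMap.det_toMatrix (EuclideanSpace.basisFun (Fin 2) ℝ).toBasis,
    Matrix.det_fin_two]
  simp [LinearMap.toMatrix_apply, coneMapDeriv, coordL_apply]
  ring

/-- The unit square as a subset of the plane. -/
def unitSquare : Set Plane := {y | y 0 ∈ Set.Ioo (0 : ℝ) 1 ∧ y 1 ∈ Set.Ioo (0 : ℝ) 1}

theorem measurableSet_unitSquare : MeasurableSet unitSquare :=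
  ((coordL 0).measurable measurableSet_Ioo).inter ((coordL 1).measurable measurableSet_Ioo)

theorem setIntegral_unitSquare {G : ℝ × ℝ → ℝ} (hG : Continuous G) :
    ∫ y in unitSquare, G (y 0, y 1) = ∫ t in (0 : ℝ)..1, ∫ a in (0 : ℝ)..1, G (a, t) := by
  have hmp : MeasurePreserving (fun y : Plane => (y 0, y 1)) volume
      ((volume : Measure ℝ).prod (volume : Measure ℝ)) :=
    (volume_preserving_finTwoArrow ℝ).comp (PiLp.volume_preserving_ofLp (Fin 2))
  have hme : MeasurableEmbedding (fun y : Plane => (y 0, y 1)) :=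
    (MeasurableEquiv.finTwoArrow (α := ℝ)).measurableEmbedding.comp
      (MeasurableEquiv.toLp 2 (Fin 2 → ℝ)).symm.measurableEmbedding
  have hpre : unitSquare = (fun y : Plane => (y 0, y 1)) ⁻¹' (Set.Ioo 0 1 ×ˢ Set.Ioo 0 1) := by
    ext y; simp [unitSquare]
  have hint : Integrable G ((volume.restrict (Set.Ioo 0 1)).prod (volume.restrict (Set.Ioo 0 1))) := by
    rw [Measure.prod_restrict]
    exact (hG.continuousOn.integrableOn_compact (isCompact_Icc.prod isCompact_Icc)).mono_set
      (Set.prod_mono Set.Ioo_subset_Icc_self Set.Ioo_subset_Icc_self)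
  rw [hpre, hmp.setIntegral_preimage_emb hme, ← Measure.prod_restrict, integral_prod_symm _ hint]
  simp only [intervalIntegral.integral_of_le zero_le_one, integral_Ioc_eq_integral_Ioo]

section

variable {K : Finset Plane} {P A B : Plane}

/-- The image of `y` has the barycentric coordinates `1 - y 0`, `y 0 * (1 - y 1)` and `y 0 * y 1` at
`P`, `A` and `B`; range and injectivity are read off from them. -/
theorem IsTri.coneMap_image (hK : IsTri K) (hP : P ∈ K) (hAB : A ≠ B) (he : K.erase P = {A, B}) :
    coneMap P (A - P) (B - A) '' unitSquare = openTri K ∧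
      Set.InjOn (coneMap P (A - P) (B - A)) unitSquare := by
  have hA' : A ∈ K.erase P := by rw [he]; simp
  have hB' : B ∈ K.erase P := by rw [he]; simp
  have hA := Finset.mem_of_mem_erase hA'
  have hB := Finset.mem_of_mem_erase hB'
  have hPA := (Finset.ne_of_mem_erase hA').symm
  have hPB := (Finset.ne_of_mem_erase hB').symm
  have hKe : ∀ Q, Q ∈ K ↔ Q = P ∨ Q = A ∨ Q = B := fun Q => by
    rw [← Finset.insert_erase hP, he]; simp
  have hl : ∀ Q y, lam K Q (coneMap P (A - P) (B - A) y) =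
      lam K Q P + y 0 * (lam K Q A - lam K Q P) + y 0 * y 1 * (lam K Q B - lam K Q A) := by
    intro Q y
    rw [lam_sub, lam_sub, lam_eq K Q _ P, coneMap,
      show P + y 0 • (A - P) + (y 0 * y 1) • (B - A) - P = y 0 • (A - P) + (y 0 * y 1) • (B - A) by
        abel, inner_add_right, inner_smul_right, inner_smul_right]
    ring
  have hlP : ∀ y, lam K P (coneMap P (A - P) (B - A) y) = 1 - y 0 := fun y => by
    rw [hl, hK.lam_self hP, hK.lam_of_ne hP hA hPA, hK.lam_of_ne hP hB hPB]; ring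
  have hlA : ∀ y, lam K A (coneMap P (A - P) (B - A) y) = y 0 * (1 - y 1) := fun y => by
    rw [hl, hK.lam_self hA, hK.lam_of_ne hA hP hPA.symm, hK.lam_of_ne hA hB hAB]; ring
  have hlB : ∀ y, lam K B (coneMap P (A - P) (B - A) y) = y 0 * y 1 := fun y => by
    rw [hl, hK.lam_self hB, hK.lam_of_ne hB hP hPB.symm, hK.lam_of_ne hB hA hAB.symm]; ring
  constructor
  · ext x
    rw [hK.mem_openTri]
    constructor
    · rintro ⟨y, ⟨⟨h1, h2⟩, ⟨h3, h4⟩⟩, rfl⟩ Q hQ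
      rcases (hKe Q).1 hQ with rfl | rfl | rfl
      · rw [hlP]; linarith
      · rw [hlA]; exact mul_pos h1 (by linarith)
      · rw [hlB]; exact mul_pos h1 h3
    · intro h
      have hs := hK.sum_lam x
      have hKi : K = {P, A, B} := by rw [← Finset.insert_erase hP, he]
      have hs' : lam K P x + (lam K A x + lam K B x) = 1 := by
        have : ∑ Q ∈ ({P, A, B} : Finset Plane), lam K Q x = 1 := by rw [← hKi]; exact hs
        rwa [Finset.sum_insert (by simp [hPA, hPB]), Finset.sum_pair hAB] at this
      have pP := h P hP
      have pA := h A hA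
      have pB := h B hB
      have hpos : 0 < 1 - lam K P x := by linarith
      refine ⟨!₂[1 - lam K P x, lam K B x / (1 - lam K P x)], ⟨⟨?_, ?_⟩, ⟨?_, ?_⟩⟩, ?_⟩
      · simpa using hpos
      · simpa using pP
      · simpa using div_pos pB hpos
      · simp only [Matrix.cons_val_one, Matrix.cons_val_fin_one]
        rw [div_lt_one hpos]; linarith
      · refine hK.ext_lam fun Q hQ => ?_
        have hz0 : (!₂[1 - lam K P x, lam K B x / (1 - lam K P x)] : Plane) 0 = 1 - lam K P x := rfl
        have hz1 : (!₂[1 - lam K P x, lam K B x / (1 - lam K P x)] : Plane) 1 =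
          lam K B x / (1 - lam K P x) := rfl
        rcases (hKe Q).1 hQ with rfl | rfl | rfl
        · rw [hlP, hz0]; ring
        · rw [hlA, hz0, hz1]; field_simp; linarith
        · rw [hlB, hz0, hz1]; field_simp
  · rintro y ⟨⟨h1, h2⟩, -⟩ z ⟨⟨h3, h4⟩, -⟩ hyz
    have e0 : y 0 = z 0 := by
      have := hlP y; rw [hyz, hlP z] at this; linarith
    have e1 : y 1 = z 1 := by
      have := hlB y; rw [hyz, hlB z, e0] at this
      exact (mul_left_cancel₀ h3.ne' this).symm
    ext i; fin_cases i
    · exact e0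
    · exact e1

/-- Change of variables with Jacobian `y 0` times the area of the parallelogram. The inner integral
runs along the ray from `P` to a point of the opposite edge. -/
theorem IsTri.integral_eq (hK : IsTri K) (hP : P ∈ K) (hAB : A ≠ B) (he : K.erase P = {A, B})
    {g : Plane → ℝ} (hg : Continuous g) :
    ∫ x in openTri K, g x = crossAbs (A - P) (B - A) *
      ∫ t in (0 : ℝ)..1, ∫ a in (0 : ℝ)..1, a * g (P + a • (A - P) + (a * t) • (B - A)) := by
  obtain ⟨h1, h2⟩ := hK.coneMap_image hP hAB he
  rw [← h1, integral_image_eq_integral_abs_det_fderiv_smul volume measurableSet_unitSquare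
    (fun y _ => (hasFDerivAt_coneMap P (A - P) (B - A) y).hasFDerivWithinAt) h2]
  have e : ∀ y ∈ unitSquare, |(coneMapDeriv (A - P) (B - A) y).det| •
      g (coneMap P (A - P) (B - A) y) = crossAbs (A - P) (B - A) *
        (fun z : ℝ × ℝ => z.1 * g (P + z.1 • (A - P) + (z.1 * z.2) • (B - A))) (y 0, y 1) := by
    rintro y ⟨⟨h3, h4⟩, -⟩
    rw [det_coneMapDeriv, abs_mul, abs_of_pos h3, smul_eq_mul, crossAbs, coneMap]
    ring
  rw [setIntegral_congr_fun measurableSet_unitSquare e, integral_const_mul,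
    setIntegral_unitSquare (G := fun z : ℝ × ℝ =>
      z.1 * g (P + z.1 • (A - P) + (z.1 * z.2) • (B - A))) (by fun_prop)]

/-- The integrand is the derivative of `a ^ 2 * φ (P + a • v)`. -/
theorem integral_radial {φ : Plane → ℝ} (hφ : ContDiff ℝ ∞ φ) (P v : Plane) :
    ∫ a in (0 : ℝ)..1, a * (inner ℝ (a • v) (gradient φ (P + a • v)) + 2 * φ (P + a • v)) =
      φ (P + v) := by
  have hd : ∀ a : ℝ, HasDerivAt (fun a => a ^ 2 * φ (P + a • v))
      (a * (inner ℝ (a • v) (gradient φ (P + a • v)) + 2 * φ (P + a • v))) a := by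
    intro a
    have h1 : HasFDerivAt φ (fderiv ℝ φ (P + a • v)) (P + a • v) :=
      (hφ.differentiable (by simp) _).hasFDerivAt
    have h2 : HasDerivAt (fun a : ℝ => P + a • v) v a := by
      simpa using ((hasDerivAt_id a).smul_const v).const_add P
    have h3 := (hasDerivAt_pow 2 a).mul (h1.comp_hasDerivAt a h2)
    refine h3.congr_deriv ?_
    rw [inner_gradient_right]
    simp only [map_smul, smul_eq_mul, conj_trivial, Function.comp]
    push_cast; ring
  have hc := continuous_gradient hφ
  have hc' := hφ.continuous
  rw [intervalIntegral.integral_eq_sub_of_hasDerivAt (fun a _ => hd a)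
    (Continuous.intervalIntegrable (by fun_prop) _ _)]
  simp

/-- The distance of the vertex `P` to the opposite edge. -/
noncomputable def height (K : Finset Plane) (P : Plane) : ℝ :=
  2 * volume.real (openTri K) / (μH[1] : Measure Plane).real (hull (K.erase P))

theorem edge_length (he : K.erase P = {A, B}) :
    (μH[1] : Measure Plane).real (hull (K.erase P)) = ‖B - A‖ := by
  rw [he, Measure.real, hausdorffMeasure_hull_pair, edist_dist, ENNReal.toReal_ofReal dist_nonneg,
    dist_comm, dist_eq_norm]

theorem IsTri.crossAbs_eq (hK : IsTri K) (hP : P ∈ K) (hAB : A ≠ B) (he : K.erase P = {A, B}) :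
    crossAbs (A - P) (B - A) = 2 * volume.real (openTri K) := by
  have h := hK.integral_eq hP hAB he (g := fun _ => 1) continuous_const
  rw [setIntegral_const] at h
  simp at h
  rw [h]; ring

theorem IsTri.height_mul (hK : IsTri K) (hP : P ∈ K) (hAB : A ≠ B) (he : K.erase P = {A, B}) :
    height K P * ‖B - A‖ = crossAbs (A - P) (B - A) := by
  have h0 : ‖B - A‖ ≠ 0 := norm_ne_zero_iff.2 (sub_ne_zero.2 hAB.symm)
  rw [hK.crossAbs_eq hP hAB he, height, edge_length he]
  field_simp

theorem IsTri.height_pos (hK : IsTri K) (hP : P ∈ K) : 0 < height K P := by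
  obtain ⟨A, B, hAB, -, -, -, -, he, -⟩ := hK.exists_of_mem hP
  rw [height, edge_length he]
  have h0 : 0 < ‖B - A‖ := norm_pos_iff.2 (sub_ne_zero.2 hAB.symm)
  have := hK.volume_pos
  positivity

/-- This is the divergence theorem for `φ (x - P)`, a field that is tangential on the two edges
through `P` and has constant normal component on the third one. In the coordinates with rays from
`P` it reduces to the fundamental theorem of calculus on each ray. -/
theorem IsTri.green_vertex (hK : IsTri K) (hP : P ∈ K) {φ : Plane → ℝ} (hφ : ContDiff ℝ ∞ φ) :
    ∫ x in openTri K, (inner ℝ (x - P) (gradient φ x) + 2 * φ x) =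
      height K P * ∫ x in hull (K.erase P), φ x ∂(μH[1] : Measure Plane) := by
  obtain ⟨A, B, hAB, -, -, -, -, he, -⟩ := hK.exists_of_mem hP
  have hc := continuous_gradient hφ
  have hc' := hφ.continuous
  rw [hK.integral_eq hP hAB he (by fun_prop), he, integral_segment hAB, ← mul_assoc,
    hK.height_mul hP hAB he]
  congr 1
  refine intervalIntegral.integral_congr fun t _ => ?_
  have := integral_radial hφ P ((A - P) + t • (B - A))
  rw [show P + (A - P + t • (B - A)) = A + t • (B - A) by abel] at this
  rw [← this]
  refine intervalIntegral.integral_congr fun a _ => ?_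
  rw [show P + a • (A - P) + (a * t) • (B - A) = P + a • (A - P + t • (B - A)) by module,
    show P + a • (A - P + t • (B - A)) - P = a • (A - P + t • (B - A)) by abel]

theorem inner_eq_sum (u v : Plane) : inner ℝ u v = u 0 * v 0 + u 1 * v 1 := by
  rw [PiLp.inner_apply, Fin.sum_univ_two]
  simp [mul_comm]

theorem IsOuterNormal.inner_edge {n : Plane} {e : Finset Plane} (hn : IsOuterNormal K e n)
    (he : e ⊆ K) {Q R : Plane} (hQ : Q ∈ e) (hR : R ∈ e) : inner ℝ n (R - Q) = 0 := by
  have h1 := hn.2 Q hQ R (he hR)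
  have h2 := hn.2 R hR Q (he hQ)
  rw [← neg_sub R Q, inner_neg_right] at h2
  linarith

theorem IsOuterNormal.inner_edge_hull {n : Plane} {e : Finset Plane} (hn : IsOuterNormal K e n)
    (he : e ⊆ K) {Q x : Plane} (hQ : Q ∈ e) (hx : x ∈ hull e) : inner ℝ n (x - Q) = 0 := by
  rw [hull, Finset.mem_convexHull'] at hx
  obtain ⟨w, -, h2, rfl⟩ := hx
  have : ∑ y ∈ e, w y • y - Q = ∑ y ∈ e, w y • (y - Q) := by
    simp_rw [smul_sub]
    rw [Finset.sum_sub_distrib, ← Finset.sum_smul, h2, one_smul]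
  rw [this, inner_sum]
  refine Finset.sum_eq_zero fun y hy => ?_
  rw [inner_smul_right, hn.inner_edge he hQ hy, mul_zero]

/-- Twice the area of a triangle is base times height; `height` is defined through the area, and the
area is a cross product of sides. -/
theorem IsOuterNormal.inner_vertex (hK : IsTri K) (hP : P ∈ K) {n : Plane}
    (hn : IsOuterNormal K (K.erase P) n) {x : Plane} (hx : x ∈ hull (K.erase P)) :
    inner ℝ n (x - P) = height K P := by
  obtain ⟨A, B, hAB, -, -, -, -, he, -⟩ := hK.exists_of_mem hP
  have hA : A ∈ K.erase P := by rw [he]; simp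
  have hB : B ∈ K.erase P := by rw [he]; simp
  have h1 : inner ℝ n (x - P) = inner ℝ n (A - P) := by
    rw [← sub_add_sub_cancel x A P, inner_add_right,
      hn.inner_edge_hull (Finset.erase_subset _ _) hA hx, zero_add]
  have hpos : 0 ≤ inner ℝ n (A - P) := by
    have := hn.2 A hA P hP
    rw [← neg_sub, inner_neg_right] at this
    linarith
  have hperp := hn.inner_edge (Finset.erase_subset _ _) hA hB
  have hlen : 0 < ‖B - A‖ := norm_pos_iff.2 (sub_ne_zero.2 hAB.symm)
  have hh := hK.height_mul hP hAB he
  rw [h1]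
  set u := A - P
  set w := B - A
  have hn1 : n 0 * n 0 + n 1 * n 1 = 1 := by
    rw [← inner_eq_sum, real_inner_self_eq_norm_sq, hn.1]; norm_num
  have hw : w 0 * w 0 + w 1 * w 1 = ‖w‖ ^ 2 := by
    rw [← inner_eq_sum, real_inner_self_eq_norm_sq]
  rw [inner_eq_sum] at hperp hpos ⊢
  -- For a unit vector `n` orthogonal to `w`, the cross product of `u` and `w` is `⟨n, u⟩` times
  -- that of `n` and `w`, and the latter has modulus `‖w‖`.
  have hcross : u 0 * w 1 - u 1 * w 0 = (n 0 * u 0 + n 1 * u 1) * (n 0 * w 1 - n 1 * w 0) := by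
    linear_combination (-u 0 * w 1 + u 1 * w 0) * hn1 + (n 1 * u 0 - n 0 * u 1) * hperp
  have hnw : (n 0 * w 1 - n 1 * w 0) ^ 2 = ‖w‖ ^ 2 := by
    rw [← hw]
    linear_combination (w 0 * w 0 + w 1 * w 1) * hn1 - (n 0 * w 0 + n 1 * w 1) * hperp
  have habs : |n 0 * w 1 - n 1 * w 0| = ‖w‖ := by
    rw [← abs_of_nonneg (norm_nonneg w)]
    exact (sq_eq_sq_iff_abs_eq_abs _ _).1 hnw
  have : height K P * ‖w‖ = (n 0 * u 0 + n 1 * u 1) * ‖w‖ := by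
    rw [hh, crossAbs, hcross, abs_mul, habs, abs_of_nonneg hpos]
  exact (mul_right_cancel₀ hlen.ne' this).symm

/-- Normalize `-gr K P`: the coordinate of `P` vanishes on the opposite edge and is nonnegative on
the triangle. -/
theorem IsTri.exists_outerNormal (hK : IsTri K) (hP : P ∈ K) :
    ∃ n, IsOuterNormal K (K.erase P) n := by
  have hg : gr K P ≠ 0 := by
    intro h0
    have h1 := lam_sub K P P (barycenter K)
    rw [h0, inner_zero_left, hK.lam_self hP, hK.lam_barycenter hP] at h1
    norm_num at h1
  have hg' : 0 < ‖gr K P‖ := norm_pos_iff.2 hg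
  refine ⟨-(‖gr K P‖⁻¹ • gr K P), ?_, fun x hx y hy => ?_⟩
  · rw [norm_neg, norm_smul, norm_inv, norm_norm, inv_mul_cancel₀ hg'.ne']
  · rw [inner_neg_left, real_inner_smul_left, ← lam_sub, hK.lam_of_ne hP
      (Finset.mem_of_mem_erase hx) (Finset.ne_of_mem_erase hx).symm, sub_zero]
    have : 0 ≤ lam K P y := by
      by_cases h : P = y
      · rw [← h, hK.lam_self hP]; exact zero_le_one
      · rw [hK.lam_of_ne hP hy h]
    have := mul_nonneg (inv_nonneg.2 hg'.le) this
    linarith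

/-- The coefficient of the field `x - P` in the Raviart–Thomas field `a + c x` on `K`. -/
noncomputable def rtCoeff (K : Finset Plane) (a : Plane) (c : ℝ) (P : Plane) : ℝ :=
  c * lam K P 0 - inner ℝ (gr K P) a

theorem IsTri.sum_rtCoeff (hK : IsTri K) (a : Plane) (c : ℝ) : ∑ P ∈ K, rtCoeff K a c P = c := by
  unfold rtCoeff
  rw [Finset.sum_sub_distrib, ← Finset.mul_sum, hK.sum_lam, ← sum_inner, hK.sum_gr,
    inner_zero_left]
  ring

/-- In the basis of the fields `x - P` the three edge fluxes decouple, since each of these fields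
has a normal component on one edge only. -/
theorem IsTri.sum_rtCoeff_smul (hK : IsTri K) (a : Plane) (c : ℝ) (x : Plane) :
    ∑ P ∈ K, rtCoeff K a c P • (x - P) = a + c • x := by
  simp_rw [smul_sub]
  rw [Finset.sum_sub_distrib, ← Finset.sum_smul, hK.sum_rtCoeff]
  unfold rtCoeff
  simp_rw [sub_smul, mul_smul]
  rw [Finset.sum_sub_distrib, ← Finset.smul_sum, hK.sum_lam_smul, hK.sum_inner_gr_smul]
  rw [smul_zero]; abel

/-- The normal flux of the field `a + c x` on `K` through the edge opposite to `P`. -/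
noncomputable def rtFlux (K : Finset Plane) (a : Plane) (c : ℝ) (P : Plane) : ℝ :=
  rtCoeff K a c P * height K P

theorem IsOuterNormal.inner_rt (hK : IsTri K) (hP : P ∈ K) {n : Plane}
    (hn : IsOuterNormal K (K.erase P) n) {x : Plane} (hx : x ∈ hull (K.erase P)) (a : Plane)
    (c : ℝ) : inner ℝ (a + c • x) n = rtFlux K a c P := by
  rw [← hK.sum_rtCoeff_smul, sum_inner, Finset.sum_eq_single_of_mem P hP]
  · rw [real_inner_smul_left, real_inner_comm, hn.inner_vertex hK hP hx, rtFlux]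
  · intro Q hQ hQP
    rw [real_inner_smul_left, real_inner_comm,
      hn.inner_edge_hull (Finset.erase_subset _ _) (Finset.mem_erase.2 ⟨hQP, hQ⟩) hx, mul_zero]

/-- The integral of the trace of `v` (with gradient `G`) on `K` over the edge opposite to `P`. -/
noncomputable def edgeTrace (K : Finset Plane) (P : Plane) (v : Plane → ℝ) (G : Plane → Plane) : ℝ :=
  (height K P)⁻¹ * ∫ x in openTri K, (inner ℝ (x - P) (G x) + 2 * v x)

theorem IsTri.edgeTrace_of_contDiff (hK : IsTri K) (hP : P ∈ K) {φ : Plane → ℝ}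
    (hφ : ContDiff ℝ ∞ φ) :
    edgeTrace K P φ (gradient φ) = ∫ x in hull (K.erase P), φ x ∂(μH[1] : Measure Plane) := by
  rw [edgeTrace, hK.green_vertex hP hφ, inv_mul_cancel_left₀ (hK.height_pos hP).ne']

theorem memLp_sub_vertex (K : Finset Plane) (P : Plane) :
    MemLp (fun x => x - P) 2 (volume.restrict (openTri K)) :=
  memLp_of_continuous_of_isBounded (isBounded_openTri K) (by fun_prop) 2

theorem integrable_of_memLp_openTri {F : Type*} [NormedAddCommGroup F] {v : Plane → F}
    (hv : MemLp v 2 (volume.restrict (openTri K))) :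
    Integrable v (volume.restrict (openTri K)) := by
  have : IsFiniteMeasure (volume.restrict (openTri K)) :=
    ⟨by simpa using (volume_openTri_ne_top K).lt_top⟩
  exact hv.integrable one_le_two

/-- Green's formula for an `H¹` function and a Raviart–Thomas field on a triangle. -/
theorem IsTri.green (hK : IsTri K) {v : Plane → ℝ} {G : Plane → Plane}
    (hv : MemLp v 2 (volume.restrict (openTri K))) (hG : MemLp G 2 (volume.restrict (openTri K)))
    (a : Plane) (c : ℝ) :
    ∫ x in openTri K, (inner ℝ (a + c • x) (G x) + 2 * c * v x) =
      ∑ P ∈ K, rtFlux K a c P * edgeTrace K P v G := by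
  have hi : ∀ P, Integrable (fun x => inner ℝ (x - P) (G x) + 2 * v x)
      (volume.restrict (openTri K)) := fun P =>
    (integrable_inner_of_memLp (memLp_sub_vertex K P) hG).add
      ((integrable_of_memLp_openTri hv).const_mul 2)
  have e : ∀ P ∈ K, rtFlux K a c P * edgeTrace K P v G =
      ∫ x in openTri K, rtCoeff K a c P * (inner ℝ (x - P) (G x) + 2 * v x) := fun P hP => by
    rw [rtFlux, edgeTrace, integral_const_mul, mul_assoc, mul_inv_cancel_left₀ (hK.height_pos hP).ne']
  rw [Finset.sum_congr rfl e, ← integral_finsetSum _ fun P _ => (hi P).const_mul _]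
  refine integral_congr_ae (Eventually.of_forall fun x => ?_)
  simp only
  simp_rw [mul_add]
  rw [Finset.sum_add_distrib, ← Finset.sum_mul, hK.sum_rtCoeff, ← hK.sum_rtCoeff_smul, sum_inner]
  simp_rw [real_inner_smul_left]
  ring

theorem tendsto_edgeTrace {v : Plane → ℝ} {G : Plane → Plane}
    (hv : MemLp v 2 (volume.restrict (openTri K))) (hG : MemLp G 2 (volume.restrict (openTri K)))
    {w : ℕ → Plane → ℝ} {H : ℕ → Plane → Plane}
    (hw : ∀ n, MemLp (w n) 2 (volume.restrict (openTri K)))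
    (hH : ∀ n, MemLp (H n) 2 (volume.restrict (openTri K)))
    (h1 : Tendsto (fun n => eLpNorm (fun x => w n x - v x) 2 (volume.restrict (openTri K)))
      atTop (𝓝 0))
    (h2 : Tendsto (fun n => eLpNorm (fun x => H n x - G x) 2 (volume.restrict (openTri K)))
      atTop (𝓝 0)) :
    Tendsto (fun n => edgeTrace K P (w n) (H n)) atTop (𝓝 (edgeTrace K P v G)) := by
  have t1 := tendsto_integral_inner (memLp_sub_vertex K P) hH hG h2
  have mc : MemLp (fun _ => (2 : ℝ)) 2 (volume.restrict (openTri K)) :=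
    memLp_of_continuous_of_isBounded (isBounded_openTri K) continuous_const 2
  have t2 := tendsto_integral_inner mc hw hv h1
  have e : ∀ (v : Plane → ℝ) (G : Plane → Plane), MemLp v 2 (volume.restrict (openTri K)) →
      MemLp G 2 (volume.restrict (openTri K)) → edgeTrace K P v G = (height K P)⁻¹ *
        ((∫ x in openTri K, inner ℝ (x - P) (G x)) + ∫ x in openTri K, inner ℝ (2 : ℝ) (v x)) := by
    intro v G hv hG
    rw [edgeTrace, ← integral_add (integrable_inner_of_memLp (memLp_sub_vertex K P) hG)
      (integrable_inner_of_memLp mc hv)]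
    congr 1
    refine integral_congr_ae (Eventually.of_forall fun x => ?_)
    simp [mul_comm]
  rw [e v G hv hG]
  refine ((t1.add t2).const_mul _).congr fun n => ?_
  rw [e _ _ (hw n) (hH n)]

end

/-! ### Traces on the edges of a triangle -/

section

variable {K : Finset Plane} {P A B : Plane}

theorem IsTri.isFiniteMeasure_edge (hK : IsTri K) (hP : P ∈ K) :
    IsFiniteMeasure ((μH[1] : Measure Plane).restrict (hull (K.erase P))) := by
  obtain ⟨A, B, hAB, -, -, -, -, he, -⟩ := hK.exists_of_mem hP
  refine ⟨?_⟩
  rw [Measure.restrict_apply_univ, he, hausdorffMeasure_hull_pair]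
  exact edist_lt_top _ _

theorem IsTri.memLp_edge (hK : IsTri K) (hP : P ∈ K) {φ : Plane → ℝ} (hφ : Continuous φ) :
    MemLp φ 2 ((μH[1] : Measure Plane).restrict (hull (K.erase P))) := by
  have := hK.isFiniteMeasure_edge hP
  obtain ⟨C, hC⟩ := ((isCompact_hull (K.erase P)).image hφ).isBounded.exists_norm_le
  refine MemLp.of_bound hφ.aestronglyMeasurable C ?_
  rw [ae_restrict_iff' (measurableSet_hull _)]
  exact Eventually.of_forall fun x hx => hC _ ⟨x, hx, rfl⟩

/-- Both sides depend continuously on the smooth approximants of `v`, and for smooth functions they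
agree by Green's formula. So integrals of traces can be computed from integrals over the triangle.
-/
theorem IsTri.integral_trace (hK : IsTri K) (hP : P ∈ K) {v t : Plane → ℝ} {G : Plane → Plane}
    (hv : InH1 (openTri K) v G) (ht : HasTrace (openTri K) (hull (K.erase P)) v t) :
    ∫ x in hull (K.erase P), t x ∂(μH[1] : Measure Plane) = edgeTrace K P v G := by
  obtain ⟨-, mt, φ, hφ, h1, h2, h3⟩ := ht
  have := hK.isFiniteMeasure_edge hP
  have hb := isBounded_openTri K
  have hae := hv.weakGrad_ae_eq (isOpen_openTri K)
  have h2' : Tendsto (fun n => eLpNorm (fun x => gradient (φ n) x - G x) 2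
      (volume.restrict (openTri K))) atTop (𝓝 0) := by
    refine h2.congr fun n => eLpNorm_congr_ae ?_
    filter_upwards [hae] with x hx
    rw [hx]
  have t1 := tendsto_edgeTrace (P := P) hv.memLp hv.memLp_grad
    (fun n => memLp_of_continuous_of_isBounded hb (hφ n).continuous 2)
    (fun n => memLp_of_continuous_of_isBounded hb (continuous_gradient (hφ n)) 2) h1 h2'
  have t2 := tendsto_integral_inner (memLp_const (1 : ℝ))
    (fun n => hK.memLp_edge hP (hφ n).continuous) mt h3
  simp only [RCLike.inner_apply, conj_trivial, mul_one] at t2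
  refine tendsto_nhds_unique t2 (t1.congr fun n => ?_)
  exact hK.edgeTrace_of_contDiff hP (hφ n)

/-- Apply `IsTri.green_vertex` to `φ²`, and use the Cauchy–Schwarz inequality for the term with `2 φ
∇φ`. -/
theorem IsTri.exists_trace_inequality (hK : IsTri K) (hP : P ∈ K) :
    ∃ C : ℝ, 0 ≤ C ∧ ∀ φ : Plane → ℝ, ContDiff ℝ ∞ φ →
      √(∫ x in hull (K.erase P), ‖φ x‖ ^ 2 ∂(μH[1] : Measure Plane)) ≤
        C * (√(∫ x in openTri K, ‖φ x‖ ^ 2) + √(∫ x in openTri K, ‖gradient φ x‖ ^ 2)) := by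
  obtain ⟨D, hD⟩ := (isBounded_openTri K).exists_norm_le
  have hb := isBounded_openTri K
  have hh := hK.height_pos hP
  set E : ℝ := max D 0 + ‖P‖ with hE
  have hE0 : 0 ≤ E := by positivity
  have hxP : ∀ x ∈ openTri K, ‖x - P‖ ≤ E := fun x hx =>
    (norm_sub_le _ _).trans (add_le_add_left ((hD x hx).trans (le_max_left _ _)) _)
  -- With `a`, `b` the norms of `φ` and of its gradient, Green's formula gives `2 a E b + 2 a² ≤ (2
  -- E + 2) (a + b)²`.
  refine ⟨√((height K P)⁻¹ * (2 * E + 2)), by positivity, fun φ hφ => ?_⟩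
  have hc := hφ.continuous
  have hgc := continuous_gradient hφ
  set a := √(∫ x in openTri K, ‖φ x‖ ^ 2) with ha
  set b := √(∫ x in openTri K, ‖gradient φ x‖ ^ 2) with hb'
  have hgreen := hK.green_vertex hP (hφ.pow 2)
  have mφ := memLp_of_continuous_of_isBounded hb hc 2
  have mg := memLp_of_continuous_of_isBounded hb hgc 2
  have mxg : MemLp (fun x => inner ℝ (x - P) (gradient φ x)) 2 (volume.restrict (openTri K)) :=
    memLp_of_continuous_of_isBounded hb (by fun_prop) 2
  have hgr : ∀ x, gradient (fun y => φ y ^ 2) x = (2 * φ x) • gradient φ x := fun x => by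
    have := gradient_mul (hφ.differentiable (by simp) x) (hφ.differentiable (by simp) x)
    simp_rw [← sq] at this
    rw [this]; module
  have e1 : ∫ x in openTri K, (inner ℝ (x - P) (gradient (fun y => φ y ^ 2) x) + 2 * φ x ^ 2) =
      2 * (∫ x in openTri K, inner ℝ (φ x) (inner ℝ (x - P) (gradient φ x))) +
        2 * ∫ x in openTri K, ‖φ x‖ ^ 2 := by
    rw [← integral_const_mul, ← integral_const_mul, ← integral_add
      ((integrable_inner_of_memLp mφ mxg).const_mul 2) ((integrable_norm_sq_of_memLp mφ).const_mul 2)]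
    refine integral_congr_ae (Eventually.of_forall fun x => ?_)
    simp only [hgr, inner_smul_right, RCLike.inner_apply, conj_trivial, Real.norm_eq_abs, sq_abs]
    ring
  have hcs := abs_integral_inner_le mφ mxg
  have hmono : √(∫ x in openTri K, ‖inner ℝ (x - P) (gradient φ x)‖ ^ 2) ≤ E * b := by
    have : ∫ x in openTri K, ‖inner ℝ (x - P) (gradient φ x)‖ ^ 2 ≤
        ∫ x in openTri K, E ^ 2 * ‖gradient φ x‖ ^ 2 := by
      refine setIntegral_mono_on (integrable_norm_sq_of_memLp mxg)
        ((integrable_norm_sq_of_memLp mg).const_mul _) (isOpen_openTri K).measurableSet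
        fun x hx => ?_
      rw [← mul_pow]
      gcongr
      exact (norm_inner_le_norm _ _).trans (by gcongr; exact hxP x hx)
    rw [integral_const_mul] at this
    calc _ ≤ √(E ^ 2 * ∫ x in openTri K, ‖gradient φ x‖ ^ 2) := Real.sqrt_le_sqrt this
      _ = E * b := by rw [Real.sqrt_mul (by positivity), Real.sqrt_sq hE0]
  have ha0 : 0 ≤ a := Real.sqrt_nonneg _
  have hb0 : 0 ≤ b := Real.sqrt_nonneg _
  have ha2 : ∫ x in openTri K, ‖φ x‖ ^ 2 = a ^ 2 :=
    (Real.sq_sqrt (integral_nonneg fun _ => by positivity)).symm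
  have hkey : ∫ x in hull (K.erase P), ‖φ x‖ ^ 2 ∂(μH[1] : Measure Plane) ≤
      (height K P)⁻¹ * (2 * E + 2) * (a + b) ^ 2 := by
    have h1 : ∫ x in hull (K.erase P), ‖φ x‖ ^ 2 ∂(μH[1] : Measure Plane) =
        (height K P)⁻¹ * (2 * (∫ x in openTri K, inner ℝ (φ x) (inner ℝ (x - P) (gradient φ x))) +
        2 * a ^ 2) := by
      rw [← ha2, ← e1, hgreen, inv_mul_cancel_left₀ hh.ne']
      simp
    rw [h1, mul_assoc]
    refine mul_le_mul_of_nonneg_left ?_ (inv_nonneg.2 hh.le)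
    have h2 : ∫ x in openTri K, inner ℝ (φ x) (inner ℝ (x - P) (gradient φ x)) ≤ a * (E * b) :=
      (le_abs_self _).trans (hcs.trans (by gcongr))
    nlinarith [mul_nonneg ha0 hb0, mul_nonneg hE0 (sq_nonneg a), mul_nonneg hE0 (sq_nonneg b),
      mul_nonneg hE0 (mul_nonneg ha0 hb0), sq_nonneg b]
  calc _ ≤ √((height K P)⁻¹ * (2 * E + 2) * (a + b) ^ 2) := Real.sqrt_le_sqrt hkey
    _ = _ := by rw [Real.sqrt_mul (by positivity), Real.sqrt_sq (by positivity)]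

/-- Smooth approximants in `H¹` are Cauchy in `L²` of the edge by the trace inequality; their limit
is the trace. -/
theorem IsTri.exists_hasTrace (hK : IsTri K) (hP : P ∈ K) {v : Plane → ℝ} {G : Plane → Plane}
    (hv : InH1 (openTri K) v G) : ∃ t, HasTrace (openTri K) (hull (K.erase P)) v t := by
  have hU := isOpen_openTri K
  have hb := isBounded_openTri K
  obtain ⟨φ, hφ, h1, h2⟩ := hv.exists_seq hU hU.measurableSet subset_rfl hK.shrinksInto
  obtain ⟨C, hC0, hC⟩ := hK.exists_trace_inequality hP
  have m1 := fun n => memLp_of_continuous_of_isBounded hb (hφ n).continuous 2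
  have m2 := fun n => memLp_of_continuous_of_isBounded hb (continuous_gradient (hφ n)) 2
  have m3 := fun n => hK.memLp_edge hP (hφ n).continuous
  have c1 := (tendsto_toLp m1 hv.memLp h1).cauchySeq
  have c2 := (tendsto_toLp m2 hv.memLp_grad h2).cauchySeq
  have c3 : CauchySeq fun n => (m3 n).toLp (φ n) := by
    rw [Metric.cauchySeq_iff] at c1 c2 ⊢
    intro ε hε
    have hε' : 0 < ε / (2 * (C + 1)) := by positivity
    obtain ⟨N1, hN1⟩ := c1 _ hε'
    obtain ⟨N2, hN2⟩ := c2 _ hε'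
    refine ⟨max N1 N2, fun m hm n hn => ?_⟩
    have d1 := hN1 m (le_of_max_le_left hm) n (le_of_max_le_left hn)
    have d2 := hN2 m (le_of_max_le_right hm) n (le_of_max_le_right hn)
    have hs := hC _ ((hφ m).sub (hφ n))
    rw [dist_eq_norm, ← MemLp.toLp_sub, norm_toLp_eq_sqrt] at d1 d2 ⊢
    have e : ∀ x, gradient (fun y => φ m y - φ n y) x = gradient (φ m) x - gradient (φ n) x := by
      intro x
      have hd := fun k => (hφ k).differentiable (by simp) x
      unfold gradient
      rw [fderiv_fun_sub (hd m) (hd n), map_sub]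
    simp only [e] at hs
    simp only [Pi.sub_apply] at d1 d2 ⊢
    refine hs.trans_lt ?_
    calc _ ≤ C * (ε / (2 * (C + 1)) + ε / (2 * (C + 1))) := by gcongr
      _ < ε := by
        rw [← add_div, ← two_mul, mul_div_assoc', div_lt_iff₀ (by positivity)]
        nlinarith
  obtain ⟨t, ht⟩ := cauchySeq_tendsto_of_complete c3
  refine ⟨t, (hasTrace_iff hU hv).2 ⟨Lp.memLp t, fun ε hε => ?_⟩⟩
  have h3 : Tendsto (fun n => eLpNorm (fun x => φ n x - t x) 2
      ((μH[1] : Measure Plane).restrict (hull (K.erase P)))) atTop (𝓝 0) := by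
    rw [Lp.tendsto_Lp_iff_tendsto_eLpNorm'] at ht
    refine ht.congr fun n => eLpNorm_congr_ae ?_
    filter_upwards [(m3 n).coeFn_toLp] with x hx
    rw [Pi.sub_apply, hx]
  have hε' := ge_mem_nhds (pos_iff_ne_zero.2 hε)
  obtain ⟨n, k1, k2, k3⟩ := ((h1.eventually hε').and
    ((h2.eventually hε').and (h3.eventually hε'))).exists
  exact ⟨φ n, hφ n, k1, k2, k3⟩

end

/-! ### Combinatorics of a triangulation -/

theorem mem_hull_of_mem {s : Finset Plane} {x : Plane} (h : x ∈ s) : x ∈ hull s :=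
  subset_convexHull ℝ _ h

/-- An affine function is determined by its values at the vertices of any triangle. -/
theorem IsTri.lam_eq_sum {K K' : Finset Plane} (hK' : IsTri K') (P y : Plane) :
    lam K P y = ∑ R ∈ K', lam K' R y * lam K P R := by
  have h : ∀ R ∈ K', lam K' R y * lam K P R =
      lam K' R y * inner ℝ (gr K P) R + lam K' R y * lam K P 0 := fun R _ => by
    rw [lam_eq_inner_add K P R, mul_add]
  rw [Finset.sum_congr rfl h, Finset.sum_add_distrib, ← Finset.sum_mul, hK'.sum_lam, one_mul,
    lam_eq_inner_add]
  congr 1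
  conv_lhs => rw [← hK'.sum_lam_smul y, inner_sum]
  exact Finset.sum_congr rfl fun R _ => inner_smul_right _ _ _

theorem eq_erase_of_subset {K e : Finset Plane} (hK : K.card = 3) (he : e ⊆ K) (h2 : e.card = 2) :
    ∃ P ∈ K, e = K.erase P := by
  have h1 : (K \ e).card = 1 := by rw [Finset.card_sdiff_of_subset he, hK, h2]
  obtain ⟨P, hP⟩ := Finset.card_eq_one.1 h1
  have hPm : P ∈ K \ e := by rw [hP]; simp
  refine ⟨P, (Finset.mem_sdiff.1 hPm).1, ?_⟩
  rw [Finset.erase_eq, ← hP, Finset.sdiff_sdiff_eq_self he]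

namespace Mesh

variable {Ω : Set Plane} (M : Mesh Ω) {K K' K'' : Finset Plane} {P P' P'' : Plane}

theorem isTri (hK : K ∈ M.tri) : IsTri K := ⟨M.card_tri K hK, M.affineIndependent K hK⟩

/-- `K` and `K'` are different triangles that share the edge opposite to `P` in `K` and to `P'` in
`K'`. -/
structure Nbr (K : Finset Plane) (P : Plane) (K' : Finset Plane) (P' : Plane) : Prop where
  left : K ∈ M.tri
  right : K' ∈ M.tri
  mem_left : P ∈ K
  mem_right : P' ∈ K'
  ne : K ≠ K'
  edge : K.erase P = K'.erase P'

variable {M}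

theorem Nbr.symm (h : M.Nbr K P K' P') : M.Nbr K' P' K P :=
  ⟨h.right, h.left, h.mem_right, h.mem_left, h.ne.symm, h.edge.symm⟩

theorem Nbr.notMem (h : M.Nbr K P K' P') : P ∉ K' := by
  intro hP
  refine h.ne (Finset.eq_of_subset_of_card_le (fun Q hQ => ?_) ?_)
  · by_cases hQP : Q = P
    · rw [hQP]; exact hP
    · have : Q ∈ K.erase P := Finset.mem_erase.2 ⟨hQP, hQ⟩
      rw [h.edge] at this
      exact Finset.mem_of_mem_erase this
  · rw [M.card_tri K h.left, M.card_tri K' h.right]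

theorem Nbr.inter_eq (h : M.Nbr K P K' P') : (K : Set Plane) ∩ K' = (K.erase P : Finset Plane) := by
  ext Q
  constructor
  · rintro ⟨h1, h2⟩
    exact Finset.mem_erase.2 ⟨fun e => h.notMem (e ▸ h2), h1⟩
  · intro hQ
    refine ⟨Finset.mem_of_mem_erase hQ, ?_⟩
    rw [h.edge] at hQ
    exact Finset.mem_of_mem_erase hQ

theorem Nbr.hull_inter (h : M.Nbr K P K' P') : hull K ∩ hull K' = hull (K.erase P) := by
  rw [M.inter K h.left K' h.right, h.inter_eq]; rfl

/-- The two triangles lie on different sides of their common edge. Otherwise a point slightly off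
the midpoint of the edge, towards `P'`, would lie in both triangles, while by conformity they meet
only in the edge. -/
theorem Nbr.lam_neg (h : M.Nbr K P K' P') : lam K P P' < 0 := by
  by_contra! h0
  have hK := M.isTri h.left
  have hK' := M.isTri h.right
  obtain ⟨A, B, hAB, hPA, hPB, hA, hB, he, hKe⟩ := hK.exists_of_mem h.mem_left
  have hA' : A ∈ K'.erase P' := by rw [← h.edge, he]; simp
  have hB' : B ∈ K'.erase P' := by rw [← h.edge, he]; simp
  set a := lam K A P'
  set b := lam K B P'
  -- So small that `t |a|` and `t |b|` are at most `1/4`; the midpoint contributes `(1 - t) / 2 ≥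
  -- 3/8`, which keeps the coordinates of `A` and `B` positive.
  set t : ℝ := 1 / (4 * (1 + |a| + |b|)) with ht
  have hden : 0 < 4 * (1 + |a| + |b|) := by positivity
  have ht0 : 0 < t := by positivity
  have htd : t * (4 * (1 + |a| + |b|)) = 1 := by rw [ht]; field_simp
  have ht4 : t ≤ 1 / 4 := by nlinarith [mul_nonneg ht0.le (abs_nonneg a), mul_nonneg ht0.le (abs_nonneg b)]
  have hta : -(1 / 4) ≤ t * a := by
    nlinarith [mul_nonneg ht0.le (abs_nonneg b), mul_le_mul_of_nonneg_left (neg_abs_le a) ht0.le]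
  have htb : -(1 / 4) ≤ t * b := by
    nlinarith [mul_nonneg ht0.le (abs_nonneg a), mul_le_mul_of_nonneg_left (neg_abs_le b) ht0.le]
  set m : Plane := (1 / 2 : ℝ) • A + (1 / 2 : ℝ) • B
  set X : Plane := (1 - t) • m + t • P'
  have hlam : ∀ (L : Finset Plane) Q, lam L Q X =
      (1 - t) * (1 / 2 * lam L Q A + 1 / 2 * lam L Q B) + t * lam L Q P' := fun L Q => by
    rw [lam_combo _ _ _ _ _ _ (by ring), lam_combo _ _ _ _ _ _ (by norm_num)]
  have hXK : X ∈ hull K := by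
    rw [hK.mem_hull]
    intro Q hQ
    rw [hKe] at hQ
    simp only [Finset.mem_insert, Finset.mem_singleton] at hQ
    rw [hlam]
    rcases hQ with rfl | rfl | rfl
    · rw [hK.lam_of_ne h.mem_left hA hPA, hK.lam_of_ne h.mem_left hB hPB]
      have := mul_nonneg ht0.le h0
      linarith
    · rw [hK.lam_self hA, hK.lam_of_ne hA hB hAB]
      linarith
    · rw [hK.lam_self hB, hK.lam_of_ne hB hA hAB.symm]
      linarith
  have hXK' : X ∈ hull K' := by
    have c := convex_convexHull ℝ (K' : Set Plane)
    exact c (c (mem_hull_of_mem (Finset.mem_of_mem_erase hA'))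
      (mem_hull_of_mem (Finset.mem_of_mem_erase hB')) (by norm_num) (by norm_num) (by norm_num))
      (mem_hull_of_mem h.mem_right) (by linarith) ht0.le (by ring)
  have hX : X ∈ hull (K'.erase P') := by
    rw [← h.edge, ← h.hull_inter]; exact ⟨hXK, hXK'⟩
  have h1 := ((hK'.mem_hull_of_subset (Finset.erase_subset _ _)).1 hX).2 P' h.mem_right (by simp)
  rw [hlam, hK'.lam_self h.mem_right, hK'.lam_of_ne h.mem_right (Finset.mem_of_mem_erase hA')
    (Finset.ne_of_mem_erase hA').symm, hK'.lam_of_ne h.mem_right (Finset.mem_of_mem_erase hB')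
    (Finset.ne_of_mem_erase hB').symm] at h1
  linarith

/-- Both sides are affine in `y`, and both vanish on the common vertices. -/
theorem Nbr.lam_eq (h : M.Nbr K P K' P') (y : Plane) :
    lam K P y = lam K' P' y * lam K P P' := by
  have hK := M.isTri h.left
  rw [(M.isTri h.right).lam_eq_sum P y, Finset.sum_eq_single_of_mem P' h.mem_right]
  intro R hR hRP
  have : R ∈ K.erase P := by rw [h.edge]; exact Finset.mem_erase.2 ⟨hRP, hR⟩
  rw [hK.lam_of_ne h.mem_left (Finset.mem_of_mem_erase this) (Finset.ne_of_mem_erase this).symm,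
    mul_zero]

/-- Three triangles cannot share an edge: `P'` and `P''` both lie opposite to `P`, and they would
also have to lie opposite to each other. The signs in `Nbr.lam_eq` exclude this. -/
theorem Nbr.unique (h : M.Nbr K P K' P') (h' : M.Nbr K P K'' P'') : K' = K'' ∧ P' = P'' := by
  have hKK : K' = K'' := by
    by_contra hne
    have h3 : M.Nbr K' P' K'' P'' :=
      ⟨h.right, h'.right, h.mem_right, h'.mem_right, hne, h.edge.symm.trans h'.edge⟩
    have e := h.lam_eq P''
    have := mul_pos_of_neg_of_neg h3.lam_neg h.lam_neg
    rw [← e] at this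
    exact absurd h'.lam_neg (not_lt.2 this.le)
  refine ⟨hKK, ?_⟩
  subst hKK
  by_contra hne
  have : P' ∈ K'.erase P'' := Finset.mem_erase.2 ⟨hne, h.mem_right⟩
  rw [← h'.edge, h.edge] at this
  simp at this

theorem Nbr.lam_edge (h : M.Nbr K P K' P') {x Q : Plane} (hx : x ∈ hull (K.erase P))
    (hQ : Q ∈ K.erase P) : lam K' Q x = lam K Q x := by
  have hK := M.isTri h.left
  have hK' := M.isTri h.right
  have hx0 := ((hK.mem_hull_of_subset (Finset.erase_subset _ _)).1 hx).2 P h.mem_left (by simp)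
  rw [hK.lam_eq_sum Q x, Finset.sum_eq_single_of_mem Q (Finset.mem_of_mem_erase hQ)]
  · have hQ' := hQ
    rw [h.edge] at hQ'
    rw [hK'.lam_self (Finset.mem_of_mem_erase hQ'), mul_one]
  · intro R hR hRQ
    by_cases hRP : R = P
    · rw [hRP, hx0, zero_mul]
    · have hR' : R ∈ K.erase P := Finset.mem_erase.2 ⟨hRP, hR⟩
      rw [h.edge] at hR' hQ
      rw [hK'.lam_of_ne (Finset.mem_of_mem_erase hQ) (Finset.mem_of_mem_erase hR') hRQ.symm,
        mul_zero]

/-- Near a point of the edge that is not an end point, the coordinates of the common vertices stay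
positive, so the sign of the coordinate of `P` decides which of the two triangles contains the
point. -/
theorem Nbr.mem_interior (h : M.Nbr K P K' P') {x : Plane} (hx : x ∈ hull K)
    (hpos : ∀ Q ∈ K.erase P, 0 < lam K Q x) : x ∈ interior (hull K ∪ hull K') := by
  have hK := M.isTri h.left
  have hK' := M.isTri h.right
  rcases (hK.mem_hull.1 hx P h.mem_left).lt_or_eq with h0 | h0
  · have : x ∈ openTri K := hK.mem_openTri.2 fun Q hQ => by
      by_cases hQP : Q = P
      · rw [hQP]; exact h0
      · exact hpos Q (Finset.mem_erase.2 ⟨hQP, hQ⟩)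
    exact interior_mono Set.subset_union_left this
  have hxe : x ∈ hull (K.erase P) := by
    rw [hK.mem_hull_of_subset (Finset.erase_subset _ _)]
    refine ⟨hK.mem_hull.1 hx, fun Q hQ hQe => ?_⟩
    have : Q = P := by by_contra hne; exact hQe (Finset.mem_erase.2 ⟨hne, hQ⟩)
    rw [this, ← h0]
  rw [mem_interior_iff_mem_nhds]
  have n1 : ∀ᶠ y in 𝓝 x, ∀ Q ∈ K.erase P, 0 < lam K Q y ∧ 0 < lam K' Q y := by
    rw [Filter.eventually_all_finset]
    intro Q hQ
    refine ((continuous_lam K Q).continuousAt.eventually_const_lt (hpos Q hQ)).and ?_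
    refine (continuous_lam K' Q).continuousAt.eventually_const_lt ?_
    rw [h.lam_edge hxe hQ]; exact hpos Q hQ
  filter_upwards [n1] with y hy
  by_cases hy0 : 0 ≤ lam K P y
  · left
    rw [hK.mem_hull]
    intro Q hQ
    by_cases hQP : Q = P
    · rw [hQP]; exact hy0
    · exact (hy Q (Finset.mem_erase.2 ⟨hQP, hQ⟩)).1.le
  · right
    rw [hK'.mem_hull]
    intro Q hQ
    by_cases hQP : Q = P'
    · rw [hQP]
      rw [h.lam_eq y] at hy0
      have := h.lam_neg
      by_contra hneg
      exact hy0 (mul_nonneg_of_nonpos_of_nonpos (not_le.1 hneg).le this.le)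
    · refine (hy Q ?_).2.le
      rw [h.edge]; exact Finset.mem_erase.2 ⟨hQP, hQ⟩

variable (M)

theorem hull_subset_closure (hK : K ∈ M.tri) : hull K ⊆ closure Ω := by
  rw [M.cover]
  exact Set.subset_biUnion_of_mem (u := fun K => hull K) hK

theorem openTri_subset (hΩr : interior (closure Ω) = Ω) (hK : K ∈ M.tri) : openTri K ⊆ Ω := by
  rw [← hΩr]; exact interior_mono (M.hull_subset_closure hK)

theorem interior_pair_subset (hΩr : interior (closure Ω) = Ω) (hK : K ∈ M.tri) (hK' : K' ∈ M.tri) :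
    interior (hull K ∪ hull K') ⊆ Ω := by
  conv_rhs => rw [← hΩr]
  exact interior_mono (Set.union_subset (M.hull_subset_closure hK) (M.hull_subset_closure hK'))

theorem subset_iUnion : Ω ⊆ ⋃ K ∈ M.tri, hull K := by
  rw [← M.cover]; exact subset_closure

theorem isBounded (M : Mesh Ω) : Bornology.IsBounded Ω := by
  refine Bornology.IsBounded.subset ?_ M.subset_iUnion
  rw [Bornology.isBounded_biUnion_finset]
  exact fun K _ => (isCompact_hull K).isBounded

/-- By conformity the point lies in the hull of the common vertices, so a vertex with positive
weight must be common. -/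
theorem mem_of_mem_inter (hK : K ∈ M.tri) (hK' : K' ∈ M.tri) {x : Plane} (hx : x ∈ hull K)
    (hx' : x ∈ hull K') {Q : Plane} (hQ : Q ∈ K) (hpos : 0 < lam K Q x) : Q ∈ K' := by
  have h : x ∈ convexHull ℝ ((K : Set Plane) ∩ (K' : Set Plane)) := by
    rw [← M.inter K hK K' hK']; exact ⟨hx, hx'⟩
  rw [← Finset.coe_inter] at h
  by_contra hQ'
  have := (((M.isTri hK).mem_hull_of_subset Finset.inter_subset_left).1 h).2 Q hQ
    (fun h => hQ' (Finset.mem_inter.1 h).2)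
  exact hpos.ne' this

theorem disjoint_openTri (hK : K ∈ M.tri) (hK' : K' ∈ M.tri) (hne : K ≠ K') :
    Disjoint (openTri K) (openTri K') := by
  rw [Set.disjoint_left]
  intro x hx hx'
  refine hne (Finset.eq_of_subset_of_card_le (fun Q hQ => ?_) ?_)
  · exact M.mem_of_mem_inter hK hK' (openTri_subset_hull K hx) (openTri_subset_hull K' hx') hQ
      ((M.isTri hK).mem_openTri.1 hx Q hQ)
  · rw [M.card_tri K hK, M.card_tri K' hK']

/-- Any other triangle through `x` contains the whole edge and is a neighbour. If there were none, a
small neighbourhood of `x` in `Ω` would be covered by `K` alone, although the points beyond the edge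
are not in `K`. -/
theorem exists_nbr_of_mem (hΩr : interior (closure Ω) = Ω) (hK : K ∈ M.tri) (hP : P ∈ K)
    {x : Plane} (hxΩ : x ∈ Ω) (hx : x ∈ hull (K.erase P))
    (hpos : ∀ Q ∈ K.erase P, 0 < lam K Q x) : ∃ K' P', M.Nbr K P K' P' := by
  have hT := M.isTri hK
  have hx' := (hT.mem_hull_of_subset (Finset.erase_subset _ _)).1 hx
  have hx0 : lam K P x = 0 := hx'.2 P hP (by simp)
  have hxK : x ∈ hull K := hT.mem_hull.2 hx'.1
  have hopen : IsOpen Ω := by rw [← hΩr]; exact isOpen_interior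
  by_contra hno
  push Not at hno
  have hcl : IsClosed (⋃ K' ∈ M.tri.erase K, hull K') :=
    isClosed_biUnion_finset fun K' _ => (isCompact_hull K').isClosed
  have hxn : x ∉ ⋃ K' ∈ M.tri.erase K, hull K' := by
    intro h
    simp only [Set.mem_iUnion, Finset.mem_erase] at h
    obtain ⟨K', ⟨hne, hK'⟩, hxK'⟩ := h
    have hsub : K.erase P ⊆ K' := fun Q hQ =>
      M.mem_of_mem_inter hK hK' hxK hxK' (Finset.mem_of_mem_erase hQ) (hpos Q hQ)
    obtain ⟨P', hP', he⟩ := eq_erase_of_subset (M.card_tri K' hK') hsub (by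
      rw [Finset.card_erase_of_mem hP, M.card_tri K hK])
    exact hno K' P' ⟨hK, hK', hP, hP', hne.symm, he⟩
  -- Negative `t` moves `x` away from `P`, across the edge.
  have hnear : ∀ᶠ t : ℝ in 𝓝[<] 0, (1 - t) • x + t • P ∈ Ω ∩ (⋃ K' ∈ M.tri.erase K, hull K')ᶜ := by
    have hc : Continuous fun t : ℝ => (1 - t) • x + t • P := by fun_prop
    have h0 : (1 - (0 : ℝ)) • x + (0 : ℝ) • P = x := by simp
    have := hc.continuousAt.eventually_mem
      ((hopen.inter hcl.isOpen_compl).mem_nhds (by rw [h0]; exact ⟨hxΩ, hxn⟩))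
    exact this.filter_mono nhdsWithin_le_nhds
  obtain ⟨t, ⟨ht1, ht2⟩, ht0⟩ := (hnear.and self_mem_nhdsWithin).exists
  have ht0' : t < 0 := ht0
  have hmem := M.subset_iUnion ht1
  simp only [Set.mem_iUnion] at hmem
  obtain ⟨K', hK', hy⟩ := hmem
  have hKK : K' = K := by
    by_contra hne
    exact ht2 (Set.mem_biUnion (t := fun K => hull K) (Finset.mem_erase.2 ⟨hne, hK'⟩) hy)
  rw [hKK] at hy
  have := hT.mem_hull.1 hy P hP
  rw [lam_combo _ _ _ _ _ _ (by ring), hx0, hT.lam_self hP] at this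
  linarith

/-- Every relative interior point of the edge is on the frontier, by `exists_nbr_of_mem`; the end
points follow by taking the closure. -/
theorem isBoundaryEdge_of_forall_not_nbr (hΩr : interior (closure Ω) = Ω) (hK : K ∈ M.tri)
    (hP : P ∈ K) (h : ∀ K' P', ¬ M.Nbr K P K' P') : M.IsBoundaryEdge (K.erase P) := by
  have hT := M.isTri hK
  refine ⟨⟨K, hK, Finset.erase_subset _ _⟩, by
    rw [Finset.card_erase_of_mem hP, M.card_tri K hK], ?_⟩
  have hopen : IsOpen Ω := by rw [← hΩr]; exact isOpen_interior
  obtain ⟨A, B, hAB, hPA, hPB, hA, hB, he, hKe⟩ := hT.exists_of_mem hP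
  have hm : ∀ s t : ℝ, 0 < s → 0 < t → s + t = 1 → s • A + t • B ∈ frontier Ω := by
    intro s t hs ht hst
    have hx : s • A + t • B ∈ hull (K.erase P) := by
      refine convex_convexHull ℝ _ (mem_hull_of_mem ?_) (mem_hull_of_mem ?_) hs.le ht.le hst
      · rw [he]; simp
      · rw [he]; simp
    rw [frontier, hopen.interior_eq]
    refine ⟨M.hull_subset_closure hK (hT.mem_hull.2
      ((hT.mem_hull_of_subset (Finset.erase_subset _ _)).1 hx).1), fun hxΩ => ?_⟩
    obtain ⟨K', P', hn⟩ := M.exists_nbr_of_mem hΩr hK hP hxΩ hx (fun Q hQ => by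
      rw [he] at hQ
      simp only [Finset.mem_insert, Finset.mem_singleton] at hQ
      rw [lam_combo _ _ _ _ _ _ hst]
      rcases hQ with rfl | rfl
      · rw [hT.lam_self hA, hT.lam_of_ne hA hB hAB]; linarith
      · rw [hT.lam_self hB, hT.lam_of_ne hB hA hAB.symm]; linarith)
    exact h K' P' hn
  have hsub : openSegment ℝ A B ⊆ frontier Ω := by
    rintro x ⟨s, t, hs, ht, hst, rfl⟩
    exact hm s t hs ht hst
  have := closure_minimal hsub isClosed_frontier
  rw [closure_openSegment] at this
  rw [he, hull, Finset.coe_insert, Finset.coe_singleton, convexHull_pair]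
  exact this

variable {M}

theorem Nbr.midpoint_mem_interior (h : M.Nbr K P K' P') {A B : Plane} (hAB : A ≠ B)
    (he : K.erase P = {A, B}) :
    (1 / 2 : ℝ) • A + (1 / 2 : ℝ) • B ∈ interior (hull K ∪ hull K') := by
  have hT := M.isTri h.left
  have hA : A ∈ K.erase P := by rw [he]; simp
  have hB : B ∈ K.erase P := by rw [he]; simp
  refine h.mem_interior ?_ fun Q hQ => ?_
  · exact convex_convexHull ℝ _ (mem_hull_of_mem (Finset.mem_of_mem_erase hA))
      (mem_hull_of_mem (Finset.mem_of_mem_erase hB)) (by norm_num) (by norm_num) (by norm_num)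
  · rw [he] at hQ
    simp only [Finset.mem_insert, Finset.mem_singleton] at hQ
    have hA := Finset.mem_of_mem_erase hA
    have hB := Finset.mem_of_mem_erase hB
    rw [lam_combo _ _ _ _ _ _ (by norm_num)]
    rcases hQ with rfl | rfl
    · rw [hT.lam_self hA, hT.lam_of_ne hA hB hAB]; norm_num
    · rw [hT.lam_self hB, hT.lam_of_ne hB hA hAB.symm]; norm_num

/-- The midpoint of a shared edge is interior to the union of the two triangles, and so belongs to
`Ω` because `Ω` is the interior of its closure: there are no slits. -/
theorem Nbr.not_isBoundaryEdge (hΩr : interior (closure Ω) = Ω) (h : M.Nbr K P K' P') :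
    ¬ M.IsBoundaryEdge (K.erase P) := by
  rintro ⟨-, -, hf⟩
  have hopen : IsOpen Ω := by rw [← hΩr]; exact isOpen_interior
  obtain ⟨A, B, hAB, hPA, hPB, hA, hB, he, hKe⟩ := (M.isTri h.left).exists_of_mem h.mem_left
  have hm := M.interior_pair_subset hΩr h.left h.right (h.midpoint_mem_interior hAB he)
  have : (1 / 2 : ℝ) • A + (1 / 2 : ℝ) • B ∈ hull (K.erase P) := by
    refine convex_convexHull ℝ _ (mem_hull_of_mem ?_) (mem_hull_of_mem ?_) (by norm_num)
      (by norm_num) (by norm_num)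
    · rw [he]; simp
    · rw [he]; simp
  have := hf this
  rw [frontier, hopen.interior_eq] at this
  exact this.2 hm

variable (M)

theorem isBoundaryEdge_iff (hΩr : interior (closure Ω) = Ω) (hK : K ∈ M.tri) (hP : P ∈ K) :
    M.IsBoundaryEdge (K.erase P) ↔ ∀ K' P', ¬ M.Nbr K P K' P' :=
  ⟨fun h _ _ hn => hn.not_isBoundaryEdge hΩr h, M.isBoundaryEdge_of_forall_not_nbr hΩr hK hP⟩

variable {M}

theorem IsBoundaryEdge.exists {e : Finset Plane} (h : M.IsBoundaryEdge e) :
    ∃ K ∈ M.tri, ∃ P ∈ K, e = K.erase P := by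
  obtain ⟨⟨K, hK, hs⟩, h2, -⟩ := h
  obtain ⟨P, hP, he⟩ := eq_erase_of_subset (M.card_tri K hK) hs h2
  exact ⟨K, hK, P, hP, he⟩

theorem IsBoundaryEdge.unique (hΩr : interior (closure Ω) = Ω) (h : M.IsBoundaryEdge (K.erase P))
    (hK : K ∈ M.tri) (hP : P ∈ K) (hK' : K' ∈ M.tri) (hP' : P' ∈ K')
    (he : K.erase P = K'.erase P') : K = K' ∧ P = P' := by
  have hKK : K = K' := by
    by_contra hne
    exact (M.isBoundaryEdge_iff hΩr hK hP).1 h K' P' ⟨hK, hK', hP, hP', hne, he⟩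
  refine ⟨hKK, ?_⟩
  subst hKK
  by_contra hne
  have : P ∈ K.erase P' := Finset.mem_erase.2 ⟨hne, hP⟩
  rw [← he] at this
  simp at this

variable (M)

/-- Contributions of the two sides of the interior edges cancel. -/
theorem sum_halfEdges (X : Finset Plane → Plane → ℝ)
    (hX : ∀ K P K' P', M.Nbr K P K' P' → X K P + X K' P' = 0) [DecidablePred M.IsBoundaryEdge]
    (hΩr : interior (closure Ω) = Ω) :
    ∑ K ∈ M.tri, ∑ P ∈ K, X K P =
      ∑ K ∈ M.tri, ∑ P ∈ K, if M.IsBoundaryEdge (K.erase P) then X K P else 0 := by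
  classical
  rw [Finset.sum_sigma', Finset.sum_sigma', ← sub_eq_zero, ← Finset.sum_sub_distrib]
  have hs : ∀ z ∈ M.tri.sigma (fun K => K), z.1 ∈ M.tri ∧ z.2 ∈ z.1 := fun z hz =>
    Finset.mem_sigma.1 hz
  have hex : ∀ z : (_ : Finset Plane) × Plane, ∃ z' : (_ : Finset Plane) × Plane,
      (∃ K' P', M.Nbr z.1 z.2 K' P') → M.Nbr z.1 z.2 z'.1 z'.2 := by
    intro z
    by_cases h : ∃ K' P', M.Nbr z.1 z.2 K' P'
    · obtain ⟨K', P', h'⟩ := h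
      exact ⟨⟨K', P'⟩, fun _ => h'⟩
    · exact ⟨z, fun h' => absurd h' h⟩
  choose g hg using hex
  have hnb : ∀ z ∈ M.tri.sigma (fun K => K), ¬ M.IsBoundaryEdge (z.1.erase z.2) →
      M.Nbr z.1 z.2 (g z).1 (g z).2 := by
    intro z hz hb
    rw [M.isBoundaryEdge_iff hΩr (hs z hz).1 (hs z hz).2] at hb
    push Not at hb
    exact hg z hb
  have hinv : ∀ z, M.Nbr z.1 z.2 (g z).1 (g z).2 → g (g z) = z := by
    intro z h
    have h2 := hg (g z) ⟨_, _, h.symm⟩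
    obtain ⟨h3, h4⟩ := h2.unique h.symm
    exact Sigma.ext h3 (heq_of_eq h4)
  -- The involution takes a pair (triangle, vertex) to the pair on the other side of its edge and
  -- fixes the pairs of boundary edges, where the summand is zero.
  refine Finset.sum_involution (fun z _ => if M.IsBoundaryEdge (z.1.erase z.2) then z else g z)
    ?_ ?_ ?_ ?_
  · intro z hz
    by_cases hb : M.IsBoundaryEdge (z.1.erase z.2)
    · simp [hb]
    · have h := hnb z hz hb
      have hb' : ¬ M.IsBoundaryEdge ((g z).1.erase (g z).2) := by rw [← h.edge]; exact hb
      simp only [hb, hb', if_false, sub_zero]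
      exact hX _ _ _ _ h
  · intro z hz hne
    by_cases hb : M.IsBoundaryEdge (z.1.erase z.2)
    · simp [hb] at hne
    · simp only [hb, if_false]
      intro he
      have h := (hnb z hz hb).ne
      rw [he] at h
      exact h rfl
  · intro z hz
    by_cases hb : M.IsBoundaryEdge (z.1.erase z.2)
    · simpa [hb] using hz
    · have h := hnb z hz hb
      simp only [hb, if_false]
      exact Finset.mem_sigma.2 ⟨h.right, h.mem_right⟩
  · intro z hz
    by_cases hb : M.IsBoundaryEdge (z.1.erase z.2)
    · simp [hb]
    · have h := hnb z hz hb
      have hb' : ¬ M.IsBoundaryEdge ((g z).1.erase (g z).2) := by rw [← h.edge]; exact hb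
      simp only [hb, hb', if_false]
      exact hinv z h

/-- A boundary edge belongs to exactly one triangle, so summing over pairs (triangle, vertex) counts
it once. -/
theorem sum_boundary (hΩr : interior (closure Ω) = Ω) {Γ : Finset (Finset Plane)}
    (hΓ : ∀ e ∈ Γ, M.IsBoundaryEdge e) (Y : Finset Plane → ℝ) :
    ∑ K ∈ M.tri, ∑ P ∈ K, (if K.erase P ∈ Γ then Y (K.erase P) else 0) = ∑ e ∈ Γ, Y e := by
  rw [Finset.sum_sigma', ← Finset.sum_filter]
  refine Finset.sum_bij (fun z _ => z.1.erase z.2) ?_ ?_ ?_ ?_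
  · intro z hz
    exact (Finset.mem_filter.1 hz).2
  · intro z hz z' hz' he
    obtain ⟨h1, h2⟩ := Finset.mem_filter.1 hz
    obtain ⟨h1', h2'⟩ := Finset.mem_filter.1 hz'
    obtain ⟨h3, h4⟩ := (hΓ _ h2).unique hΩr (Finset.mem_sigma.1 h1).1 (Finset.mem_sigma.1 h1).2
      (Finset.mem_sigma.1 h1').1 (Finset.mem_sigma.1 h1').2 he
    exact Sigma.ext h3 (heq_of_eq h4)
  · intro e he
    obtain ⟨K, hK, P, hP, h⟩ := (hΓ e he).exists
    exact ⟨⟨K, P⟩, Finset.mem_filter.2 ⟨Finset.mem_sigma.2 ⟨hK, hP⟩, h ▸ he⟩, h.symm⟩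
  · intro z hz; rfl

theorem ae_eq_iUnion (hΩr : interior (closure Ω) = Ω) :
    (⋃ K ∈ M.tri, openTri K : Set Plane) =ᵐ[volume] Ω := by
  have h1 : (⋃ K ∈ M.tri, openTri K : Set Plane) ⊆ Ω :=
    Set.iUnion₂_subset fun K hK => M.openTri_subset hΩr hK
  have h2 : ∀ᵐ x : Plane, ∀ K ∈ M.tri, x ∈ openTri K ↔ x ∈ hull K :=
    (Filter.eventually_all_finset M.tri).2 fun K _ => (hull_ae_eq_openTri K).mem_iff
  filter_upwards [h2] with x hx
  refine propext ⟨fun h => h1 h, fun h => ?_⟩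
  have := M.subset_iUnion h
  simp only [Set.mem_iUnion] at this
  obtain ⟨K, hK, hxK⟩ := this
  exact Set.mem_biUnion hK ((hx K hK).2 hxK)

theorem integral_eq_sum (hΩr : interior (closure Ω) = Ω) {F : Type*} [NormedAddCommGroup F]
    [NormedSpace ℝ F] {f : Plane → F} (hf : ∀ K ∈ M.tri, IntegrableOn f (openTri K)) :
    ∫ x in Ω, f x = ∑ K ∈ M.tri, ∫ x in openTri K, f x := by
  rw [← setIntegral_congr_set (M.ae_eq_iUnion hΩr),
    integral_biUnion_finset _ (fun K _ => (isOpen_openTri K).measurableSet)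
      (fun K hK K' hK' hne => M.disjoint_openTri hK hK' hne) hf]

theorem ae_restrict_iff (hΩr : interior (closure Ω) = Ω) {p : Plane → Prop} :
    (∀ᵐ x ∂(volume.restrict Ω), p x) ↔ ∀ K ∈ M.tri, ∀ᵐ x ∂(volume.restrict (openTri K)), p x := by
  rw [← Measure.restrict_congr_set (M.ae_eq_iUnion hΩr)]
  exact ae_restrict_biUnion_finset_iff _ _ _

end Mesh

/-! ### Connectedness of the triangulation -/

theorem IsTri.lam_pos_of_notMem {K : Finset Plane} {P x : Plane} (hK : IsTri K) (hP : P ∈ K)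
    (hx : x ∈ hull (K.erase P)) (hv : x ∉ K) {Q : Plane} (hQ : Q ∈ K.erase P) :
    0 < lam K Q x := by
  obtain ⟨h1, h2⟩ := (hK.mem_hull_of_subset (Finset.erase_subset _ _)).1 hx
  have hP0 : lam K P x = 0 := h2 P hP (by simp)
  obtain ⟨hQP, hQK⟩ := Finset.mem_erase.1 hQ
  refine (h1 Q hQK).lt_of_ne fun h0 => ?_
  have hcard : ((K.erase P).erase Q).card = 1 := by
    rw [Finset.card_erase_of_mem hQ, Finset.card_erase_of_mem hP, hK.card]
  obtain ⟨R, hR⟩ := Finset.card_eq_one.1 hcard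
  have hRm : R ∈ (K.erase P).erase Q := by rw [hR]; simp
  have hs : ∀ T ∈ K, T ≠ R → lam K T x = 0 := by
    intro T hT hTR
    by_cases hTP : T = P
    · rw [hTP, hP0]
    · by_cases hTQ : T = Q
      · rw [hTQ, ← h0]
      · have : T ∈ (K.erase P).erase Q := by simp [hTP, hTQ, hT]
        rw [hR, Finset.mem_singleton] at this
        exact absurd this hTR
  have hRK : R ∈ K := Finset.mem_of_mem_erase (Finset.mem_of_mem_erase hRm)
  have e1 := hK.sum_lam x
  have e2 := hK.sum_lam_smul x
  rw [Finset.sum_eq_single_of_mem R hRK hs] at e1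
  rw [Finset.sum_eq_single_of_mem R hRK fun T hT hTR => by rw [hs T hT hTR, zero_smul], e1,
    one_smul] at e2
  exact hv (e2 ▸ hRK)

/-- A ball is homeomorphic to the plane, and the plane stays connected when a countable set is
removed. -/
theorem isPreconnected_ball_diff_of_countable {s : Set Plane} (hs : s.Countable) (z : Plane)
    {r : ℝ} (hr : 0 < r) : IsPreconnected (Metric.ball z r \ s) := by
  set Φ := OpenPartialHomeomorph.univBall (E := Plane) z r
  have hsrc : Φ.source = Set.univ := OpenPartialHomeomorph.univBall_source z r
  have htgt : Φ.target = Metric.ball z r := OpenPartialHomeomorph.univBall_target z hr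
  have hinj : Set.InjOn Φ Set.univ := hsrc ▸ Φ.injOn
  have hc : (Φ ⁻¹' s).Countable := hs.preimage_of_injOn (hinj.mono (Set.subset_univ _))
  have hrank : 1 < Module.rank ℝ Plane :=
    Module.one_lt_rank_of_one_lt_finrank (by rw [finrank_euclideanSpace_fin]; norm_num)
  have h := (hc.isConnected_compl_of_one_lt_rank hrank).isPreconnected.image Φ
    (OpenPartialHomeomorph.continuous_univBall z r).continuousOn
  convert h using 1
  ext y
  constructor
  · rintro ⟨hy, hys⟩
    rw [← htgt] at hy
    exact ⟨Φ.symm y, by rw [Set.mem_compl_iff, Set.mem_preimage, Φ.right_inv hy]; exact hys,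
      Φ.right_inv hy⟩
  · rintro ⟨w, hw, rfl⟩
    exact ⟨htgt ▸ Φ.map_source (hsrc ▸ Set.mem_univ w), hw⟩

theorem IsTri.ball_inter_nonempty {K : Finset Plane} (hK : IsTri K) {z : Plane} (hz : z ∈ hull K)
    {r : ℝ} (hr : 0 < r) {s : Set Plane} (hs : s.Countable) :
    ((Metric.ball z r \ s) ∩ hull K).Nonempty := by
  have hcl : z ∈ closure (openTri K) := by
    have h := (convex_convexHull ℝ (K : Set Plane)).closure_interior_eq_closure_of_nonempty_interior
      ⟨_, hK.barycenter_mem⟩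
    exact h ▸ subset_closure hz
  have hne : (Metric.ball z r ∩ openTri K).Nonempty :=
    mem_closure_iff.1 hcl _ Metric.isOpen_ball (Metric.mem_ball_self hr)
  obtain ⟨y, hy, hys⟩ := (hs.dense_compl ℝ).inter_open_nonempty _
    (Metric.isOpen_ball.inter (isOpen_openTri K)) hne
  exact ⟨y, ⟨hy.1, hys⟩, openTri_subset_hull K hy.2⟩

namespace Mesh

variable {Ω : Set Plane} (M : Mesh Ω) {K K' : Finset Plane} {P P' : Plane}

/-- All vertices of the triangulation. -/
def vertices : Set Plane := ⋃ K ∈ M.tri, (K : Set Plane)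

theorem countable_vertices : M.vertices.Countable :=
  (M.tri.finite_toSet.biUnion fun K _ => K.finite_toSet).countable

theorem notMem_of_notMem_vertices {x : Plane} (hx : x ∉ M.vertices) (hK : K ∈ M.tri) : x ∉ K :=
  fun h => hx (by simp only [vertices, Set.mem_iUnion]; exact ⟨K, hK, h⟩)

/-- At a common point that is not a vertex, exactly one coordinate in `K` vanishes; the other two
vertices are common by `mem_of_mem_inter`. -/
theorem exists_nbr_of_mem_inter (hK : K ∈ M.tri) (hK' : K' ∈ M.tri) (hne : K ≠ K') {x : Plane}
    (hx : x ∈ hull K) (hx' : x ∈ hull K') (hv : x ∉ M.vertices) : ∃ P P', M.Nbr K P K' P' := by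
  have hT := M.isTri hK
  obtain ⟨P, hP, hPK'⟩ : ∃ P ∈ K, P ∉ K' := by
    by_contra! h
    exact hne (Finset.eq_of_subset_of_card_le h (by rw [M.card_tri K hK, M.card_tri K' hK']))
  have hxv := M.notMem_of_notMem_vertices hv hK
  have hl := hT.mem_hull.1 hx
  have h0 : lam K P x = 0 := by
    by_contra h0
    exact hPK' (M.mem_of_mem_inter hK hK' hx hx' hP ((hl P hP).lt_of_ne' h0))
  have hxe : x ∈ hull (K.erase P) := by
    refine (hT.mem_hull_of_subset (Finset.erase_subset _ _)).2 ⟨hl, fun Q hQ hQe => ?_⟩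
    have : Q = P := by
      by_contra h
      exact hQe (Finset.mem_erase.2 ⟨h, hQ⟩)
    rw [this, h0]
  have hsub : K.erase P ⊆ K' := fun Q hQ =>
    M.mem_of_mem_inter hK hK' hx hx' (Finset.mem_of_mem_erase hQ)
      (hT.lam_pos_of_notMem hP hxe hxv hQ)
  obtain ⟨P', hP', he⟩ := eq_erase_of_subset (M.card_tri K' hK') hsub
    (by rw [Finset.card_erase_of_mem hP, M.card_tri K hK])
  exact ⟨P, P', hK, hK', hP, hP', hne, he⟩

/-- The triangles with and without the property `A` cover `D` by two closed sets that both meet `D`,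
so these sets meet inside `D`. -/
theorem exists_nbr_of_isPreconnected {D : Set Plane} (hD : IsPreconnected D)
    (hDΩ : D ⊆ closure Ω) (A : Finset Plane → Prop)
    (h1 : ∃ K ∈ M.tri, A K ∧ (D ∩ hull K).Nonempty)
    (h2 : ∃ K ∈ M.tri, ¬ A K ∧ (D ∩ hull K).Nonempty) :
    ∃ z ∈ D, ∃ K ∈ M.tri, ∃ K' ∈ M.tri, A K ∧ ¬ A K' ∧ z ∈ hull K ∧ z ∈ hull K' := by
  classical
  have hcl : ∀ T : Finset (Finset Plane), IsClosed (⋃ K ∈ T, hull K) := fun T =>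
    T.finite_toSet.isClosed_biUnion fun K _ => (isCompact_hull K).isClosed
  obtain ⟨K, hK, hAK, x, hxD, hx⟩ := h1
  obtain ⟨L, hL, hAL, y, hyD, hy⟩ := h2
  obtain ⟨z, hzD, hz1, hz2⟩ := isPreconnected_closed_iff.1 hD
    (⋃ K ∈ M.tri.filter A, hull K) (⋃ K ∈ M.tri.filter (fun K => ¬ A K), hull K)
    (hcl _) (hcl _) (fun w hw => by
      have h := hDΩ hw
      rw [M.cover] at h
      simp only [Set.mem_iUnion] at h
      obtain ⟨J, hJ, hwJ⟩ := h
      by_cases hA : A J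
      · exact Or.inl (Set.mem_biUnion (Finset.mem_coe.2 (Finset.mem_filter.2 ⟨hJ, hA⟩)) hwJ)
      · exact Or.inr (Set.mem_biUnion (Finset.mem_coe.2 (Finset.mem_filter.2 ⟨hJ, hA⟩)) hwJ))
    ⟨x, hxD, Set.mem_biUnion (Finset.mem_coe.2 (Finset.mem_filter.2 ⟨hK, hAK⟩)) hx⟩
    ⟨y, hyD, Set.mem_biUnion (Finset.mem_coe.2 (Finset.mem_filter.2 ⟨hL, hAL⟩)) hy⟩
  simp only [Set.mem_iUnion, Finset.mem_filter] at hz1 hz2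
  obtain ⟨J, ⟨hJ, hAJ⟩, hzJ⟩ := hz1
  obtain ⟨J', ⟨hJ', hAJ'⟩, hzJ'⟩ := hz2
  exact ⟨z, hzD, J, hJ, J', hJ', hAJ, hAJ', hzJ, hzJ'⟩

/-- In a triangulation of a connected domain, any two triangles are linked by a chain of triangles
with common edges. -/
theorem forall_of_nbr (hΩ : IsConnected Ω) (hΩr : interior (closure Ω) = Ω)
    (A : Finset Plane → Prop) (hA : ∀ K P K' P', M.Nbr K P K' P' → A K → A K') (hK : K ∈ M.tri)
    (hAK : A K) : ∀ K' ∈ M.tri, A K' := by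
  by_contra! h
  obtain ⟨L, hL, hAL⟩ := h
  have hne : ∀ J ∈ M.tri, (Ω ∩ hull J).Nonempty := fun J hJ =>
    ⟨_, M.openTri_subset hΩr hJ (M.isTri hJ).barycenter_mem,
      openTri_subset_hull J (M.isTri hJ).barycenter_mem⟩
  obtain ⟨z, hz, J, hJ, J', hJ', hAJ, hAJ', hzJ, hzJ'⟩ :=
    M.exists_nbr_of_isPreconnected hΩ.isPreconnected subset_closure A
      ⟨K, hK, hAK, hne K hK⟩ ⟨L, hL, hAL, hne L hL⟩
  have hopen : IsOpen Ω := by rw [← hΩr]; exact isOpen_interior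
  obtain ⟨r, hr, hrΩ⟩ := Metric.isOpen_iff.1 hopen z hz
  -- The point `z` may be a vertex, where the two triangles need not share an edge. A second
  -- application in a small ball around `z` without the vertices gives a meeting point at which they
  -- do.
  obtain ⟨w, hw, T, hT, T', hT', hAT, hAT', hwT, hwT'⟩ :=
    M.exists_nbr_of_isPreconnected
      (isPreconnected_ball_diff_of_countable M.countable_vertices z hr)
      (Set.sdiff_subset.trans (hrΩ.trans subset_closure)) A
      ⟨J, hJ, hAJ, (M.isTri hJ).ball_inter_nonempty hzJ hr M.countable_vertices⟩
      ⟨J', hJ', hAJ', (M.isTri hJ').ball_inter_nonempty hzJ' hr M.countable_vertices⟩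
  obtain ⟨P, P', hn⟩ := M.exists_nbr_of_mem_inter hT hT' (fun e => hAT' (e ▸ hAT)) hwT hwT' hw.2
  exact hAT' (hA _ _ _ _ hn hAT)

theorem tri_nonempty (hΩ : IsConnected Ω) : M.tri.Nonempty := by
  obtain ⟨x, hx⟩ := hΩ.nonempty
  have := M.subset_iUnion hx
  simp only [Set.mem_iUnion] at this
  obtain ⟨K, hK, -⟩ := this
  exact ⟨K, hK⟩

theorem size_pos (hΩ : IsConnected Ω) : 0 < M.size := by
  obtain ⟨K, hK⟩ := M.tri_nonempty hΩ
  have hb : BddAbove (Set.range fun K : M.tri => Metric.diam ((K : Finset Plane) : Set Plane)) :=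
    (Set.finite_range _).bddAbove
  refine lt_of_lt_of_le ?_ (le_ciSup hb ⟨K, hK⟩)
  obtain ⟨P, hP⟩ : K.Nonempty := by rw [← Finset.card_pos, M.card_tri K hK]; norm_num
  obtain ⟨A, B, hAB, -, -, hA, hB, -⟩ := (M.isTri hK).exists_of_mem hP
  exact lt_of_lt_of_le (dist_pos.2 hAB)
    (Metric.dist_le_diam_of_mem K.finite_toSet.isBounded (Finset.mem_coe.2 hA)
      (Finset.mem_coe.2 hB))

/-- Distinct boundary edges meet only in vertices; this lets the traces on single edges be glued. -/
theorem eq_of_mem_boundaryEdges (hΩr : interior (closure Ω) = Ω) {e e' : Finset Plane}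
    (he : M.IsBoundaryEdge e) (he' : M.IsBoundaryEdge e') {x : Plane} (hx : x ∈ hull e)
    (hx' : x ∈ hull e') (hv : x ∉ M.vertices) : e = e' := by
  obtain ⟨K, hK, P, hP, rfl⟩ := he.exists
  obtain ⟨K', hK', P', hP', rfl⟩ := he'.exists
  have hs : ∀ {J Q}, hull (Finset.erase J Q) ⊆ hull J := fun {J Q} =>
    convexHull_mono (Finset.coe_subset.2 (Finset.erase_subset _ _))
  have hT := M.isTri hK
  have hT' := M.isTri hK'
  have hpos : ∀ Q ∈ K.erase P, 0 < lam K Q x := fun Q hQ =>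
    hT.lam_pos_of_notMem hP hx (M.notMem_of_notMem_vertices hv hK) hQ
  have hc : (K.erase P).card = 2 := by rw [Finset.card_erase_of_mem hP, hT.card]
  have hc' : (K'.erase P').card = 2 := by rw [Finset.card_erase_of_mem hP', hT'.card]
  by_cases hKK : K = K'
  · subst hKK
    refine Finset.eq_of_subset_of_card_le (fun Q hQ => ?_) (by rw [hc, hc'])
    refine Finset.mem_erase.2 ⟨fun h => ?_, Finset.mem_of_mem_erase hQ⟩
    have := ((hT.mem_hull_of_subset (Finset.erase_subset _ _)).1 hx').2 P' hP' (by simp)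
    exact (hpos Q hQ).ne' (h ▸ this)
  · have hsub : K.erase P ⊆ K' := fun Q hQ =>
      M.mem_of_mem_inter hK hK' (hs hx) (hs hx') (Finset.mem_of_mem_erase hQ) (hpos Q hQ)
    obtain ⟨R, hR, hRe⟩ := eq_erase_of_subset hT'.card hsub hc
    exact absurd ⟨hK, hK', hP, hR, hKK, hRe⟩ ((M.isBoundaryEdge_iff hΩr hK hP).1 he K' R)

end Mesh

/-! ### Traces on interior edges and normal fluxes of Raviart–Thomas fields -/

theorem isOpen_of_regular {Ω : Set Plane} (hΩr : interior (closure Ω) = Ω) : IsOpen Ω := by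
  rw [← hΩr]; exact isOpen_interior

section Triangle

variable {K : Finset Plane} {P : Plane}

/-- Green's formula for a smooth function and a Raviart–Thomas field on a triangle. -/
theorem IsTri.green_contDiff (hK : IsTri K) {φ : Plane → ℝ} (hφ : ContDiff ℝ ∞ φ) (a : Plane)
    (c : ℝ) :
    ∫ x in openTri K, (inner ℝ (a + c • x) (gradient φ x) + 2 * c * φ x) =
      ∑ P ∈ K, rtFlux K a c P * ∫ x in hull (K.erase P), φ x ∂(μH[1] : Measure Plane) := by
  rw [hK.green (memLp_of_continuous_of_isBounded (isBounded_openTri K) hφ.continuous 2)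
    (memLp_of_continuous_of_isBounded (isBounded_openTri K) (continuous_gradient hφ) 2)]
  exact Finset.sum_congr rfl fun P hP => by rw [hK.edgeTrace_of_contDiff hP hφ]

theorem setIntegral_hull_eq_zero {e : Finset Plane} {φ : Plane → ℝ} (h : ∀ x ∈ hull e, φ x = 0) :
    ∫ x in hull e, φ x ∂(μH[1] : Measure Plane) = 0 :=
  setIntegral_eq_zero_of_forall_eq_zero h

theorem IsRTOn.ae {p : Plane → Plane} {a : Plane} {c : ℝ} (h : IsRTOn K p a c) :
    ∀ᵐ x ∂(volume.restrict (openTri K)), p x = a + c • x := by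
  rw [IsRTOn, restrict_hull] at h
  exact h

theorem IsTri.rt_unique (hK : IsTri K) {p : Plane → Plane} {a a' : Plane} {c c' : ℝ}
    (h : IsRTOn K p a c) (h' : IsRTOn K p a' c') : a = a' ∧ c = c' := by
  have h1 : Set.EqOn (fun x : Plane => a + c • x) (fun x => a' + c' • x) (openTri K) := by
    refine Measure.eqOn_open_of_ae_eq (μ := volume) ?_ (isOpen_openTri K) (by fun_prop)
      (by fun_prop)
    filter_upwards [h.ae, h'.ae] with x h1 h2
    rw [← h1, h2]
  have hne : ∃ y ∈ openTri K, y ≠ barycenter K := by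
    obtain ⟨y, hy, hyn⟩ := ((Set.countable_singleton (barycenter K)).dense_compl
      ℝ).inter_open_nonempty _ (isOpen_openTri K) ⟨_, hK.barycenter_mem⟩
    exact ⟨y, hy, hyn⟩
  obtain ⟨y, hy, hyn⟩ := hne
  have e1 := h1 hy
  have e2 := h1 hK.barycenter_mem
  simp only at e1 e2
  have e3 : (c - c') • (y - barycenter K) = 0 := by
    have : (c - c') • (y - barycenter K) =
      (a + c • y - (a' + c' • y)) - (a + c • barycenter K - (a' + c' • barycenter K)) := by module
    rw [this, e1, e2]; simp
  rcases smul_eq_zero.1 e3 with e | e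
  · have hc : c = c' := sub_eq_zero.1 e
    exact ⟨by rw [hc] at e2; exact add_right_cancel e2, hc⟩
  · exact absurd (sub_eq_zero.1 e) hyn

/-- Against test functions supported in the open triangle the edge terms of Green's formula vanish,
which leaves the classical divergence `2 c` of the field. -/
theorem HasWeakDiv.ae_eq_of_isRTOn {Ω : Set Plane} (hK : IsTri K) (hKΩ : openTri K ⊆ Ω)
    {p : Plane → Plane} {d : Plane → ℝ} {a : Plane} {c : ℝ} (hp : HasWeakDiv Ω p d)
    (h : IsRTOn K p a c) : ∀ᵐ x ∂(volume.restrict (openTri K)), d x = 2 * c := by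
  have hd : LocallyIntegrableOn d (openTri K) := hp.2.1.mono_set hKΩ
  have hc : LocallyIntegrableOn (fun _ : Plane => 2 * c) (openTri K) :=
    (locallyIntegrable_const _).locallyIntegrableOn _
  have key : ∀ᵐ x ∂volume, x ∈ openTri K → d x - 2 * c = 0 := by
    refine (isOpen_openTri K).ae_eq_zero_of_integral_contDiff_smul_eq_zero (hd.sub hc) ?_
    intro φ h1 h2 h3
    have hφ : IsTestFunction (openTri K) φ := ⟨h1, h2, h3⟩
    have e0 := hp.2.2 φ (hφ.mono hKΩ)
    rw [setIntegral_eq_of_subset hKΩ fun x hx => by rw [hφ.gradient_eq_zero hx, inner_zero_right],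
      setIntegral_eq_of_subset hKΩ fun x hx => by rw [hφ.eq_zero hx, mul_zero]] at e0
    have e1 := hK.green_contDiff h1 a c
    rw [Finset.sum_eq_zero fun P hP => by
      rw [setIntegral_hull_eq_zero fun x hx => hφ.eq_zero fun hxK =>
        ((hK.mem_openTri.1 hxK P hP).ne'
          (((hK.mem_hull_of_subset (Finset.erase_subset _ _)).1 hx).2 P hP (by simp))), mul_zero]]
      at e1
    have e2 : ∫ x in openTri K, inner ℝ (p x) (gradient φ x) =
        ∫ x in openTri K, inner ℝ (a + c • x) (gradient φ x) := by
      refine integral_congr_ae ?_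
      filter_upwards [h.ae] with x hx
      rw [hx]
    have m1 : MemLp (fun x : Plane => a + c • x) 2 (volume.restrict (openTri K)) :=
      memLp_of_continuous_of_isBounded (isBounded_openTri K) (by fun_prop) 2
    have m2 : MemLp (gradient φ) 2 (volume.restrict (openTri K)) :=
      memLp_of_continuous_of_isBounded (isBounded_openTri K) (continuous_gradient h1) 2
    have i1 := integrable_inner_of_memLp m1 m2
    have i2 := hφ.integrableOn_smul hc
    have i3 := hφ.integrableOn_smul hd
    have i2' : Integrable (fun x => 2 * c * φ x) (volume.restrict (openTri K)) := by
      refine i2.congr (Eventually.of_forall fun x => ?_)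
      simp [mul_comm]
    rw [integral_add i1 i2', ← e2, e0] at e1
    rw [← setIntegral_eq_integral_of_forall_compl_eq_zero (s := openTri K)
      (fun x hx => by rw [hφ.eq_zero hx, zero_smul])]
    simp only [smul_sub]
    rw [integral_sub i3 i2]
    simp only [smul_eq_mul] at e1 ⊢
    simp only [mul_comm (φ _)]
    linarith
  rw [ae_restrict_iff' (isOpen_openTri K).measurableSet]
  filter_upwards [key] with x hx hxU
  exact sub_eq_zero.1 (hx hxU)

end Triangle

namespace Mesh

variable {Ω : Set Plane} {M : Mesh Ω} {K K' : Finset Plane} {P P' : Plane}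

/-- The union of the two triangles is contracted towards the midpoint of the common edge, and this
map takes it into its interior. -/
theorem Nbr.shrinksInto (h : M.Nbr K P K' P') :
    ShrinksInto (openTri K ∪ openTri K') (interior (hull K ∪ hull K')) := by
  obtain ⟨A, B, hAB, hPA, hPB, hA, hB, he, -⟩ := (M.isTri h.left).exists_of_mem h.mem_left
  set m : Plane := (1 / 2 : ℝ) • A + (1 / 2 : ℝ) • B with hm
  have key : ∀ {K P K' P'}, M.Nbr K P K' P' → K.erase P = {A, B} → ∀ x ∈ hull K, ∀ s : ℝ, 0 < s →
      s < 1 → (1 - s) • x + s • m ∈ interior (hull K ∪ hull K') := by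
    intro K P K' P' h he x hx s hs0 hs1
    have hT := M.isTri h.left
    have hAe : A ∈ K.erase P := by rw [he]; simp
    have hBe : B ∈ K.erase P := by rw [he]; simp
    have hmK : m ∈ hull K := convex_convexHull ℝ _ (mem_hull_of_mem (Finset.mem_of_mem_erase hAe))
      (mem_hull_of_mem (Finset.mem_of_mem_erase hBe)) (by norm_num) (by norm_num) (by norm_num)
    refine h.mem_interior (convex_convexHull ℝ _ hx hmK (by linarith) hs0.le (by ring))
      fun Q hQ => ?_
    rw [lam_combo K Q x m _ _ (by ring), hm, lam_combo K Q A B _ _ (by norm_num)]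
    have h1 : 0 ≤ (1 - s) * lam K Q x :=
      mul_nonneg (by linarith) (hT.mem_hull.1 hx Q (Finset.mem_of_mem_erase hQ))
    have h2 : 1 / 2 * lam K Q A + 1 / 2 * lam K Q B = 1 / 2 := by
      rw [he] at hQ
      rcases Finset.mem_insert.1 hQ with rfl | hQ
      · rw [hT.lam_self (Finset.mem_of_mem_erase hAe), hT.lam_of_ne (Finset.mem_of_mem_erase hAe)
          (Finset.mem_of_mem_erase hBe) hAB]; ring
      · rw [Finset.mem_singleton] at hQ
        subst hQ
        rw [hT.lam_self (Finset.mem_of_mem_erase hBe), hT.lam_of_ne (Finset.mem_of_mem_erase hBe)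
          (Finset.mem_of_mem_erase hAe) hAB.symm]; ring
    rw [h2]
    linarith
  refine (shrinksInto_of_starConvex ((isCompact_hull K).union (isCompact_hull K'))
    isOpen_interior m ?_).mono
    (Set.union_subset_union (openTri_subset_hull K) (openTri_subset_hull K'))
  rintro x (hx | hx) s hs0 hs1
  · exact key h he x hx s hs0 hs1
  · rw [Set.union_comm]
    exact key h.symm (h.edge ▸ he) x hx s hs0 hs1

theorem union_openTri_subset (K K' : Finset Plane) :
    openTri K ∪ openTri K' ⊆ interior (hull K ∪ hull K') :=
  Set.union_subset (interior_mono Set.subset_union_left) (interior_mono Set.subset_union_right)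

/-- The traces of an `H¹` function from both sides of an interior edge have the same integral. -/
theorem Nbr.edgeTrace_eq (hΩr : interior (closure Ω) = Ω) (h : M.Nbr K P K' P') {v : Plane → ℝ}
    {G : Plane → Plane} (hv : InH1 Ω v G) : edgeTrace K P v G = edgeTrace K' P' v G := by
  have hv' := hv.mono (M.interior_pair_subset hΩr h.left h.right)
  -- One sequence of smooth functions approximates `v` on both triangles at once, and its integrals
  -- over the edge do not depend on the side.
  obtain ⟨φ, h1, h2, h3⟩ := hv'.exists_seq isOpen_interior
    ((isOpen_openTri K).union (isOpen_openTri K')).measurableSet (union_openTri_subset K K')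
    h.shrinksInto
  have lim : ∀ {J Q}, J ∈ M.tri → Q ∈ J → openTri J ⊆ openTri K ∪ openTri K' →
      J.erase Q = K.erase P → Tendsto (fun n => ∫ x in hull (K.erase P), φ n x ∂(μH[1] : Measure Plane))
        atTop (𝓝 (edgeTrace J Q v G)) := by
    intro J Q hJ hQ hs he
    have hvJ := hv.mono (M.openTri_subset hΩr hJ)
    have t := tendsto_edgeTrace (K := J) (P := Q) hvJ.memLp hvJ.memLp_grad
      (fun n => (inH1_of_contDiff (isBounded_openTri J) (h1 n)).memLp)
      (fun n => (inH1_of_contDiff (isBounded_openTri J) (h1 n)).memLp_grad)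
      (tendsto_of_tendsto_of_tendsto_of_le_of_le tendsto_const_nhds h2 (fun _ => zero_le)
        fun n => eLpNorm_mono_measure _ (Measure.restrict_mono hs le_rfl))
      (tendsto_of_tendsto_of_tendsto_of_le_of_le tendsto_const_nhds h3 (fun _ => zero_le)
        fun n => eLpNorm_mono_measure _ (Measure.restrict_mono hs le_rfl))
    refine t.congr fun n => ?_
    rw [(M.isTri hJ).edgeTrace_of_contDiff hQ (h1 n), he]
  exact tendsto_nhds_unique
    (lim h.left h.mem_left Set.subset_union_left rfl)
    (lim h.right h.mem_right Set.subset_union_right h.edge.symm)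

theorem Nbr.interior_ae_eq (K K' : Finset Plane) :
    (openTri K ∪ openTri K' : Set Plane) =ᵐ[volume] interior (hull K ∪ hull K') := by
  filter_upwards [(hull_ae_eq_openTri K).mem_iff, (hull_ae_eq_openTri K').mem_iff] with x h1 h2
  refine propext ⟨fun h => union_openTri_subset K K' h, fun h => ?_⟩
  rcases interior_subset h with h | h
  · exact Or.inl (h1.2 h)
  · exact Or.inr (h2.2 h)

theorem integral_hull_pair_pos {A B x : Plane} (hAB : A ≠ B) {φ : Plane → ℝ} (hc : Continuous φ)
    (h0 : ∀ y, 0 ≤ φ y) {s : ℝ} (hs : s ∈ Set.Icc (0 : ℝ) 1) (hx : x = A + s • (B - A))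
    (hpos : 0 < φ x) : 0 < ∫ y in hull {A, B}, φ y ∂(μH[1] : Measure Plane) := by
  rw [integral_segment hAB]
  refine mul_pos (norm_pos_iff.2 (sub_ne_zero.2 hAB.symm)) ?_
  refine intervalIntegral.integral_pos zero_lt_one (by fun_prop) (fun t _ => h0 _)
    ⟨s, hs, by rwa [← hx]⟩

/-- The normal component of an `H(div)` field of Raviart–Thomas form is continuous. -/
theorem Nbr.rtFlux_add (hΩr : interior (closure Ω) = Ω) (h : M.Nbr K P K' P')
    {p : Plane → Plane} {d : Plane → ℝ} (hp : HasWeakDiv Ω p d) {a a' : Plane} {c c' : ℝ}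
    (hK : IsRTOn K p a c) (hK' : IsRTOn K' p a' c') : rtFlux K a c P + rtFlux K' a' c' P' = 0 := by
  have hT := M.isTri h.left
  have hT' := M.isTri h.right
  obtain ⟨A, B, hAB, hPA, hPB, hA, hB, he, -⟩ := hT.exists_of_mem h.mem_left
  set m : Plane := (1 / 2 : ℝ) • A + (1 / 2 : ℝ) • B with hm
  have hme : m ∈ hull (K.erase P) := by
    refine convex_convexHull ℝ _ (mem_hull_of_mem ?_) (mem_hull_of_mem ?_) (by norm_num)
      (by norm_num) (by norm_num) <;> rw [he] <;> simp
  have hlam : ∀ Q ∈ K.erase P, 0 < lam K Q m := by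
    intro Q hQ
    rw [hm, lam_combo K Q A B _ _ (by norm_num)]
    rw [he] at hQ
    rcases Finset.mem_insert.1 hQ with rfl | hQ
    · rw [hT.lam_self hA, hT.lam_of_ne hA hB hAB]; norm_num
    · rw [Finset.mem_singleton] at hQ
      subst hQ
      rw [hT.lam_self hB, hT.lam_of_ne hB hA hAB.symm]; norm_num
  set U : Set Plane := interior (hull K ∪ hull K') with hU
  have hUΩ : U ⊆ Ω := M.interior_pair_subset hΩr h.left h.right
  have hmU : m ∈ U := h.midpoint_mem_interior hAB he
  have hnhds : {x : Plane | x ∈ U ∧ (∀ Q ∈ K.erase P, 0 < lam K Q x) ∧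
      ∀ Q ∈ K.erase P, 0 < lam K' Q x} ∈ 𝓝 m := by
    have hmU' : ∀ᶠ x in 𝓝 m, x ∈ U := isOpen_interior.mem_nhds hmU
    refine hmU'.and (((eventually_all_finset _).2 fun Q hQ => ?_).and
      ((eventually_all_finset _).2 fun Q hQ => ?_))
    · exact (continuous_lam K Q).continuousAt.eventually (lt_mem_nhds (hlam Q hQ))
    · refine (continuous_lam K' Q).continuousAt.eventually (lt_mem_nhds ?_)
      rw [h.lam_edge hme hQ]
      exact hlam Q hQ
  -- A bump at the midpoint that vanishes on the other four edges: Green's formula on either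
  -- triangle keeps only the common edge, where the integral of `φ` is positive.
  obtain ⟨φ, hφs, hφc, hφd, hφr, hφm⟩ := exists_contDiff_tsupport_subset (n := ⊤) hnhds
  have hφ0 : ∀ y, 0 ≤ φ y := fun y => (hφr ⟨y, rfl⟩).1
  have htest : IsTestFunction U φ := ⟨hφd, hφc, fun x hx => (hφs hx).1⟩
  have hsupp : ∀ x, φ x ≠ 0 → (∀ Q ∈ K.erase P, 0 < lam K Q x) ∧ ∀ Q ∈ K.erase P, 0 < lam K' Q x :=
    fun x hx => (hφs (subset_tsupport φ hx)).2
  have hI : 0 < ∫ x in hull (K.erase P), φ x ∂(μH[1] : Measure Plane) := by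
    rw [he]
    refine integral_hull_pair_pos (s := 1 / 2) (x := m) hAB hφd.continuous hφ0
      (by norm_num) ?_ (by rw [hφm]; exact zero_lt_one)
    rw [hm]; module
  have local_green : ∀ {J Q b e}, IsTri J → Q ∈ J → openTri J ⊆ Ω → J.erase Q = K.erase P →
      IsRTOn J p b e → (∀ x, φ x ≠ 0 → ∀ R ∈ K.erase P, 0 < lam J R x) →
      IntegrableOn (fun x => inner ℝ (p x) (gradient φ x) + d x * φ x) (openTri J) ∧
      ∫ x in openTri J, (inner ℝ (p x) (gradient φ x) + d x * φ x) =
        rtFlux J b e Q * ∫ x in hull (K.erase P), φ x ∂(μH[1] : Measure Plane) := by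
    intro J Q b e hJ hQ hJΩ hJe hrt hl
    have hae : (fun x => inner ℝ (b + e • x) (gradient φ x) + 2 * e * φ x)
        =ᵐ[volume.restrict (openTri J)] fun x => inner ℝ (p x) (gradient φ x) + d x * φ x := by
      filter_upwards [hrt.ae, hp.ae_eq_of_isRTOn hJ hJΩ hrt] with x h1 h2
      rw [h1, h2]
    have hcont : Continuous fun x => inner ℝ (b + e • x) (gradient φ x) + 2 * e * φ x := by
      have := continuous_gradient hφd
      have := hφd.continuous
      fun_prop
    refine ⟨(integrable_of_memLp_openTri (memLp_of_continuous_of_isBounded (isBounded_openTri J)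
      hcont 2)).congr hae, ?_⟩
    rw [← integral_congr_ae hae, hJ.green_contDiff hφd, Finset.sum_eq_single_of_mem Q hQ, hJe]
    intro R hR hRQ
    rw [setIntegral_hull_eq_zero, mul_zero]
    intro x hx
    by_contra hx0
    have h1 : R ∈ K.erase P := hJe ▸ Finset.mem_erase.2 ⟨hRQ, hR⟩
    exact (hl x hx0 R h1).ne'
      (((hJ.mem_hull_of_subset (Finset.erase_subset _ _)).1 hx).2 R hR (by simp))
  obtain ⟨i1, e1⟩ := local_green hT h.mem_left (M.openTri_subset hΩr h.left) rfl hK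
    fun x hx => (hsupp x hx).1
  obtain ⟨i2, e2⟩ := local_green hT' h.mem_right (M.openTri_subset hΩr h.right) h.edge.symm hK'
    fun x hx => (hsupp x hx).2
  have htΩ := htest.mono hUΩ
  have hw := hp.2.2 φ htΩ
  have j2 : IntegrableOn (fun x => d x * φ x) U := by
    refine (htest.integrableOn_smul (hp.2.1.mono_set hUΩ)).congr (Eventually.of_forall fun x => ?_)
    simp [mul_comm]
  have j1 : IntegrableOn (fun x => inner ℝ (p x) (gradient φ x)) U := by
    have k := ((i1.union i2).congr_set_ae (Nbr.interior_ae_eq K K').symm).sub j2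
    refine k.congr (Eventually.of_forall fun x => ?_)
    simp
  -- The weak divergence makes the sum over both triangles vanish. It equals the sum of the two
  -- fluxes times the integral of `φ` over the edge.
  have e3 : ∫ x in U, (inner ℝ (p x) (gradient φ x) + d x * φ x) = 0 := by
    rw [integral_add j1 j2,
      ← setIntegral_eq_of_subset hUΩ (fun x hx => by rw [htest.gradient_eq_zero hx, inner_zero_right]),
      ← setIntegral_eq_of_subset hUΩ (fun x hx => by rw [htest.eq_zero hx, mul_zero]), hw]
    ring
  rw [← setIntegral_congr_set (Nbr.interior_ae_eq K K'),
    setIntegral_union (M.disjoint_openTri h.left h.right h.ne) (isOpen_openTri K').measurableSet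
      i1 i2, e1, e2, ← add_mul] at e3
  exact (mul_eq_zero.1 e3).resolve_right hI.ne'

end Mesh

/-! ### Piecewise defined functions, Raviart–Thomas fields and Green's formula on the domain -/

namespace Mesh

variable {Ω : Set Plane} {M : Mesh Ω} {K K' : Finset Plane} {P P' : Plane}

/-- The function that is equal to `F K` on every open triangle `K`. -/
noncomputable def piecewise {E : Type*} [AddCommMonoid E] (M : Mesh Ω)
    (F : Finset Plane → Plane → E) (x : Plane) : E :=
  ∑ K ∈ M.tri, (openTri K).indicator (F K) x

theorem piecewise_apply {E : Type*} [AddCommMonoid E] {F : Finset Plane → Plane → E}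
    (hK : K ∈ M.tri) {x : Plane} (hx : x ∈ openTri K) : M.piecewise F x = F K x := by
  rw [piecewise, Finset.sum_eq_single_of_mem K hK, Set.indicator_of_mem hx]
  intro K' hK' hne
  exact Set.indicator_of_notMem
    (fun h => Set.disjoint_left.1 (M.disjoint_openTri hK' hK hne) h hx) _

theorem piecewise_ae {E : Type*} [AddCommMonoid E] {F : Finset Plane → Plane → E}
    (hK : K ∈ M.tri) : M.piecewise F =ᵐ[volume.restrict (openTri K)] F K := by
  filter_upwards [ae_restrict_mem (isOpen_openTri K).measurableSet] with x hx
  exact piecewise_apply hK hx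

theorem memLp_of_forall (hΩr : interior (closure Ω) = Ω) {E : Type*} [NormedAddCommGroup E]
    {f : Plane → E} (h : ∀ K ∈ M.tri, MemLp f 2 (volume.restrict (openTri K))) :
    MemLp f 2 (volume.restrict Ω) := by
  have h1 : ∀ K ∈ M.tri, MemLp ((openTri K).indicator f) 2 volume := fun K hK =>
    memLp_indicator_of_restrict (isOpen_openTri K) (h K hK)
  have h2 := (memLp_finsetSum M.tri h1).restrict Ω
  refine h2.ae_eq ?_
  rw [EventuallyEq, M.ae_restrict_iff hΩr]
  intro K hK
  filter_upwards [piecewise_ae (F := fun _ => f) hK] with x hx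
  exact hx

theorem memLp_piecewise (hΩr : interior (closure Ω) = Ω) {E : Type*} [NormedAddCommGroup E]
    {F : Finset Plane → Plane → E} (h : ∀ K ∈ M.tri, Continuous (F K)) :
    MemLp (M.piecewise F) 2 (volume.restrict Ω) :=
  memLp_of_forall (M := M) hΩr fun K hK => (memLp_of_continuous_of_isBounded (isBounded_openTri K)
    (h K hK) 2).ae_eq (piecewise_ae hK).symm

/-- `p` is the `H(div)` field equal to `a K + c K x` on every triangle `K`, with divergence `d`. -/
structure RTData (M : Mesh Ω) (p : Plane → Plane) (d : Plane → ℝ) (a : Finset Plane → Plane)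
    (c : Finset Plane → ℝ) : Prop where
  rt : ∀ K ∈ M.tri, IsRTOn K p (a K) (c K)
  div : ∀ K ∈ M.tri, ∀ᵐ x ∂(volume.restrict (openTri K)), d x = 2 * c K
  flux : ∀ K P K' P', M.Nbr K P K' P' →
    rtFlux K (a K) (c K) P + rtFlux K' (a K') (c K') P' = 0

theorem exists_rtData (hΩr : interior (closure Ω) = Ω) {p : Plane → Plane} {d : Plane → ℝ}
    (hp : MemRT M p) (hd : HasWeakDiv Ω p d) : ∃ a c, RTData M p d a c := by
  choose! a c h using hp.2
  exact ⟨a, c, h, fun K hK => hd.ae_eq_of_isRTOn (M.isTri hK) (M.openTri_subset hΩr hK) (h K hK),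
    fun K P K' P' hn => hn.rtFlux_add hΩr hd (h K hn.left) (h K' hn.right)⟩

theorem rtData_piecewise (a : Finset Plane → Plane) (c : Finset Plane → ℝ)
    (h : ∀ K P K' P', M.Nbr K P K' P' →
      rtFlux K (a K) (c K) P + rtFlux K' (a K') (c K') P' = 0) :
    RTData M (M.piecewise fun K x => a K + c K • x) (M.piecewise fun K _ => 2 * c K) a c :=
  ⟨fun K hK => by rw [IsRTOn, restrict_hull]; exact piecewise_ae hK, fun K hK => piecewise_ae hK, h⟩

variable {p : Plane → Plane} {d : Plane → ℝ} {a : Finset Plane → Plane} {c : Finset Plane → ℝ}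

theorem RTData.memLp (hΩr : interior (closure Ω) = Ω) (h : RTData M p d a c) :
    MemLp p 2 (volume.restrict Ω) :=
  memLp_of_forall (M := M) hΩr fun K hK => (memLp_of_continuous_of_isBounded (isBounded_openTri K)
    (by fun_prop : Continuous fun x => a K + c K • x) 2).ae_eq
    (EventuallyEq.symm (h.rt K hK).ae)

theorem RTData.memLp_div (hΩr : interior (closure Ω) = Ω) (h : RTData M p d a c) :
    MemLp d 2 (volume.restrict Ω) :=
  memLp_of_forall (M := M) hΩr fun K hK => (memLp_of_continuous_of_isBounded (isBounded_openTri K)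
    (continuous_const : Continuous fun _ => 2 * c K) 2).ae_eq (EventuallyEq.symm (h.div K hK))

open scoped Classical in
/-- Green's formula for an `H¹` function and a Raviart–Thomas field. -/
theorem RTData.green (hΩr : interior (closure Ω) = Ω) (h : RTData M p d a c) {v : Plane → ℝ}
    {G : Plane → Plane} (hv : InH1 Ω v G) :
    (∫ x in Ω, inner ℝ (p x) (G x)) + ∫ x in Ω, d x * v x =
      ∑ K ∈ M.tri, ∑ P ∈ K, if M.IsBoundaryEdge (K.erase P) then
        rtFlux K (a K) (c K) P * edgeTrace K P v G else 0 := by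
  have hpi := integrable_inner_of_memLp (h.memLp hΩr) hv.memLp_grad
  have hdi := integrable_smul_of_memLp (h.memLp_div hΩr) hv.memLp
  simp only [smul_eq_mul] at hdi
  have hs : IntegrableOn (fun x => inner ℝ (p x) (G x) + d x * v x) Ω := hpi.add hdi
  rw [← integral_add hpi hdi, M.integral_eq_sum hΩr fun K hK =>
    hs.mono_set (M.openTri_subset hΩr hK),
    ← M.sum_halfEdges (fun K P => rtFlux K (a K) (c K) P * edgeTrace K P v G) ?_ hΩr]
  · refine Finset.sum_congr rfl fun K hK => ?_
    have hvK := hv.mono (M.openTri_subset hΩr hK)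
    rw [← (M.isTri hK).green hvK.memLp hvK.memLp_grad]
    refine integral_congr_ae ?_
    filter_upwards [(h.rt K hK).ae, h.div K hK] with x h1 h2
    rw [h1, h2]
  · intro K P K' P' hn
    rw [hn.edgeTrace_eq hΩr hv, ← add_mul, h.flux K P K' P' hn, zero_mul]

theorem integral_test_edge_eq_zero (hΩr : interior (closure Ω) = Ω) {e : Finset Plane}
    (he : M.IsBoundaryEdge e) {φ : Plane → ℝ} (hφ : ∀ x ∉ Ω, φ x = 0) :
    ∫ x in hull e, φ x ∂(μH[1] : Measure Plane) = 0 :=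
  setIntegral_hull_eq_zero fun x hx => hφ x fun h =>
    (disjoint_interior_frontier (s := Ω)).le_bot
      ⟨(isOpen_of_regular hΩr).interior_eq.symm ▸ h, he.2.2 hx⟩

/-- The converse of `Nbr.rtFlux_add`: if the normal fluxes match on interior edges, only boundary
edges remain in Green's formula, and test functions vanish there. -/
theorem RTData.hasWeakDiv (hΩr : interior (closure Ω) = Ω) (h : RTData M p d a c) :
    HasWeakDiv Ω p d := by
  classical
  refine ⟨locallyIntegrableOn_of_memLp one_le_two (h.memLp hΩr),
    locallyIntegrableOn_of_memLp one_le_two (h.memLp_div hΩr), fun φ hφ => ?_⟩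
  have hg := h.green hΩr (inH1_of_contDiff M.isBounded hφ.1)
  rw [Finset.sum_eq_zero fun K hK => Finset.sum_eq_zero fun P hP => ?_] at hg
  · linarith
  · split_ifs with hb
    · rw [(M.isTri hK).edgeTrace_of_contDiff hP hφ.1,
        integral_test_edge_eq_zero hΩr hb fun x hx => hφ.eq_zero hx, mul_zero]
    · rfl

theorem RTData.memRT (hΩr : interior (closure Ω) = Ω) (h : RTData M p d a c) : MemRT M p :=
  ⟨⟨h.memLp hΩr, d, h.memLp_div hΩr, h.hasWeakDiv hΩr⟩, fun K hK => ⟨_, _, h.rt K hK⟩⟩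

variable {B : BoundarySplit M}

theorem boundaryEdge_of_mem_D {e : Finset Plane} (he : e ∈ B.ΓD) : M.IsBoundaryEdge e :=
  (B.cover e).2 (Or.inl he)

theorem boundaryEdge_of_mem_N {e : Finset Plane} (he : e ∈ B.ΓN) : M.IsBoundaryEdge e :=
  (B.cover e).2 (Or.inr he)

theorem RTData.flux_eq_of_normalEq (h : RTData M p d a c) {g : Finset Plane → ℝ}
    (hN : NormalEq M B p g) (hK : K ∈ M.tri) (hP : P ∈ K) (he : K.erase P ∈ B.ΓN) :
    rtFlux K (a K) (c K) P = g (K.erase P) := by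
  obtain ⟨n, hn⟩ := (M.isTri hK).exists_outerNormal hP
  have hne : (K.erase P).Nonempty := by
    rw [← Finset.card_pos, Finset.card_erase_of_mem hP, M.card_tri K hK]; norm_num
  obtain ⟨x, hx⟩ := hne
  rw [← hn.inner_rt (M.isTri hK) hP (mem_hull_of_mem hx)]
  exact hN _ he K hK (Finset.erase_subset _ _) n hn _ _ (h.rt K hK) x (mem_hull_of_mem hx)

/-- `NormalEq` quantifies over all representations of the field on a triangle, so uniqueness of the
coefficients is needed. -/
theorem RTData.normalEq (h : RTData M p d a c) {g : Finset Plane → ℝ}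
    (hg : ∀ K ∈ M.tri, ∀ P ∈ K, K.erase P ∈ B.ΓN → rtFlux K (a K) (c K) P = g (K.erase P)) :
    NormalEq M B p g := by
  intro e he K hK heK n hn a' c' hrt x hx
  obtain ⟨P, hP, rfl⟩ := eq_erase_of_subset (M.card_tri K hK) heK (boundaryEdge_of_mem_N he).2.1
  obtain ⟨ha, hc⟩ := (M.isTri hK).rt_unique hrt (h.rt K hK)
  rw [hn.inner_rt (M.isTri hK) hP hx, ha, hc]
  exact hg K hK P hP he

/-- Green's formula with traces on the two parts of the boundary. -/
theorem RTData.green_split (hΩr : interior (closure Ω) = Ω) (h : RTData M p d a c)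
    {g : Finset Plane → ℝ}
    (hg : ∀ K ∈ M.tri, ∀ P ∈ K, K.erase P ∈ B.ΓN → rtFlux K (a K) (c K) P = g (K.erase P))
    {v t : Plane → ℝ} {G : Plane → Plane} (hv : InH1 Ω v G) (hD : HasTraceOn M B.ΓD v 0)
    (hN : HasTraceOn M B.ΓN v t) :
    (∫ x in Ω, inner ℝ (p x) (G x)) + ∫ x in Ω, d x * v x = edgePairing B.ΓN g t := by
  classical
  rw [h.green hΩr hv, edgePairing, ← M.sum_boundary hΩr (fun e he => boundaryEdge_of_mem_N he)]
  refine Finset.sum_congr rfl fun K hK => Finset.sum_congr rfl fun P hP => ?_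
  have hvK := hv.mono (M.openTri_subset hΩr hK)
  by_cases hb : M.IsBoundaryEdge (K.erase P)
  · rw [if_pos hb]
    rcases (B.cover _).1 hb with hD' | hN'
    · rw [if_neg (Finset.disjoint_left.1 B.disjoint hD'), ← (M.isTri hK).integral_trace hP hvK
        (hD _ hD' K hK (Finset.erase_subset _ _))]
      simp
    · rw [if_pos hN', ← (M.isTri hK).integral_trace hP hvK
        (hN _ hN' K hK (Finset.erase_subset _ _)), hg K hK P hP hN']
  · rw [if_neg hb, if_neg fun h => hb (boundaryEdge_of_mem_N h)]

/-! ### Existence of traces -/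

theorem hausdorffMeasure_vertices (M : Mesh Ω) : (μH[1] : Measure Plane) M.vertices = 0 :=
  have := Measure.nullSingletonClass_hausdorff Plane one_pos
  M.countable_vertices.measure_zero _

theorem hasTrace_congr {U Γ : Set Plane} {v t t' : Plane → ℝ} (h : HasTrace U Γ v t)
    (ht : t =ᵐ[(μH[1] : Measure Plane).restrict Γ] t') : HasTrace U Γ v t' := by
  obtain ⟨h1, h2, φ, h3, h4, h5, h6⟩ := h
  refine ⟨h1, h2.ae_eq ht, φ, h3, h4, h5, h6.congr fun n => eLpNorm_congr_ae ?_⟩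
  filter_upwards [ht] with x hx
  rw [hx]

/-- An `H¹` function has a trace on every set of boundary edges. -/
theorem exists_hasTraceOn (hΩr : interior (closure Ω) = Ω) {Γ : Finset (Finset Plane)}
    (hΓ : ∀ e ∈ Γ, M.IsBoundaryEdge e) {v : Plane → ℝ} {G : Plane → Plane} (hv : InH1 Ω v G) :
    ∃ t, HasTraceOn M Γ v t := by
  classical
  have h1 : ∀ e ∈ Γ, ∃ t, ∀ K ∈ M.tri, e ⊆ K → HasTrace (openTri K) (hull e) v t := by
    intro e he
    obtain ⟨K, hK, P, hP, rfl⟩ := (hΓ e he).exists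
    obtain ⟨t, ht⟩ := (M.isTri hK).exists_hasTrace hP (hv.mono (M.openTri_subset hΩr hK))
    refine ⟨t, fun K' hK' he' => ?_⟩
    obtain ⟨P', hP', hee⟩ := eq_erase_of_subset (M.card_tri K' hK') he' (hΓ _ he).2.1
    obtain ⟨rfl, -⟩ := IsBoundaryEdge.unique hΩr (hΓ _ he) hK hP hK' hP' hee
    exact ht
  choose! t ht using h1
  -- The glued function takes the trace of any edge through `x`. The choice matters only at
  -- vertices, a null set for arc length.
  refine ⟨fun x => if h : ∃ e ∈ Γ, x ∈ hull e then t h.choose x else 0, fun e he K hK heK =>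
    hasTrace_congr (ht e he K hK heK) ?_⟩
  have hv0 : ∀ᵐ x ∂((μH[1] : Measure Plane).restrict (hull e)), x ∉ M.vertices :=
    ae_restrict_of_ae (measure_eq_zero_iff_ae_notMem.1 M.hausdorffMeasure_vertices)
  filter_upwards [hv0, ae_restrict_mem (measurableSet_hull e)] with x hx hxe
  have hex : ∃ e ∈ Γ, x ∈ hull e := ⟨e, he, hxe⟩
  rw [dif_pos hex]
  rw [M.eq_of_mem_boundaryEdges hΩr (hΓ _ hex.choose_spec.1) (hΓ e he) hex.choose_spec.2 hxe hx]

/-! ### Continuous piecewise linear functions -/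

/-- A constant field has weak divergence zero on `Ω`, so continuity of the normal component applies
to it. Geometrically, the outer normals from the two sides are opposite. -/
theorem rtFlux_const_add (hΩr : interior (closure Ω) = Ω) (h : M.Nbr K P K' P') (w : Plane) :
    rtFlux K w 0 P + rtFlux K' w 0 P' = 0 := by
  refine h.rtFlux_add hΩr (p := fun _ => w) (d := fun _ => 0) ⟨?_, ?_, fun φ hφ => ?_⟩ ?_ ?_
  · exact (locallyIntegrable_const _).locallyIntegrableOn _
  · exact (locallyIntegrable_const _).locallyIntegrableOn _
  · have e := integral_gradient_smul_eq hφ.1 (contDiff_const (c := (1 : ℝ))) hφ.2.1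
    have hg : gradient (fun _ : Plane => (1 : ℝ)) = fun _ => 0 := by
      ext1 x; exact gradient_fun_const x 1
    rw [hg] at e
    simp only [one_smul, smul_zero, integral_zero, neg_zero] at e
    have hi : Integrable (gradient φ) :=
      (continuous_gradient hφ.1).integrable_of_hasCompactSupport (hasCompactSupport_gradient hφ.2.1)
    rw [setIntegral_eq_integral_of_forall_compl_eq_zero fun x hx => by
      rw [hφ.gradient_eq_zero hx, inner_zero_right], integral_inner hi, e]
    simp
  · exact Eventually.of_forall fun x => by simp
  · exact Eventually.of_forall fun x => by simp

/-- A continuous piecewise linear function belongs to `H¹`. -/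
theorem inH1_of_piecewise_affine (hΩr : interior (closure Ω) = Ω) {vh : Plane → ℝ}
    {a : Finset Plane → Plane} {b : Finset Plane → ℝ}
    (h : ∀ K ∈ M.tri, ∀ x ∈ hull K, vh x = inner ℝ (a K) x + b K) :
    InH1 Ω vh (M.piecewise fun K _ => a K) := by
  classical
  have hvae : ∀ K ∈ M.tri, vh =ᵐ[volume.restrict (openTri K)] fun x => inner ℝ (a K) x + b K := by
    intro K hK
    filter_upwards [ae_restrict_mem (isOpen_openTri K).measurableSet] with x hx
    exact h K hK x (openTri_subset_hull K hx)
  have hv : MemLp vh 2 (volume.restrict Ω) :=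
    memLp_of_forall (M := M) hΩr fun K hK => (memLp_of_continuous_of_isBounded
      (isBounded_openTri K) (contDiff_affine (a K) (b K)).continuous 2).ae_eq (hvae K hK).symm
  have hG : MemLp (M.piecewise fun K _ => a K) 2 (volume.restrict Ω) :=
    memLp_piecewise hΩr fun K _ => continuous_const
  refine ⟨hv, hG, fun φ hφ => ?_⟩
  have i1 := hφ.integrableOn_smul_gradient (locallyIntegrableOn_of_memLp one_le_two hv)
  have i2 := hφ.integrableOn_smul (locallyIntegrableOn_of_memLp one_le_two hG)
  have hsm : ∀ K, ContDiff ℝ ∞ fun y => φ y * (inner ℝ (a K) y + b K) := fun K =>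
    hφ.1.mul (contDiff_affine (a K) (b K))
  rw [eq_neg_iff_add_eq_zero, ← integral_add i1 i2]
  refine ext_inner_left ℝ fun w => ?_
  have i3 : IntegrableOn (fun x => vh x • gradient φ x +
      φ x • M.piecewise (fun K _ => a K) x) Ω := i1.add i2
  have i4 : IntegrableOn (fun x => inner ℝ w (vh x • gradient φ x +
      φ x • M.piecewise (fun K _ => a K) x)) Ω := Integrable.const_inner w i3
  rw [inner_zero_right, ← integral_inner i3, M.integral_eq_sum hΩr fun K hK =>
    i4.mono_set (M.openTri_subset hΩr hK)]
  -- Green's formula on `K` for the constant field `w` and the product `φ vh`. The edge terms from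
  -- the two sides cancel because `vh` has the same values on both sides.
  have key : ∀ K ∈ M.tri, ∫ x in openTri K, inner ℝ w
      (vh x • gradient φ x + φ x • M.piecewise (fun K _ => a K) x) =
      ∑ P ∈ K, rtFlux K w 0 P * ∫ x in hull (K.erase P), φ x * vh x ∂(μH[1] : Measure Plane) := by
    intro K hK
    have hg := (M.isTri hK).green_contDiff (hsm K) w 0
    rw [Finset.sum_congr rfl fun P hP => by
      rw [setIntegral_congr_fun (measurableSet_hull _)
        (fun x hx => by
          show φ x * (inner ℝ (a K) x + b K) = φ x * vh x
          rw [h K hK x (convexHull_mono (Finset.coe_subset.2 (Finset.erase_subset P K)) hx)])]]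
      at hg
    rw [← hg]
    refine integral_congr_ae ?_
    filter_upwards [hvae K hK, piecewise_ae (M := M) (F := fun K _ => a K) hK] with x h1 h2
    rw [gradient_mul ((hφ.1.differentiable (by simp)) x) ((contDiff_affine (a K) (b K)).differentiable (by simp) x),
      gradient_affine]
    rw [h1, h2, add_comm]
    simp
  rw [Finset.sum_congr rfl key, M.sum_halfEdges (fun K P => rtFlux K w 0 P *
    ∫ x in hull (K.erase P), φ x * vh x ∂(μH[1] : Measure Plane)) ?_ hΩr]
  · refine Finset.sum_eq_zero fun K hK => Finset.sum_eq_zero fun P hP => ?_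
    split_ifs with hb
    · rw [integral_test_edge_eq_zero hΩr hb fun x hx => by rw [hφ.eq_zero hx, zero_mul], mul_zero]
    · rfl
  · intro K P K' P' hn
    simp only
    rw [hn.edge, ← add_mul, rtFlux_const_add hΩr hn, zero_mul]

theorem hasTraceOn_of_piecewise_affine {vh : Plane → ℝ}
    (h : ∀ K ∈ M.tri, ∃ (a : Plane) (b : ℝ), ∀ x ∈ hull K, vh x = inner ℝ a x + b)
    {Γ : Finset (Finset Plane)} (hΓ : ∀ e ∈ Γ, M.IsBoundaryEdge e) {g : Plane → ℝ}
    (hg : ∀ e ∈ Γ, ∀ x ∈ hull e, vh x = g x) : HasTraceOn M Γ vh g := by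
  intro e he K hK heK
  obtain ⟨P, hP, rfl⟩ := eq_erase_of_subset (M.card_tri K hK) heK (hΓ e he).2.1
  obtain ⟨a, b, hab⟩ := h K hK
  refine hasTrace_of_contDiff (isOpen_openTri K) (isBounded_openTri K) (contDiff_affine a b)
    (fun x hx => hab x (openTri_subset_hull K hx)) (fun x hx => ?_) (measurableSet_hull _)
    ((M.isTri hK).memLp_edge hP (contDiff_affine a b).continuous)
  rw [← hg _ he x hx]
  exact hab x (convexHull_mono (Finset.coe_subset.2 (Finset.erase_subset P K)) hx)

theorem memV_of_memVh (hΩr : interior (closure Ω) = Ω) {g vh : Plane → ℝ} (h : MemVh M B g vh) :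
    MemV M B g vh := by
  have h2 := h.2.1
  choose! a b hab using h2
  exact ⟨(inH1_of_piecewise_affine hΩr hab).memH1, hasTraceOn_of_piecewise_affine h.2.1
    (fun e he => boundaryEdge_of_mem_D he) h.2.2.1, h.2.2.2⟩

theorem hasTraceOn_of_memVh {g vh : Plane → ℝ} (h : MemVh M B g vh) : HasTraceOn M B.ΓN vh vh :=
  hasTraceOn_of_piecewise_affine h.2.1 (fun _ he => boundaryEdge_of_mem_N he) fun _ _ _ _ => rfl

end Mesh

/-! ### Surjectivity of the divergence of Raviart–Thomas fields -/

section Triangle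

variable {K : Finset Plane} {P : Plane}

/-- The field with these coefficients is the sum of `γ Q • (x - Q)`, so any three edge fluxes can be
prescribed on a triangle. -/
theorem IsTri.rtCoeff_sum (hK : IsTri K) (hP : P ∈ K) (γ : Plane → ℝ) :
    rtCoeff K (-∑ Q ∈ K, γ Q • Q) (∑ Q ∈ K, γ Q) P = γ P := by
  have e : rtCoeff K (-∑ Q ∈ K, γ Q • Q) (∑ Q ∈ K, γ Q) P = ∑ Q ∈ K, γ Q * lam K P Q := by
    rw [rtCoeff, inner_neg_right, inner_sum, sub_neg_eq_add, Finset.sum_mul, ← Finset.sum_add_distrib]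
    refine Finset.sum_congr rfl fun Q _ => ?_
    rw [lam_eq_inner_add K P Q, real_inner_smul_right]
    ring
  rw [e, Finset.sum_eq_single_of_mem P hP, hK.lam_self hP, mul_one]
  intro Q hQ hQP
  rw [hK.lam_of_ne hP hQ hQP.symm, mul_zero]

end Triangle

namespace Mesh

variable {Ω : Set Plane} {M : Mesh Ω} {B : BoundarySplit M} {K K' : Finset Plane} {P P' : Plane}

/-- A total normal flux through the edges of all triangles which is conservative and vanishes on the
Neumann boundary. -/
structure IsFlux (B : BoundarySplit M) (X : Finset Plane → Plane → ℝ) : Prop where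
  anti : ∀ K P K' P', M.Nbr K P K' P' → X K P + X K' P' = 0
  zero : ∀ K ∈ M.tri, ∀ P ∈ K, K.erase P ∈ B.ΓN → X K P = 0

theorem IsFlux.sum {ι : Type*} (s : Finset ι) {m : ι → ℝ} {X : ι → Finset Plane → Plane → ℝ}
    (h : ∀ i ∈ s, IsFlux B (X i)) : IsFlux B (fun K P => ∑ i ∈ s, m i * X i K P) :=
  ⟨fun K P K' P' hn => by
    rw [← Finset.sum_add_distrib]
    exact Finset.sum_eq_zero fun i hi => by rw [← mul_add, (h i hi).anti _ _ _ _ hn, mul_zero],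
  fun K hK P hP he => Finset.sum_eq_zero fun i hi => by rw [(h i hi).zero K hK P hP he, mul_zero]⟩

theorem IsFlux.sub {X Y : Finset Plane → Plane → ℝ} (hX : IsFlux B X) (hY : IsFlux B Y) :
    IsFlux B (fun K P => X K P - Y K P) :=
  ⟨fun K P K' P' hn => by linarith [hX.anti _ _ _ _ hn, hY.anti _ _ _ _ hn],
  fun K hK P hP he => by rw [hX.zero K hK P hP he, hY.zero K hK P hP he, sub_zero]⟩

open scoped Classical in
/-- The unit flux through the edge of `K` opposite to `P`. -/
noncomputable def unitFlux (K : Finset Plane) (P : Plane) (J : Finset Plane) (Q : Plane) : ℝ :=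
  if J = K ∧ Q = P then 1 else 0

open scoped Classical in
theorem sum_unitFlux (hP : P ∈ K) (J : Finset Plane) :
    ∑ Q ∈ J, unitFlux K P J Q = if J = K then 1 else 0 := by
  unfold unitFlux
  split_ifs with h
  · subst h
    simp [hP]
  · simp [h]

/-- One unit crosses the common edge: it leaves `K'` and enters `K`. The edge is interior, so the
Neumann condition is untouched. -/
theorem Nbr.isFlux (hΩr : interior (closure Ω) = Ω) (h : M.Nbr K P K' P') :
    IsFlux B (fun J Q => unitFlux K' P' J Q - unitFlux K P J Q) := by
  classical
  refine ⟨fun J Q J' Q' hn => ?_, fun J hJ Q hQ he => ?_⟩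
  · have h1 : ∀ {K P K' P'}, M.Nbr K P K' P' → (J = K ∧ Q = P ↔ J' = K' ∧ Q' = P') := by
      intro K P K' P' h
      constructor
      · rintro ⟨rfl, rfl⟩
        exact hn.unique h
      · rintro ⟨rfl, rfl⟩
        exact hn.symm.unique h.symm
    have h2 := h1 h
    have h3 := h1 h.symm
    simp only [unitFlux, h2, h3]
    ring
  · have hb := boundaryEdge_of_mem_N he
    have hno := (M.isBoundaryEdge_iff hΩr hJ hQ).1 hb
    have h1 : ¬ (J = K ∧ Q = P) := by
      rintro ⟨rfl, rfl⟩; exact hno _ _ h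
    have h2 : ¬ (J = K' ∧ Q = P') := by
      rintro ⟨rfl, rfl⟩; exact hno _ _ h.symm
    simp [unitFlux, h1, h2]

open scoped Classical in
-- Transport one unit along a chain of neighbours from `K` to `K₀`; the contributions to
-- intermediate triangles cancel. Connectedness enters through `forall_of_nbr`.
theorem exists_flux_link (hΩ : IsConnected Ω) (hΩr : interior (closure Ω) = Ω)
    {K₀ : Finset Plane} (hK₀ : K₀ ∈ M.tri) : ∀ K ∈ M.tri, ∃ X, IsFlux B X ∧ ∀ J,
      ∑ P ∈ J, X J P = (if J = K then 1 else 0) - if J = K₀ then 1 else 0 := by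
  refine M.forall_of_nbr hΩ hΩr _ (fun K P K' P' hn hX => ?_) hK₀
    ⟨fun _ _ => 0, ⟨fun _ _ _ _ _ => by simp, fun _ _ _ _ _ => rfl⟩, fun J => by simp⟩
  obtain ⟨X, hX, hs⟩ := hX
  refine ⟨_, IsFlux.sub hX (hn.symm.isFlux hΩr), fun J => ?_⟩
  rw [Finset.sum_sub_distrib, hs, Finset.sum_sub_distrib, sum_unitFlux hn.mem_left,
    sum_unitFlux hn.mem_right]
  ring

open scoped Classical in
-- Let one unit leave through a Dirichlet edge, where neither conservation nor the Neumann condition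
-- imposes a restriction.
theorem exists_flux_dirichlet (hΩr : interior (closure Ω) = Ω) (hD : B.ΓD ≠ ∅) :
    ∃ K₀ ∈ M.tri, ∃ X, IsFlux B X ∧ ∀ J, ∑ P ∈ J, X J P = if J = K₀ then 1 else 0 := by
  obtain ⟨e, he⟩ := Finset.nonempty_iff_ne_empty.2 hD
  have hb := boundaryEdge_of_mem_D he
  obtain ⟨K, hK, P, hP, rfl⟩ := hb.exists
  refine ⟨K, hK, unitFlux K P, ⟨fun J Q J' Q' hn => ?_, fun J hJ Q hQ heN => ?_⟩,
    fun J => sum_unitFlux hP J⟩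
  · have hno := (M.isBoundaryEdge_iff hΩr hK hP).1 hb
    have h1 : ¬ (J = K ∧ Q = P) := by
      rintro ⟨rfl, rfl⟩; exact hno _ _ hn
    have h2 : ¬ (J' = K ∧ Q' = P) := by
      rintro ⟨rfl, rfl⟩; exact hno _ _ hn.symm
    simp [unitFlux, h1, h2]
  · have h1 : ¬ (J = K ∧ Q = P) := by
      rintro ⟨rfl, rfl⟩; exact Finset.disjoint_left.1 B.disjoint he heN
    simp [unitFlux, h1]

open scoped Classical in
/-- Fluxes with arbitrary prescribed sums on the triangles, up to a compensation by the total sum on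
one triangle if there is no Dirichlet boundary. -/
theorem exists_flux_basis (hΩ : IsConnected Ω) (hΩr : interior (closure Ω) = Ω)
    (B : BoundarySplit M) : ∃ (K₀ : Finset Plane) (σ : ℝ) (X : Finset Plane → Finset Plane → Plane → ℝ),
      (B.ΓD ≠ ∅ → σ = 0) ∧ ∀ K ∈ M.tri, IsFlux B (X K) ∧ ∀ J,
        ∑ P ∈ J, X K J P = (if J = K then 1 else 0) - σ * if J = K₀ then 1 else 0 := by
  -- Without a Dirichlet edge each unit ends in `K₀`, which gives `σ = 1`. Otherwise it is sent on
  -- from `K₀` through a Dirichlet edge, and no compensation remains.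
  by_cases hD : B.ΓD = ∅
  · obtain ⟨K₀, hK₀⟩ := M.tri_nonempty hΩ
    choose! X h1 h2 using exists_flux_link (B := B) hΩ hΩr hK₀
    exact ⟨K₀, 1, X, fun h => absurd hD h, fun K hK => ⟨h1 K hK, fun J => by
      rw [h2 K hK, one_mul]⟩⟩
  · obtain ⟨K₀, hK₀, Y, hY, hYs⟩ := exists_flux_dirichlet (B := B) hΩr hD
    choose! X h1 h2 using exists_flux_link (B := B) hΩ hΩr hK₀
    refine ⟨K₀, 0, fun K J P => X K J P + Y J P, fun _ => rfl, fun K hK => ⟨⟨?_, ?_⟩, fun J => ?_⟩⟩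
    · exact fun J Q J' Q' hn => by
        linarith [(h1 K hK).anti _ _ _ _ hn, hY.anti _ _ _ _ hn]
    · exact fun J hJ Q hQ he => by
        linarith [(h1 K hK).zero J hJ Q hQ he, hY.zero J hJ Q hQ he]
    · rw [Finset.sum_add_distrib, h2 K hK, hYs]; ring

/-- The coefficients of the Raviart–Thomas field with the fluxes `X`. -/
noncomputable def fluxA (X : Finset Plane → Plane → ℝ) (K : Finset Plane) : Plane :=
  -∑ Q ∈ K, (X K Q / (2 * volume.real (openTri K))) • Q

/-- The coefficients of the Raviart–Thomas field with the fluxes `X`. -/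
noncomputable def fluxC (X : Finset Plane → Plane → ℝ) (K : Finset Plane) : ℝ :=
  ∑ Q ∈ K, X K Q / (2 * volume.real (openTri K))

/-- The total flux divided by the edge length is the normal component, since height times length is
twice the area. -/
theorem rtFlux_flux (X : Finset Plane → Plane → ℝ) (hK : K ∈ M.tri) (hP : P ∈ K) :
    rtFlux K (fluxA X K) (fluxC X K) P =
      X K P / (μH[1] : Measure Plane).real (hull (K.erase P)) := by
  have hv := (M.isTri hK).volume_pos
  rw [rtFlux, fluxA, fluxC, (M.isTri hK).rtCoeff_sum hP (fun Q => X K Q / (2 * volume.real (openTri K))),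
    height]
  field_simp

theorem IsFlux.rtData {X : Finset Plane → Plane → ℝ} (h : IsFlux B X) :
    RTData M (M.piecewise fun K x => fluxA X K + fluxC X K • x)
      (M.piecewise fun K _ => 2 * fluxC X K) (fluxA X) (fluxC X) :=
  rtData_piecewise _ _ fun K P K' P' hn => by
    rw [rtFlux_flux X hn.left hn.mem_left, rtFlux_flux X hn.right hn.mem_right, hn.edge, ← add_div,
      h.anti _ _ _ _ hn, zero_div]

theorem IsFlux.rtFlux_eq_zero {X : Finset Plane → Plane → ℝ} (h : IsFlux B X) (hK : K ∈ M.tri)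
    (hP : P ∈ K) (he : K.erase P ∈ B.ΓN) : rtFlux K (fluxA X K) (fluxC X K) P = 0 := by
  rw [rtFlux_flux X hK hP, h.zero K hK P hP he, zero_div]

end Mesh

/-! ### The `L²` norm, and a bounded right inverse of the divergence. -/

theorem l2norm_nonneg {F : Type*} [NormedAddCommGroup F] (A : Set Plane) (q : Plane → F) :
    0 ≤ l2norm A q := Real.sqrt_nonneg _

theorem l2norm_sq {F : Type*} [NormedAddCommGroup F] (A : Set Plane) (q : Plane → F) :
    l2norm A q ^ 2 = ∫ x in A, ‖q x‖ ^ 2 :=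
  Real.sq_sqrt (integral_nonneg fun _ => by positivity)

theorem l2norm_congr {F : Type*} [NormedAddCommGroup F] {A : Set Plane} {q r : Plane → F}
    (h : q =ᵐ[volume.restrict A] r) : l2norm A q = l2norm A r := by
  unfold l2norm
  congr 1
  refine integral_congr_ae ?_
  filter_upwards [h] with x hx
  rw [hx]

theorem l2norm_le_of_bound {F : Type*} [NormedAddCommGroup F] {A : Set Plane} (hA : volume A ≠ ⊤)
    {q : Plane → F} {C : ℝ} (hC : 0 ≤ C) (h : ∀ᵐ x ∂(volume.restrict A), ‖q x‖ ≤ C) :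
    l2norm A q ≤ √(volume.real A) * C := by
  have : IsFiniteMeasure (volume.restrict A) := ⟨by simpa using hA.lt_top⟩
  have h1 : ∫ x in A, ‖q x‖ ^ 2 ≤ ∫ _ in A, C ^ 2 := by
    refine integral_mono_of_nonneg (Eventually.of_forall fun _ => by positivity)
      (integrable_const _) ?_
    filter_upwards [h] with x hx
    exact pow_le_pow_left₀ (norm_nonneg _) hx 2
  rw [setIntegral_const, smul_eq_mul] at h1
  refine (Real.sqrt_le_sqrt h1).trans ?_
  rw [Real.sqrt_mul measureReal_nonneg, Real.sqrt_sq hC]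

namespace Mesh

variable {Ω : Set Plane} {M : Mesh Ω} {B : BoundarySplit M} {K K' : Finset Plane} {P P' : Plane}

theorem l2norm_sq_eq_sum (hΩr : interior (closure Ω) = Ω) {F : Type*} [NormedAddCommGroup F]
    [InnerProductSpace ℝ F] {q : Plane → F} (hq : MemLp q 2 (volume.restrict Ω)) :
    l2norm Ω q ^ 2 = ∑ K ∈ M.tri, l2norm (openTri K) q ^ 2 := by
  have hi : IntegrableOn (fun x => ‖q x‖ ^ 2) Ω := integrable_norm_sq_of_memLp hq
  rw [l2norm_sq, M.integral_eq_sum hΩr fun K hK => hi.mono_set (M.openTri_subset hΩr hK)]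
  exact Finset.sum_congr rfl fun K _ => (l2norm_sq _ _).symm

theorem l2norm_piecewise_sq (hΩr : interior (closure Ω) = Ω) (d : Finset Plane → ℝ) :
    l2norm Ω (M.piecewise fun K _ => d K) ^ 2 = ∑ K ∈ M.tri, volume.real (openTri K) * d K ^ 2 := by
  rw [l2norm_sq_eq_sum (M := M) hΩr (memLp_piecewise hΩr fun K _ => continuous_const)]
  refine Finset.sum_congr rfl fun K hK => ?_
  rw [l2norm_congr (piecewise_ae hK), l2norm_sq]
  simp

theorem volume_ne_top (M : Mesh Ω) : volume Ω ≠ ⊤ := M.isBounded.measure_lt_top.ne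

/-- The divergence has a bounded right inverse on the Raviart–Thomas space. -/
theorem exists_bounded_rt (hΩ : IsConnected Ω) (hΩr : interior (closure Ω) = Ω)
    (B : BoundarySplit M) : ∃ C : ℝ, 0 ≤ C ∧ ∀ d : Finset Plane → ℝ,
      (B.ΓD = ∅ → ∑ K ∈ M.tri, volume.real (openTri K) * d K = 0) →
      ∃ q a c, RTData M q (M.piecewise fun K _ => d K) a c ∧
        (∀ K ∈ M.tri, ∀ P ∈ K, K.erase P ∈ B.ΓN → rtFlux K (a K) (c K) P = 0) ∧
        l2norm Ω q ≤ C * l2norm Ω (M.piecewise fun K _ => d K) := by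
  classical
  obtain ⟨K₀, σ, X, hσ, hX⟩ := exists_flux_basis hΩ hΩr B
  obtain ⟨R, hR⟩ := M.isBounded.closure.exists_norm_le
  -- A crude pointwise bound for the field on `J` with data of unit norm: `|R|` bounds the norms of
  -- all points of the domain, so `‖x - Q‖ ≤ 2 |R|`.
  set A : Finset Plane → ℝ := fun J => ∑ Q ∈ J,
    (∑ K ∈ M.tri, √(volume.real (openTri K)) * |X K J Q|) / (2 * volume.real (openTri J)) * (2 * |R|)
    with hA
  have hA0 : ∀ J, 0 ≤ A J := fun J => Finset.sum_nonneg fun Q _ => by positivity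
  refine ⟨√(volume.real Ω) * ∑ J ∈ M.tri, A J,
    mul_nonneg (Real.sqrt_nonneg _) (Finset.sum_nonneg fun J _ => hA0 J), fun d hd => ?_⟩
  set N := l2norm Ω (M.piecewise fun K _ => d K) with hN
  have hN0 : 0 ≤ N := l2norm_nonneg _ _
  set m : Finset Plane → ℝ := fun K => volume.real (openTri K) * d K with hm
  -- `m K` is the integral of the data over `K`; Cauchy–Schwarz on one triangle bounds it.
  have hmN : ∀ K ∈ M.tri, |m K| ≤ √(volume.real (openTri K)) * N := by
    intro K hK
    have h1 : volume.real (openTri K) * d K ^ 2 ≤ N ^ 2 := by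
      rw [hN, l2norm_piecewise_sq hΩr]
      exact Finset.single_le_sum (f := fun K => volume.real (openTri K) * d K ^ 2)
        (fun K _ => by positivity) hK
    have h2 : m K ^ 2 ≤ (√(volume.real (openTri K)) * N) ^ 2 := by
      rw [mul_pow _ N, Real.sq_sqrt measureReal_nonneg]
      calc (volume.real (openTri K) * d K) ^ 2
          = volume.real (openTri K) * (volume.real (openTri K) * d K ^ 2) := by ring
        _ ≤ _ := mul_le_mul_of_nonneg_left h1 measureReal_nonneg
    exact abs_le_of_sq_le_sq h2 (by positivity)
  -- Superpose the basis fluxes with the triangle integrals of the data as weights.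
  set Y : Finset Plane → Plane → ℝ := fun J Q => ∑ K ∈ M.tri, m K * X K J Q with hY
  have hYf : IsFlux B Y := IsFlux.sum M.tri fun K hK => (hX K hK).1
  have hYs : ∀ J ∈ M.tri, ∑ Q ∈ J, Y J Q = m J := by
    intro J hJ
    rw [hY, Finset.sum_comm]
    simp_rw [← Finset.mul_sum]
    rw [Finset.sum_congr rfl fun K hK => by rw [(hX K hK).2 J, mul_sub]]
    rw [Finset.sum_sub_distrib, ← Finset.sum_mul]
    -- The amounts collected in `K₀` add up to zero: either `σ = 0`, or the data have mean zero.
    have h0 : (∑ K ∈ M.tri, m K) * σ = 0 := by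
      by_cases h : B.ΓD = ∅
      · rw [hm, hd h, zero_mul]
      · rw [hσ h, mul_zero]
    rw [← mul_assoc, h0]
    simp [hJ]
  have hc : ∀ J ∈ M.tri, 2 * fluxC Y J = d J := by
    intro J hJ
    have hv := (M.isTri hJ).volume_pos
    rw [fluxC, ← Finset.sum_div, hYs J hJ, hm]
    field_simp
  have hdata := hYf.rtData
  refine ⟨_, _, _, ⟨hdata.rt, fun K hK => ?_, hdata.flux⟩,
    fun K hK P hP he => hYf.rtFlux_eq_zero hK hP he, ?_⟩
  · filter_upwards [piecewise_ae (M := M) (F := fun K _ => d K) hK] with x hx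
    rw [hx, hc K hK]
  · rw [mul_assoc]
    refine l2norm_le_of_bound M.volume_ne_top
      (mul_nonneg (Finset.sum_nonneg fun J _ => hA0 J) hN0) ?_
    rw [M.ae_restrict_iff hΩr]
    intro J hJ
    filter_upwards [hdata.rt J hJ |>.ae, ae_restrict_mem (isOpen_openTri J).measurableSet]
      with x hx hxJ
    rw [hx]
    have hxR : ‖x‖ ≤ |R| := (hR x (M.hull_subset_closure hJ (openTri_subset_hull J hxJ))).trans
      (le_abs_self R)
    refine le_trans ?_ (mul_le_mul_of_nonneg_right
      (Finset.single_le_sum (f := A) (fun J _ => hA0 J) hJ) hN0)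
    have e : fluxA Y J + fluxC Y J • x =
        ∑ Q ∈ J, (Y J Q / (2 * volume.real (openTri J))) • (x - Q) := by
      simp_rw [smul_sub]
      rw [fluxA, fluxC, Finset.sum_sub_distrib, Finset.sum_smul]
      abel
    rw [e, hA, Finset.sum_mul]
    refine (norm_sum_le _ _).trans (Finset.sum_le_sum fun Q hQ => ?_)
    have hQR : ‖Q‖ ≤ |R| := (hR Q (M.hull_subset_closure hJ (mem_hull_of_mem hQ))).trans
      (le_abs_self R)
    have hxQ : ‖x - Q‖ ≤ 2 * |R| := (norm_sub_le _ _).trans (by linarith)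
    have hYb : |Y J Q| ≤ (∑ K ∈ M.tri, √(volume.real (openTri K)) * |X K J Q|) * N := by
      rw [hY, Finset.sum_mul]
      refine (Finset.abs_sum_le_sum_abs _ _).trans (Finset.sum_le_sum fun K hK => ?_)
      rw [abs_mul]
      calc |m K| * |X K J Q| ≤ √(volume.real (openTri K)) * N * |X K J Q| :=
            mul_le_mul_of_nonneg_right (hmN K hK) (abs_nonneg _)
        _ = _ := by ring
    have hv := (M.isTri hJ).volume_pos
    rw [norm_smul, Real.norm_eq_abs, abs_div, abs_of_pos (by positivity : 0 < 2 * volume.real (openTri J))]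
    generalize (∑ K ∈ M.tri, √(volume.real (openTri K)) * |X K J Q|) = s at hYb ⊢
    have h1 := mul_le_mul (div_le_div_of_nonneg_right hYb
      (by positivity : 0 ≤ 2 * volume.real (openTri J))) hxQ (norm_nonneg _)
      (div_nonneg ((abs_nonneg _).trans hYb) (by positivity))
    refine h1.trans (le_of_eq ?_)
    ring

end Mesh

/-! ### Piecewise means, the Poincaré inequality and the constant `κ_h` -/

theorem abs_l2innerVec_le {A : Set Plane} {p q : Plane → Plane}
    (hp : MemLp p 2 (volume.restrict A)) (hq : MemLp q 2 (volume.restrict A)) :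
    |l2innerVec A p q| ≤ l2norm A p * l2norm A q := abs_integral_inner_le hp hq

theorem l2inner_eq {A : Set Plane} (u v : Plane → ℝ) :
    l2inner A u v = ∫ x in A, inner ℝ (u x) (v x) :=
  integral_congr_ae (Eventually.of_forall fun x => by
    simp only [RCLike.inner_apply, conj_trivial]; ring)

theorem abs_l2inner_le {A : Set Plane} {u v : Plane → ℝ}
    (hu : MemLp u 2 (volume.restrict A)) (hv : MemLp v 2 (volume.restrict A)) :
    |l2inner A u v| ≤ l2norm A u * l2norm A v := by
  rw [l2inner_eq]; exact abs_integral_inner_le hu hv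

theorem l2norm_neg {F : Type*} [NormedAddCommGroup F] (A : Set Plane) (q : Plane → F) :
    l2norm A (fun x => -q x) = l2norm A q := by
  unfold l2norm; simp

theorem l2norm_add_le {F : Type*} [NormedAddCommGroup F] [InnerProductSpace ℝ F] {A : Set Plane}
    {p q : Plane → F} (hp : MemLp p 2 (volume.restrict A)) (hq : MemLp q 2 (volume.restrict A)) :
    l2norm A (fun x => p x + q x) ≤ l2norm A p + l2norm A q := sqrt_integral_add_le hp hq

namespace Mesh

variable {Ω : Set Plane} {M : Mesh Ω} {B : BoundarySplit M} {K K' : Finset Plane} {P P' : Plane}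

/-- The function with zero trace on the Dirichlet boundary, or zero mean, and its gradient. -/
structure InV0 (B : BoundarySplit M) (v : Plane → ℝ) (G : Plane → Plane) : Prop where
  inH1 : InH1 Ω v G
  trace : HasTraceOn M B.ΓD v 0
  mean : B.ΓD = ∅ → ∫ x in Ω, v x = 0

theorem InV0.memV {v : Plane → ℝ} {G : Plane → Plane} (h : InV0 B v G) : MemV M B 0 v :=
  ⟨h.inH1.memH1, h.trace, h.mean⟩

theorem inV0_of_memV (hΩr : interior (closure Ω) = Ω) {v : Plane → ℝ} (h : MemV M B 0 v) :
    InV0 B v (weakGrad Ω v) := ⟨h.1.inH1 (isOpen_of_regular hΩr), h.2.1, h.2.2⟩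

/-- The piecewise mean values of `v`. -/
noncomputable def avg (M : Mesh Ω) (v : Plane → ℝ) : Plane → ℝ :=
  M.piecewise fun K _ => ⨍ y in openTri K, v y

theorem memLp_avg (hΩr : interior (closure Ω) = Ω) (v : Plane → ℝ) :
    MemLp (M.avg v) 2 (volume.restrict Ω) := memLp_piecewise hΩr fun _ _ => continuous_const

theorem volume_mul_avg (hK : K ∈ M.tri) (v : Plane → ℝ) :
    volume.real (openTri K) * ⨍ y in openTri K, v y = ∫ y in openTri K, v y := by
  rw [setAverage_eq, smul_eq_mul, mul_inv_cancel_left₀ (M.isTri hK).volume_pos.ne']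

theorem integrableOn_of_memLp {F : Type*} [NormedAddCommGroup F] (M : Mesh Ω) {v : Plane → F}
    (hv : MemLp v 2 (volume.restrict Ω)) : IntegrableOn v Ω := by
  have : IsFiniteMeasure (volume.restrict Ω) := ⟨by simpa using M.volume_ne_top.lt_top⟩
  exact hv.integrable one_le_two

theorem sum_volume_mul_avg (hΩr : interior (closure Ω) = Ω) {v : Plane → ℝ}
    (hv : MemLp v 2 (volume.restrict Ω)) :
    ∑ K ∈ M.tri, volume.real (openTri K) * ⨍ y in openTri K, v y = ∫ x in Ω, v x := by
  rw [M.integral_eq_sum hΩr fun K hK =>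
    (M.integrableOn_of_memLp hv).mono_set (M.openTri_subset hΩr hK)]
  exact Finset.sum_congr rfl fun K hK => volume_mul_avg hK v

theorem integral_piecewise (hΩr : interior (closure Ω) = Ω) (d : Finset Plane → ℝ) :
    ∫ x in Ω, M.piecewise (fun K _ => d K) x = ∑ K ∈ M.tri, volume.real (openTri K) * d K := by
  have hm : MemLp (M.piecewise fun K _ => d K) 2 (volume.restrict Ω) :=
    memLp_piecewise hΩr fun _ _ => continuous_const
  rw [M.integral_eq_sum hΩr fun K hK =>
    (M.integrableOn_of_memLp hm).mono_set (M.openTri_subset hΩr hK)]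
  refine Finset.sum_congr rfl fun K hK => ?_
  rw [integral_congr_ae (piecewise_ae hK), setIntegral_const, smul_eq_mul]

theorem memXh_piecewise (hΩr : interior (closure Ω) = Ω) {d : Finset Plane → ℝ}
    (hd : B.ΓD = ∅ → ∑ K ∈ M.tri, volume.real (openTri K) * d K = 0) :
    MemXh M B (M.piecewise fun K _ => d K) :=
  ⟨memLp_piecewise hΩr fun _ _ => continuous_const,
    fun K hK => ⟨d K, by rw [restrict_hull]; exact piecewise_ae hK⟩,
    fun h => by rw [integral_piecewise hΩr, hd h]⟩

theorem memXh_avg (hΩr : interior (closure Ω) = Ω) {v : Plane → ℝ}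
    (hv : MemLp v 2 (volume.restrict Ω)) (h0 : B.ΓD = ∅ → ∫ x in Ω, v x = 0) :
    MemXh M B (M.avg v) :=
  memXh_piecewise hΩr fun h => by rw [sum_volume_mul_avg hΩr hv, h0 h]

theorem exists_coeff_of_memXh (hΩr : interior (closure Ω) = Ω) {fh : Plane → ℝ}
    (h : MemXh M B fh) : ∃ d : Finset Plane → ℝ,
      fh =ᵐ[volume.restrict Ω] M.piecewise (fun K _ => d K) ∧
      (B.ΓD = ∅ → ∑ K ∈ M.tri, volume.real (openTri K) * d K = 0) := by
  choose! d hd using h.2.1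
  have he : fh =ᵐ[volume.restrict Ω] M.piecewise (fun K _ => d K) := by
    rw [EventuallyEq, M.ae_restrict_iff hΩr]
    intro K hK
    have := hd K hK
    rw [restrict_hull] at this
    filter_upwards [this, piecewise_ae (M := M) (F := fun K _ => d K) hK] with x h1 h2
    rw [h1, h2]
  refine ⟨d, he, fun h0 => ?_⟩
  rw [← integral_piecewise hΩr, ← integral_congr_ae he, h.2.2 h0]

theorem RTData.congr_div (hΩr : interior (closure Ω) = Ω) {p : Plane → Plane} {d d' : Plane → ℝ}
    {a : Finset Plane → Plane} {c : Finset Plane → ℝ} (h : RTData M p d a c)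
    (hd : d =ᵐ[volume.restrict Ω] d') : RTData M p d' a c := by
  refine ⟨h.rt, fun K hK => ?_, h.flux⟩
  filter_upwards [h.div K hK, (M.ae_restrict_iff hΩr).1 hd K hK] with x h1 h2
  rw [← h2, h1]

theorem exists_bounded_rt_of_memXh (hΩ : IsConnected Ω) (hΩr : interior (closure Ω) = Ω)
    (B : BoundarySplit M) : ∃ C : ℝ, 0 ≤ C ∧ ∀ fh, MemXh M B fh →
      ∃ q a c, RTData M q (fun x => -fh x) a c ∧
        (∀ K ∈ M.tri, ∀ P ∈ K, K.erase P ∈ B.ΓN → rtFlux K (a K) (c K) P = 0) ∧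
        l2norm Ω q ≤ C * l2norm Ω fh := by
  obtain ⟨C, hC, h⟩ := exists_bounded_rt hΩ hΩr B
  refine ⟨C, hC, fun fh hfh => ?_⟩
  obtain ⟨d, hd, hs⟩ := exists_coeff_of_memXh hΩr hfh
  obtain ⟨q, a, c, h1, h2, h3⟩ := h (fun K => -d K) fun h0 => by
    simp only [mul_neg, Finset.sum_neg_distrib, hs h0, neg_zero]
  have he : (M.piecewise fun K _ => -d K) =ᵐ[volume.restrict Ω] fun x => -fh x := by
    filter_upwards [hd] with x hx
    rw [hx]
    unfold piecewise
    rw [← Finset.sum_neg_distrib]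
    exact Finset.sum_congr rfl fun K _ => by
      by_cases hxK : x ∈ openTri K <;> simp [hxK]
  refine ⟨q, a, c, h1.congr_div hΩr he, h2, ?_⟩
  rwa [l2norm_congr he, l2norm_neg] at h3

theorem l2inner_avg (hΩr : interior (closure Ω) = Ω) {v : Plane → ℝ}
    (hv : MemLp v 2 (volume.restrict Ω)) : ∫ x in Ω, M.avg v x * v x = l2norm Ω (M.avg v) ^ 2 := by
  have hi : IntegrableOn (fun x => M.avg v x * v x) Ω :=
    integrable_smul_of_memLp (memLp_avg hΩr v) hv
  rw [avg, l2norm_piecewise_sq hΩr, ← avg,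
    M.integral_eq_sum hΩr fun K hK => hi.mono_set (M.openTri_subset hΩr hK)]
  refine Finset.sum_congr rfl fun K hK => ?_
  have e : (fun x => M.avg v x * v x) =ᵐ[volume.restrict (openTri K)]
      fun x => (⨍ y in openTri K, v y) * v x := by
    filter_upwards [piecewise_ae (M := M) (F := fun K _ => ⨍ y in openTri K, v y) hK] with x hx
    rw [avg, hx]
  rw [integral_congr_ae e, integral_const_mul, ← volume_mul_avg hK]
  ring

/-- Pythagoras, since taking piecewise means is an orthogonal projection. -/
theorem l2norm_sq_eq_avg (hΩr : interior (closure Ω) = Ω) {v : Plane → ℝ}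
    (hv : MemLp v 2 (volume.restrict Ω)) :
    l2norm Ω v ^ 2 = l2norm Ω (fun x => v x - M.avg v x) ^ 2 + l2norm Ω (M.avg v) ^ 2 := by
  have ha := memLp_avg (M := M) hΩr v
  have i1 : Integrable (fun x => ‖v x‖ ^ 2) (volume.restrict Ω) := integrable_norm_sq_of_memLp hv
  have i2 : Integrable (fun x => M.avg v x * v x) (volume.restrict Ω) :=
    integrable_smul_of_memLp ha hv
  have i3 : Integrable (fun x => ‖M.avg v x‖ ^ 2) (volume.restrict Ω) :=
    integrable_norm_sq_of_memLp ha
  have i4 : Integrable (fun x => ‖v x‖ ^ 2 - 2 * (M.avg v x * v x)) (volume.restrict Ω) :=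
    i1.sub (i2.const_mul 2)
  have e : ∫ x in Ω, ‖v x - M.avg v x‖ ^ 2 =
      (∫ x in Ω, ‖v x‖ ^ 2) - 2 * (∫ x in Ω, M.avg v x * v x) + ∫ x in Ω, ‖M.avg v x‖ ^ 2 := by
    rw [← integral_const_mul, ← integral_sub i1 (i2.const_mul 2),
      ← integral_add i4 i3]
    refine integral_congr_ae (Eventually.of_forall fun x => ?_)
    simp only [Real.norm_eq_abs, sq_abs]
    ring
  rw [l2norm_sq Ω (fun x => v x - M.avg v x), e, l2inner_avg hΩr hv, ← l2norm_sq, ← l2norm_sq]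
  ring

/-- Testing a Raviart–Thomas field whose divergence is the mean of `v` with `∇v`. -/
theorem InV0.l2innerVec_eq (hΩr : interior (closure Ω) = Ω) {v : Plane → ℝ} {G q : Plane → Plane}
    (h : InV0 B v G) {a : Finset Plane → Plane} {c : Finset Plane → ℝ}
    (hq : RTData M q (fun x => -M.avg v x) a c)
    (h0 : ∀ K ∈ M.tri, ∀ P ∈ K, K.erase P ∈ B.ΓN → rtFlux K (a K) (c K) P = 0) :
    l2innerVec Ω q G = l2norm Ω (M.avg v) ^ 2 := by
  obtain ⟨t, ht⟩ := exists_hasTraceOn hΩr (fun e he => boundaryEdge_of_mem_N (B := B) he) h.inH1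
  have hg := hq.green_split hΩr (g := 0) h0 h.inH1 h.trace ht
  rw [← l2inner_avg hΩr h.inH1.memLp]
  simp only [neg_mul, integral_neg, edgePairing, Pi.zero_apply, zero_mul,
    Finset.sum_const_zero] at hg
  rw [l2innerVec]
  linarith

section Kappa

variable (M B) in
/-- The values of the quotient in the definition of `κ_h` for a given function in `X_h`. -/
def quotients (fh : Plane → ℝ) : Set ℝ :=
  {r : ℝ | ∃ (vh : Plane → ℝ) (qh : Plane → Plane),
      MemVh M B 0 vh ∧ MemRT M qh ∧ NormalEq M B qh 0 ∧ HasWeakDiv Ω qh (fun x => -fh x) ∧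
      r = l2norm Ω (fun x => weakGrad Ω vh x - qh x) / l2norm Ω fh}

theorem quotients_nonneg {fh : Plane → ℝ} {r : ℝ} (h : r ∈ quotients M B fh) : 0 ≤ r := by
  obtain ⟨vh, qh, -, -, -, -, rfl⟩ := h
  exact div_nonneg (l2norm_nonneg _ _) (l2norm_nonneg _ _)

theorem memVh_zero : MemVh M B 0 0 :=
  ⟨continuousOn_const, fun K _ => ⟨0, 0, fun x _ => by simp⟩, fun _ _ _ _ => rfl,
    fun _ => by simp⟩

/-- Take `v_h = 0` and the bounded right inverse of the divergence. So the sets of quotients are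
nonempty and their infima uniformly bounded, and the `sSup` in `kappa` is a true supremum rather
than the default value. -/
theorem exists_quotient_le (hΩ : IsConnected Ω) (hΩr : interior (closure Ω) = Ω)
    (B : BoundarySplit M) : ∃ C : ℝ, ∀ fh, MemXh M B fh → l2norm Ω fh ≠ 0 →
      ∃ r ∈ quotients M B fh, r ≤ C := by
  obtain ⟨C, hC, h⟩ := exists_bounded_rt_of_memXh hΩ hΩr B
  refine ⟨C, fun fh hfh h0 => ?_⟩
  obtain ⟨q, a, c, h1, h2, h3⟩ := h fh hfh
  refine ⟨_, ⟨0, q, memVh_zero, h1.memRT hΩr, h1.normalEq (g := 0) h2, h1.hasWeakDiv hΩr, rfl⟩, ?_⟩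
  have hz : weakGrad Ω (0 : Plane → ℝ) =ᵐ[volume.restrict Ω] fun _ => 0 :=
    (inH1_const M.isBounded 0).weakGrad_ae_eq (isOpen_of_regular hΩr)
  have he : (fun x => weakGrad Ω (0 : Plane → ℝ) x - q x) =ᵐ[volume.restrict Ω] fun x => -q x := by
    filter_upwards [hz] with x hx
    rw [hx, zero_sub]
  rw [l2norm_congr he, l2norm_neg, div_le_iff₀ ((l2norm_nonneg _ _).lt_of_ne' h0)]
  exact h3

theorem kappa_eq (M : Mesh Ω) (B : BoundarySplit M) :
    kappa M B = sSup {m : ℝ | ∃ fh : Plane → ℝ, MemXh M B fh ∧ l2norm Ω fh ≠ 0 ∧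
      m = sInf (quotients M B fh)} := rfl

theorem kappa_nonneg : 0 ≤ kappa M B := by
  rw [kappa_eq]
  refine Real.sSup_nonneg fun m hm => ?_
  obtain ⟨fh, -, -, rfl⟩ := hm
  exact Real.sInf_nonneg fun r hr => quotients_nonneg hr

theorem sInf_quotients_le_kappa (hΩ : IsConnected Ω) (hΩr : interior (closure Ω) = Ω)
    {fh : Plane → ℝ} (hfh : MemXh M B fh) (h0 : l2norm Ω fh ≠ 0) :
    sInf (quotients M B fh) ≤ kappa M B := by
  obtain ⟨C, hC⟩ := exists_quotient_le hΩ hΩr B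
  rw [kappa_eq]
  refine le_csSup ⟨C, ?_⟩ ⟨fh, hfh, h0, rfl⟩
  rintro m ⟨gh, hgh, hg0, rfl⟩
  obtain ⟨r, hr, hrC⟩ := hC gh hgh hg0
  exact (csInf_le ⟨0, fun r hr => quotients_nonneg hr⟩ hr).trans hrC

/-- A function that is orthogonal to the finite element space in the energy inner product has small
piecewise means. -/
theorem InV0.l2norm_avg_le (hΩ : IsConnected Ω) (hΩr : interior (closure Ω) = Ω) {v : Plane → ℝ}
    {G : Plane → Plane} (h : InV0 B v G)
    (ho : ∀ vh, MemVh M B 0 vh → l2innerVec Ω (weakGrad Ω vh) G = 0) :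
    l2norm Ω (M.avg v) ≤ kappa M B * l2norm Ω G := by
  have hG0 := l2norm_nonneg Ω G
  by_cases h0 : l2norm Ω (M.avg v) = 0
  · rw [h0]; exact mul_nonneg kappa_nonneg hG0
  have hX := memXh_avg (B := B) hΩr h.inH1.memLp h.mean
  have hpos : 0 < l2norm Ω (M.avg v) := (l2norm_nonneg _ _).lt_of_ne' h0
  -- Green's formula turns the squared norm of the mean into the pairing of `qh` with `G`.
  -- Orthogonality of `G` to discrete gradients allows subtracting `∇vh` before Cauchy–Schwarz.
  have key : ∀ r ∈ quotients M B (M.avg v), l2norm Ω (M.avg v) ≤ r * l2norm Ω G := by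
    rintro r ⟨vh, qh, hvh, hqh, hN, hdiv, rfl⟩
    obtain ⟨a, c, hdata⟩ := exists_rtData hΩr hqh hdiv
    have e1 := h.l2innerVec_eq hΩr hdata fun K hK P hP he =>
      hdata.flux_eq_of_normalEq (g := 0) hN hK hP he
    have mq := hdata.memLp hΩr
    have mv := ((memV_of_memVh hΩr hvh).1.inH1 (isOpen_of_regular hΩr)).memLp_grad
    have e2 : l2innerVec Ω (fun x => weakGrad Ω vh x - qh x) G = - l2norm Ω (M.avg v) ^ 2 := by
      rw [← e1, ← zero_sub, ← ho vh hvh]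
      unfold l2innerVec
      rw [← integral_sub (integrable_inner_of_memLp mv h.inH1.memLp_grad)
        (integrable_inner_of_memLp mq h.inH1.memLp_grad)]
      simp only [inner_sub_left]
    have e3 := abs_l2innerVec_le (mv.sub mq) h.inH1.memLp_grad
    have e4 : l2norm Ω (M.avg v) ^ 2 ≤ l2norm Ω (fun x => weakGrad Ω vh x - qh x) * l2norm Ω G := by
      refine le_trans ?_ e3
      have : l2innerVec Ω (weakGrad Ω vh - qh) G = - l2norm Ω (M.avg v) ^ 2 := e2
      rw [this, abs_neg, abs_of_nonneg (by positivity)]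
    rw [div_mul_eq_mul_div, le_div_iff₀ hpos, ← sq]
    exact e4
  obtain ⟨C, hC⟩ := exists_quotient_le hΩ hΩr B
  obtain ⟨r₀, hr₀, -⟩ := hC _ hX h0
  -- With `‖G‖ > 0` the bound can be divided by `‖G‖`, which leaves a lower bound for all quotients,
  -- hence for their infimum.
  have hGpos : 0 < l2norm Ω G := by
    refine hG0.lt_of_ne' fun hz => ?_
    have := key r₀ hr₀
    rw [hz, mul_zero] at this
    exact absurd hpos (not_lt.2 this)
  rw [← div_le_iff₀ hGpos]
  refine le_trans (le_csInf ⟨r₀, hr₀⟩ fun r hr => ?_) (sInf_quotients_le_kappa hΩ hΩr hX h0)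
  rw [div_le_iff₀ hGpos]
  exact key r hr

end Kappa

section ProjectionConstant

variable {C0K : Finset Plane → ℝ}

/-- A linear function with nonzero gradient rules out negative constants. -/
theorem projectionConstant_nonneg (hK : K ∈ M.tri) {c : ℝ} (hc : IsProjectionConstant K c) :
    0 ≤ c := by
  have hT := M.isTri hK
  obtain ⟨P, hP⟩ : K.Nonempty := by rw [← Finset.card_pos, hT.card]; norm_num
  obtain ⟨A, -, -, hPA, -, hA, -⟩ := hT.exists_of_mem hP
  have hgr : gr K P ≠ 0 := by
    intro h0
    have := lam_sub K P P A
    rw [h0, inner_zero_left, hT.lam_self hP, hT.lam_of_ne hP hA hPA] at this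
    norm_num at this
  have hin := inH1_of_contDiff (isBounded_openTri K) (contDiff_affine (gr K P) 0)
  have hw := hin.weakGrad_ae_eq (isOpen_openTri K)
  have hpos : 0 < l2norm (openTri K) (weakGrad (openTri K) fun y => inner ℝ (gr K P) y + 0) := by
    rw [l2norm_congr hw, l2norm]
    simp only [gradient_affine]
    rw [setIntegral_const, smul_eq_mul]
    have := hT.volume_pos
    have := norm_pos_iff.2 hgr
    positivity
  by_contra! h
  exact absurd ((l2norm_nonneg _ _).trans (hc _ hin.memH1)) (not_le.2 (mul_neg_of_neg_of_pos h hpos))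

theorem le_C0_mul_size (hΩ : IsConnected Ω) (C0K : Finset Plane → ℝ) (hK : K ∈ M.tri) :
    C0K K ≤ M.C0 C0K * M.size := by
  have hs := M.size_pos hΩ
  have h : C0K K / M.size ≤ M.C0 C0K :=
    le_ciSup (f := fun K : M.tri => C0K K / M.size) (Set.finite_range _).bddAbove ⟨K, hK⟩
  rwa [div_le_iff₀ hs] at h

theorem C0_mul_size_nonneg (hΩ : IsConnected Ω)
    (hC : ∀ K ∈ M.tri, IsProjectionConstant K (C0K K)) : 0 ≤ M.C0 C0K * M.size := by
  obtain ⟨K, hK⟩ := M.tri_nonempty hΩ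
  exact (projectionConstant_nonneg hK (hC K hK)).trans (le_C0_mul_size hΩ C0K hK)

/-- Square the Poincaré inequality on each triangle and sum; the mesh size cancels in `C₀ h`, which
dominates every local constant. -/
theorem l2norm_sub_avg_le (hΩ : IsConnected Ω) (hΩr : interior (closure Ω) = Ω)
    (hC : ∀ K ∈ M.tri, IsProjectionConstant K (C0K K)) {v : Plane → ℝ} {G : Plane → Plane}
    (hv : InH1 Ω v G) :
    l2norm Ω (fun x => v x - M.avg v x) ≤ M.C0 C0K * M.size * l2norm Ω G := by
  have hm := C0_mul_size_nonneg hΩ hC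
  refine le_of_sq_le_sq ?_ (mul_nonneg hm (l2norm_nonneg _ _))
  have ms : MemLp (fun x => v x - M.avg v x) 2 (volume.restrict Ω) :=
    hv.memLp.sub (memLp_avg hΩr v)
  rw [l2norm_sq_eq_sum (M := M) hΩr ms, mul_pow,
    l2norm_sq_eq_sum (M := M) hΩr hv.memLp_grad, Finset.mul_sum]
  refine Finset.sum_le_sum fun K hK => ?_
  have hvK := hv.mono (M.openTri_subset hΩr hK)
  have h1 := hC K hK v hvK.memH1
  rw [l2norm_congr (hvK.weakGrad_ae_eq (isOpen_openTri K))] at h1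
  have e : (fun x => v x - M.avg v x) =ᵐ[volume.restrict (openTri K)]
      fun x => v x - ⨍ y in openTri K, v y := by
    filter_upwards [piecewise_ae (M := M) (F := fun K _ => ⨍ y in openTri K, v y) hK] with x hx
    rw [avg, hx]
  rw [l2norm_congr e, ← mul_pow]
  exact pow_le_pow_left₀ (l2norm_nonneg _ _) (h1.trans (mul_le_mul_of_nonneg_right
    (le_C0_mul_size hΩ C0K hK) (l2norm_nonneg _ _))) 2

/-- The `L²` error estimate by duality. -/
theorem InV0.l2norm_le_Ch (hΩ : IsConnected Ω) (hΩr : interior (closure Ω) = Ω)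
    (hC : ∀ K ∈ M.tri, IsProjectionConstant K (C0K K)) {v : Plane → ℝ}
    {G : Plane → Plane} (h : InV0 B v G)
    (ho : ∀ vh, MemVh M B 0 vh → l2innerVec Ω (weakGrad Ω vh) G = 0) :
    l2norm Ω v ≤ Ch M B C0K * l2norm Ω G := by
  refine le_of_sq_le_sq ?_ (mul_nonneg (Real.sqrt_nonneg _) (l2norm_nonneg _ _))
  have h1 := l2norm_sub_avg_le hΩ hΩr hC h.inH1
  have h2 := h.l2norm_avg_le hΩ hΩr ho
  rw [l2norm_sq_eq_avg (M := M) hΩr h.inH1.memLp, mul_pow, Ch, Real.sq_sqrt (by positivity)]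
  have h3 := pow_le_pow_left₀ (l2norm_nonneg _ _) h1 2
  have h4 := pow_le_pow_left₀ (l2norm_nonneg _ _) h2 2
  rw [mul_pow] at h3 h4
  linarith

/-- The deviation from the piecewise mean is controlled on each triangle. The mean `m` is controlled
by a field `q` with `div q = -m` and `‖q‖ ≤ C ‖m‖`, since `‖m‖² = (q, ∇v)`. -/
theorem exists_poincare (hΩ : IsConnected Ω) (hΩr : interior (closure Ω) = Ω)
    (hC : ∀ K ∈ M.tri, IsProjectionConstant K (C0K K)) (B : BoundarySplit M) :
    ∃ C : ℝ, 0 ≤ C ∧ ∀ v G, InV0 B v G → l2norm Ω v ≤ C * l2norm Ω G := by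
  obtain ⟨C, hC0, h⟩ := exists_bounded_rt_of_memXh hΩ hΩr B
  have hm := C0_mul_size_nonneg hΩ hC
  refine ⟨M.C0 C0K * M.size + C, by positivity, fun v G hv => ?_⟩
  obtain ⟨q, a, c, h1, h2, h3⟩ := h _ (memXh_avg (B := B) hΩr hv.inH1.memLp hv.mean)
  have e1 := hv.l2innerVec_eq hΩr h1 h2
  have e2 := (le_abs_self _).trans (abs_l2innerVec_le (h1.memLp hΩr) hv.inH1.memLp_grad)
  have hG := l2norm_nonneg Ω G
  have hA := l2norm_nonneg Ω (M.avg v)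
  have e3 : l2norm Ω (M.avg v) ≤ C * l2norm Ω G := by
    rcases hA.eq_or_lt with h0 | h0
    · rw [← h0]; positivity
    · rw [e1] at e2
      refine le_of_mul_le_mul_left ?_ h0
      calc l2norm Ω (M.avg v) * l2norm Ω (M.avg v) = l2norm Ω (M.avg v) ^ 2 := (sq _).symm
        _ ≤ l2norm Ω q * l2norm Ω G := e2
        _ ≤ C * l2norm Ω (M.avg v) * l2norm Ω G := mul_le_mul_of_nonneg_right h3 hG
        _ = _ := by ring
  have e4 := l2norm_sub_avg_le hΩ hΩr hC hv.inH1
  have e5 := l2norm_add_le (hv.inH1.memLp.sub (memLp_avg (M := M) hΩr v)) (memLp_avg (M := M) hΩr v)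
  have e6 : (fun x => (v - M.avg v) x + M.avg v x) = v := by
    ext x; simp
  rw [e6] at e5
  have e7 : l2norm Ω (v - M.avg v) = l2norm Ω (fun x => v x - M.avg v x) := rfl
  rw [e7] at e5
  linarith

end ProjectionConstant

end Mesh

namespace Mesh

/-! ### The space of gradients and its orthogonal projection -/

variable {Ω : Set Plane} {M : Mesh Ω} {B : BoundarySplit M}

theorem _root_.LocalFEM.HasTraceOn.sub {Γ : Finset (Finset Plane)} {v w s t : Plane → ℝ}
    (hv : HasTraceOn M Γ v s) (hw : HasTraceOn M Γ w t) :
    HasTraceOn M Γ (fun x => v x - w x) (fun x => s x - t x) := fun e he K hK heK =>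
  (hv e he K hK heK).sub (isOpen_openTri K) (isBounded_openTri K) (hw e he K hK heK)

theorem InV0.congr {v : Plane → ℝ} {G H : Plane → Plane}
    (h : InV0 B v G) (hG : G =ᵐ[volume.restrict Ω] H) : InV0 B v H :=
  ⟨h.inH1.congr (EventuallyEq.refl _ _) hG, h.trace, h.mean⟩

theorem InV0.sub {v w : Plane → ℝ} {G H : Plane → Plane} (hv : InV0 B v G) (hw : InV0 B w H) :
    InV0 B (fun x => v x - w x) (fun x => G x - H x) := by
  refine ⟨hv.inH1.sub hw.inH1, ?_, fun h => ?_⟩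
  · have := hv.trace.sub hw.trace
    have e : (fun x => (0 : Plane → ℝ) x - (0 : Plane → ℝ) x) = 0 := by ext; simp
    rwa [e] at this
  · rw [integral_sub (M.integrableOn_of_memLp hv.inH1.memLp)
      (M.integrableOn_of_memLp hw.inH1.memLp), hv.mean h, hw.mean h, sub_zero]

theorem InV0.const_mul {v : Plane → ℝ} {G : Plane → Plane} (hv : InV0 B v G) (r : ℝ) :
    InV0 B (fun x => r * v x) (fun x => r • G x) := by
  refine ⟨hv.inH1.const_mul r, fun e he K hK heK => ?_, fun h => ?_⟩
  · have := (hv.trace e he K hK heK).const_mul (isOpen_openTri K) r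
    have e : (fun x => r * (0 : Plane → ℝ) x) = 0 := by ext; simp
    rwa [e] at this
  · rw [integral_const_mul, hv.mean h, mul_zero]

theorem inV0_zero (M : Mesh Ω) (B : BoundarySplit M) : InV0 B (fun _ => 0) (fun _ => 0) :=
  ⟨inH1_const M.isBounded 0, hasTraceOn_of_piecewise_affine
    (fun K _ => ⟨0, 0, fun x _ => by simp⟩) (fun _ he => boundaryEdge_of_mem_D he)
    fun _ _ _ _ => rfl, fun _ => by simp⟩

/-- Limits of functions in `V₀` together with their gradients. -/
theorem inV0_of_tendsto (hΩr : interior (closure Ω) = Ω) {v : ℕ → Plane → ℝ}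
    {G : ℕ → Plane → Plane} (h : ∀ n, InV0 B (v n) (G n)) {w : Plane → ℝ} {H : Plane → Plane}
    (hw : MemLp w 2 (volume.restrict Ω)) (hH : MemLp H 2 (volume.restrict Ω))
    (h1 : Tendsto (fun n => eLpNorm (fun x => v n x - w x) 2 (volume.restrict Ω)) atTop (𝓝 0))
    (h2 : Tendsto (fun n => eLpNorm (fun x => G n x - H x) 2 (volume.restrict Ω)) atTop (𝓝 0)) :
    InV0 B w H := by
  have hv : ∀ n, MemLp (v n) 2 (volume.restrict Ω) := fun n => (h n).inH1.memLp
  have hG : ∀ n, MemLp (G n) 2 (volume.restrict Ω) := fun n => (h n).inH1.memLp_grad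
  have hin : InH1 Ω w H := by
    refine ⟨hw, hH, fun φ hφ => ?_⟩
    refine ext_inner_left ℝ fun a => ?_
    have mg : MemLp (gradient φ) 2 (volume.restrict Ω) :=
      memLp_of_continuous_of_isBounded M.isBounded (continuous_gradient hφ.1) 2
    have mφ : MemLp φ 2 (volume.restrict Ω) :=
      memLp_of_continuous_of_isBounded M.isBounded hφ.continuous 2
    have cg := continuous_gradient hφ.1
    have cφ := hφ.continuous
    have m1 : MemLp (fun x => inner ℝ a (gradient φ x) : Plane → ℝ) 2 (volume.restrict Ω) :=
      memLp_of_continuous_of_isBounded M.isBounded (by fun_prop) 2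
    have m2 : MemLp (fun x => φ x • a) 2 (volume.restrict Ω) :=
      memLp_of_continuous_of_isBounded M.isBounded (by fun_prop) 2
    have t1 := tendsto_integral_inner m1 hv hw h1
    have t2 := (tendsto_integral_inner m2 hG hH h2).neg
    have e1 : ∀ {u : Plane → ℝ}, MemLp u 2 (volume.restrict Ω) →
        inner ℝ a (∫ x in Ω, u x • gradient φ x) =
          ∫ x in Ω, inner ℝ (inner ℝ a (gradient φ x) : ℝ) (u x) := by
      intro u hu
      rw [← integral_inner (integrable_smul_of_memLp hu mg)]
      refine integral_congr_ae (Eventually.of_forall fun x => ?_)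
      simp [real_inner_smul_right]
    have e2 : ∀ {F : Plane → Plane}, MemLp F 2 (volume.restrict Ω) →
        inner ℝ a (-∫ x in Ω, φ x • F x) = -∫ x in Ω, inner ℝ (φ x • a) (F x) := by
      intro F hF
      rw [inner_neg_right, ← integral_inner (integrable_smul_of_memLp mφ hF)]
      congr 1
      refine integral_congr_ae (Eventually.of_forall fun x => ?_)
      simp [real_inner_smul_right, real_inner_smul_left]
    rw [e1 hw, e2 hH]
    refine tendsto_nhds_unique t1 (t2.congr fun n => ?_)
    rw [← e2 (hG n), ← e1 (hv n), (h n).inH1.weak φ hφ]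
  refine ⟨hin, fun e he K hK heK => ?_, fun h0 => ?_⟩
  · have hs := M.openTri_subset hΩr hK
    have hle : ∀ {F : Type} [NormedAddCommGroup F] (f : Plane → F),
        eLpNorm f 2 (volume.restrict (openTri K)) ≤ eLpNorm f 2 (volume.restrict Ω) := fun f =>
      eLpNorm_mono_measure _ (Measure.restrict_mono hs le_rfl)
    refine hasTrace_of_approx (isOpen_openTri K) (isBounded_openTri K) (hin.mono hs) MemLp.zero
      fun ε hε => ?_
    have hε' : 0 < ε := pos_iff_ne_zero.2 hε
    obtain ⟨n, hn1, hn2⟩ := ((h1.eventually (ge_mem_nhds hε')).and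
      (h2.eventually (ge_mem_nhds hε'))).exists
    exact ⟨v n, G n, 0, (h n).inH1.mono hs, (h n).trace e he K hK heK,
      (hle _).trans hn1, (hle _).trans hn2, by simp⟩
  · have m1 : MemLp (fun _ : Plane => (1 : ℝ)) 2 (volume.restrict Ω) :=
      memLp_of_continuous_of_isBounded M.isBounded continuous_const 2
    have t := tendsto_integral_inner m1 hv hw h1
    have e : ∀ u : Plane → ℝ, ∫ x in Ω, inner ℝ (1 : ℝ) (u x) = ∫ x in Ω, u x := fun u => by simp
    simp only [e] at t
    exact tendsto_nhds_unique t (tendsto_const_nhds.congr fun n => ((h n).mean h0).symm)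

/-- The gradients of the functions in `V₀`. -/
def gradSpace (B : BoundarySplit M) : Submodule ℝ (Lp Plane 2 (volume.restrict Ω)) where
  carrier := {g | ∃ v, InV0 B v g}
  zero_mem' := ⟨_, (inV0_zero M B).congr (Lp.coeFn_zero _ _ _).symm⟩
  add_mem' := by
    rintro g k ⟨v, hv⟩ ⟨w, hw⟩
    refine ⟨_, (hv.sub (hw.const_mul (-1))).congr ?_⟩
    filter_upwards [Lp.coeFn_add g k] with x hx
    rw [hx]; simp
  smul_mem' := by
    rintro r g ⟨v, hv⟩
    refine ⟨_, (hv.const_mul r).congr ?_⟩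
    filter_upwards [Lp.coeFn_smul r g] with x hx
    rw [hx]; rfl

theorem norm_eq_l2norm {F : Type*} [NormedAddCommGroup F] [InnerProductSpace ℝ F]
    (g : Lp F 2 (volume.restrict Ω)) : ‖g‖ = l2norm Ω g := by
  have h := norm_toLp_eq_sqrt (Lp.memLp g)
  rwa [Lp.toLp_coeFn] at h

/-- By the Poincaré inequality a convergent sequence of gradients comes from a Cauchy sequence of
functions, and its limit stays in `V₀`. -/
theorem isClosed_gradSpace (hΩr : interior (closure Ω) = Ω) {C : ℝ} (hC0 : 0 ≤ C)
    (hC : ∀ v G, InV0 B v G → l2norm Ω v ≤ C * l2norm Ω G) :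
    IsClosed (gradSpace B : Set (Lp Plane 2 (volume.restrict Ω))) := by
  refine IsSeqClosed.isClosed fun g k hg hgk => ?_
  choose v hv using hg
  have hm : ∀ n, MemLp (v n) 2 (volume.restrict Ω) := fun n => (hv n).inH1.memLp
  have hd : ∀ n m, dist ((hm n).toLp (v n)) ((hm m).toLp (v m)) ≤ C * dist (g n) (g m) := by
    intro n m
    rw [dist_eq_norm, dist_eq_norm, ← MemLp.toLp_sub, norm_toLp_eq_sqrt, norm_eq_l2norm]
    have h1 := hC _ _ (((hv n).sub (hv m)).congr (Lp.coeFn_sub (g n) (g m)).symm)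
    exact h1
  have hcau : CauchySeq fun n => (hm n).toLp (v n) := by
    rw [Metric.cauchySeq_iff]
    intro ε hε
    obtain ⟨N, hN⟩ := Metric.cauchySeq_iff.1 hgk.cauchySeq (ε / (C + 1)) (by positivity)
    refine ⟨N, fun n hn m hm' => (hd n m).trans_lt ?_⟩
    have h1 := hN n hn m hm'
    have h2 : (C + 1) * dist (g n) (g m) < (C + 1) * (ε / (C + 1)) :=
      mul_lt_mul_of_pos_left h1 (by positivity)
    rw [mul_div_cancel₀ _ (by positivity : C + 1 ≠ 0)] at h2
    have h3 : 0 ≤ dist (g n) (g m) := dist_nonneg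
    linarith
  obtain ⟨w, hw⟩ := cauchySeq_tendsto_of_complete hcau
  refine ⟨w, inV0_of_tendsto hΩr hv (Lp.memLp w) (Lp.memLp k) ?_ ?_⟩
  · have h1 := (Lp.tendsto_Lp_iff_tendsto_eLpNorm' _ _).1 hw
    refine h1.congr fun n => eLpNorm_congr_ae ?_
    filter_upwards [(hm n).coeFn_toLp] with x hx
    simp [hx]
  · exact (Lp.tendsto_Lp_iff_tendsto_eLpNorm' _ _).1 hgk

/-- The orthogonal projection of a vector field to the gradients of `V₀`. -/
theorem exists_gradient_projection (hΩr : interior (closure Ω) = Ω) {C : ℝ} (hC0 : 0 ≤ C)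
    (hC : ∀ v G, InV0 B v G → l2norm Ω v ≤ C * l2norm Ω G) {q : Plane → Plane}
    (hq : MemLp q 2 (volume.restrict Ω)) :
    ∃ v G, InV0 B v G ∧ ∀ w H, InV0 B w H → l2innerVec Ω (fun x => q x - G x) H = 0 := by
  have hcl := isClosed_gradSpace hΩr hC0 hC
  have : CompleteSpace (gradSpace B) := hcl.completeSpace_coe
  set y := (gradSpace B).starProjection (hq.toLp q) with hy
  obtain ⟨v, hv⟩ : y ∈ gradSpace B := (gradSpace B).starProjection_apply_mem _
  refine ⟨v, y, hv, fun w H hw => ?_⟩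
  have hmem : hw.inH1.memLp_grad.toLp H ∈ gradSpace B :=
    ⟨w, hw.congr hw.inH1.memLp_grad.coeFn_toLp.symm⟩
  have h0 := (gradSpace B).starProjection_inner_eq_zero (hq.toLp q) _ hmem
  rw [← hy] at h0
  have e : hq.toLp q - y = (hq.sub (Lp.memLp y)).toLp (q - (y : Plane → Plane)) := by
    rw [MemLp.toLp_sub hq (Lp.memLp y), Lp.toLp_coeFn]
  rw [e, inner_toLp_eq] at h0
  exact h0

/-! ### Localization -/

/-- With a Dirichlet part, the zero trace survives multiplication by `α`. Without one, the mean of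
`α v` must be removed, which does not change the gradient; hence the existential `w`. -/
theorem InV0.mul_inW1 (hΩr : interior (closure Ω) = Ω) {v α : Plane → ℝ} {G A : Plane → Plane}
    (h : InV0 B v G) (hα : InW1 Ω α A) :
    ∃ w, InV0 B w (fun x => α x • G x + v x • A x) := by
  have h1 := h.inH1.mul_inW1 (isOpen_of_regular hΩr) hα
  by_cases hD : B.ΓD = ∅
  · set c := (volume.real Ω)⁻¹ * ∫ x in Ω, α x * v x with hc
    refine ⟨fun x => α x * v x - c, ?_, by simp [HasTraceOn, hD], fun _ => ?_⟩
    · have := h1.sub (inH1_const M.isBounded c)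
      simpa using this
    · have hfin : IsFiniteMeasure (volume.restrict Ω) :=
        ⟨by simpa using M.volume_ne_top.lt_top⟩
      rw [integral_sub (M.integrableOn_of_memLp h1.memLp) (integrable_const _), setIntegral_const,
        smul_eq_mul, hc]
      by_cases h0 : volume.real Ω = 0
      · have : (volume.restrict Ω : Measure Plane) = 0 := by
          rw [Measure.restrict_eq_zero]
          exact (measureReal_eq_zero_iff M.volume_ne_top).1 h0
        simp [this]
      · rw [mul_inv_cancel_left₀ h0, sub_self]
  · refine ⟨fun x => α x * v x, h1, fun e he K hK heK => ?_, fun h0 => absurd h0 hD⟩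
    exact (h.trace e he K hK heK).mul_inW1 (isOpen_openTri K) (isBounded_openTri K)
      (M.isTri hK).shrinksInto (hα.mono (M.openTri_subset hΩr hK))

end Mesh

/-! ### Properties of the weight function and the weighted energy inequality. -/

theorem IsWeight.mem_Icc {Ω S : Set Plane} {ε : ℝ} {α : Plane → ℝ} (h : IsWeight Ω S ε α)
    {x : Plane} (hx : x ∈ Ω) : 0 ≤ α x ∧ α x ≤ 1 := by
  by_cases hS : x ∈ S
  · rw [h.2.1 x hS]; norm_num
  · by_cases hx' : x ∈ extendedDomain Ω S ε
    · exact h.2.2.2 x ⟨hx', hS⟩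
    · rw [h.2.2.1 x ⟨hx, hx'⟩]; norm_num

theorem IsWeight.inW1 {Ω S : Set Plane} (hΩ : IsOpen Ω) (hfin : volume Ω ≠ ⊤) {ε : ℝ}
    {α : Plane → ℝ} (h : IsWeight Ω S ε α) : InW1 Ω α (weakGrad Ω α) := by
  have : IsFiniteMeasure (volume.restrict Ω) := ⟨by simpa using hfin.lt_top⟩
  obtain ⟨G, hG, hw⟩ := h.1.2
  have hA : MemLp (weakGrad Ω α) ⊤ (volume.restrict Ω) := hG.ae_eq (hw.weakGrad_ae_eq hΩ).symm
  refine ⟨⟨h.1.1.mono_exponent le_top, hA.mono_exponent le_top, hw.weakGrad.2.2⟩, fun x hx => ?_, hA⟩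
  obtain ⟨h0, h1⟩ := h.mem_Icc hx
  rwa [abs_of_nonneg h0]

theorem gradSupNorm_nonneg (U : Set Plane) (α : Plane → ℝ) : 0 ≤ gradSupNorm U α :=
  Real.iSup_nonneg fun _ => ENNReal.toReal_nonneg

/-- The factor `√2` compares the Euclidean norm of the gradient with the larger of its two
components, by which `gradSupNorm` is defined. -/
theorem ae_norm_weakGrad_le {U : Set Plane} {α : Plane → ℝ}
    (h : MemLp (weakGrad U α) ⊤ (volume.restrict U)) :
    ∀ᵐ x ∂(volume.restrict U), ‖weakGrad U α x‖ ≤ √2 * gradSupNorm U α := by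
  have hi : ∀ i : Fin 2, ∀ᵐ x ∂(volume.restrict U), |weakGrad U α x i| ≤ gradSupNorm U α := by
    intro i
    have hm : MemLp (fun x => weakGrad U α x i) ⊤ (volume.restrict U) :=
      (EuclideanSpace.proj (𝕜 := ℝ) i).comp_memLp' h
    have hle : (eLpNorm (fun x => weakGrad U α x i) ⊤ (volume.restrict U)).toReal ≤
        gradSupNorm U α :=
      le_ciSup (f := fun i => (eLpNorm (fun x => weakGrad U α x i) ⊤ (volume.restrict U)).toReal)
        (Set.finite_range _).bddAbove i
    have hae := ae_le_eLpNormEssSup (f := fun x => weakGrad U α x i) (μ := volume.restrict U)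
    filter_upwards [hae] with x hx
    refine le_trans ?_ hle
    have h2 := hm.2.ne
    rw [eLpNorm_exponent_top] at h2 ⊢
    have h3 := ENNReal.toReal_mono h2 hx
    simpa using h3
  filter_upwards [hi 0, hi 1] with x h0 h1
  have hg := gradSupNorm_nonneg U α
  rw [EuclideanSpace.norm_eq, Fin.sum_univ_two]
  refine Real.sqrt_le_iff.2 ⟨by positivity, ?_⟩
  rw [mul_pow, Real.sq_sqrt (by norm_num)]
  have e0 := pow_le_pow_left₀ (abs_nonneg _) h0 2
  have e1 := pow_le_pow_left₀ (abs_nonneg _) h1 2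
  simp only [Real.norm_eq_abs]
  linarith

/-- The weighted energy identity, in the form of an inequality: if `D` is orthogonal to `α E + e A`
then the weighted norm of `E` is bounded by that of `D - E`. -/
theorem integral_weight_le {Ω : Set Plane} (hΩ : MeasurableSet Ω) {α e : Plane → ℝ}
    {A D E : Plane → Plane}
    (hα0 : ∀ x ∈ Ω, 0 ≤ α x) (hα1 : ∀ x ∈ Ω, α x ≤ 1)
    (hαm : AEStronglyMeasurable α (volume.restrict Ω))
    (hD : MemLp D 2 (volume.restrict Ω)) (hE : MemLp E 2 (volume.restrict Ω))
    (heA : MemLp (fun x => e x • A x) 2 (volume.restrict Ω))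
    (h0 : l2innerVec Ω D (fun x => α x • E x + e x • A x) = 0) :
    ∫ x in Ω, α x * ‖E x‖ ^ 2 ≤
      (∫ x in Ω, α x * ‖D x - E x‖ ^ 2) + 2 * |l2innerVec Ω D (fun x => e x • A x)| := by
  have hb : ∀ᵐ x ∂(volume.restrict Ω), ‖α x‖ ≤ 1 := by
    filter_upwards [ae_restrict_mem hΩ] with x hx
    rw [Real.norm_eq_abs, abs_of_nonneg (hα0 x hx)]
    exact hα1 x hx
  have mαE : MemLp (fun x => α x • E x) 2 (volume.restrict Ω) := memLp_mul_of_bound hαm hb hE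
  have mDE : MemLp (fun x => D x - E x) 2 (volume.restrict Ω) := hD.sub hE
  have mαDE : MemLp (fun x => α x • (D x - E x)) 2 (volume.restrict Ω) :=
    memLp_mul_of_bound hαm hb mDE
  have i1 : Integrable (fun x => inner ℝ (α x • E x) (E x)) (volume.restrict Ω) :=
    integrable_inner_of_memLp mαE hE
  have i2 : Integrable (fun x => inner ℝ (α x • (D x - E x)) (D x - E x)) (volume.restrict Ω) :=
    integrable_inner_of_memLp mαDE mDE
  have i3 : Integrable (fun x => inner ℝ (D x) (α x • E x)) (volume.restrict Ω) :=
    integrable_inner_of_memLp hD mαE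
  have i4 : Integrable (fun x => inner ℝ (D x) (e x • A x)) (volume.restrict Ω) :=
    integrable_inner_of_memLp hD heA
  have i5 : Integrable (fun x => inner ℝ (α x • (D x - E x)) (D x - E x) +
      2 * inner ℝ (D x) (α x • E x)) (volume.restrict Ω) := i2.add (i3.const_mul 2)
  have e0 : (∫ x in Ω, inner ℝ (D x) (α x • E x)) + ∫ x in Ω, inner ℝ (D x) (e x • A x) = 0 := by
    rw [← integral_add i3 i4, ← h0, l2innerVec]
    simp only [inner_add_right]
  have e1 : ∫ x in Ω, α x * ‖E x‖ ^ 2 = ∫ x in Ω, inner ℝ (α x • E x) (E x) := by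
    simp only [real_inner_smul_left, real_inner_self_eq_norm_sq]
  have e2 : ∫ x in Ω, α x * ‖D x - E x‖ ^ 2 =
      ∫ x in Ω, inner ℝ (α x • (D x - E x)) (D x - E x) := by
    simp only [real_inner_smul_left, real_inner_self_eq_norm_sq]
  -- Pointwise, `α|E|² ≤ α|E|² + α|D|² = α|D - E|² + 2 α D·E`; the integral of the last term is then
  -- replaced by means of `h0`.
  have e3 : ∫ x in Ω, inner ℝ (α x • E x) (E x) ≤
      ∫ x in Ω, (inner ℝ (α x • (D x - E x)) (D x - E x) + 2 * inner ℝ (D x) (α x • E x)) := by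
    refine integral_mono_ae i1 i5 ?_
    filter_upwards [ae_restrict_mem hΩ] with x hx
    have e : inner ℝ (α x • (D x - E x)) (D x - E x) + 2 * inner ℝ (D x) (α x • E x) =
        inner ℝ (α x • E x) (E x) + α x * ‖D x‖ ^ 2 := by
      simp only [inner_sub_left, inner_sub_right, real_inner_smul_left, real_inner_smul_right,
        real_inner_self_eq_norm_sq, real_inner_comm (D x) (E x)]
      ring
    rw [e]
    have := mul_nonneg (hα0 x hx) (sq_nonneg ‖D x‖)
    linarith
  rw [integral_add i2 (i3.const_mul 2), integral_const_mul] at e3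
  rw [e1, e2, l2innerVec]
  have := neg_abs_le (∫ x in Ω, inner ℝ (D x) (e x • A x))
  linarith

theorem l2norm_smul_le {Ω : Set Plane} {e : Plane → ℝ} {A : Plane → Plane}
    (he : MemLp e 2 (volume.restrict Ω)) {c : ℝ} (hc : 0 ≤ c)
    (hA : ∀ᵐ x ∂(volume.restrict Ω), ‖A x‖ ≤ c) :
    l2norm Ω (fun x => e x • A x) ≤ c * l2norm Ω e := by
  have h1 : ∫ x in Ω, ‖e x • A x‖ ^ 2 ≤ ∫ x in Ω, c ^ 2 * ‖e x‖ ^ 2 := by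
    refine integral_mono_of_nonneg (Eventually.of_forall fun _ => by positivity)
      ((integrable_norm_sq_of_memLp he).const_mul _) ?_
    filter_upwards [hA] with x hx
    simp only [norm_smul, mul_pow]
    rw [mul_comm]
    gcongr
  rw [integral_const_mul] at h1
  refine (Real.sqrt_le_sqrt h1).trans ?_
  rw [Real.sqrt_mul (sq_nonneg c), Real.sqrt_sq hc]
  rfl

theorem integral_extendedDomain {Ω S : Set Plane} (hΩ : IsOpen Ω) {ε : ℝ} {α : Plane → ℝ}
    (h : IsWeight Ω S ε α) (q : Plane → Plane) :
    ∫ x in extendedDomain Ω S ε, α x * ‖q x‖ ^ 2 = ∫ x in Ω, α x * ‖q x‖ ^ 2 := by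
  refine (setIntegral_eq_of_subset_of_forall_sdiff_eq_zero hΩ.measurableSet
    (fun x hx => hx.1) fun x hx => ?_).symm
  rw [h.2.2.1 x hx, zero_mul]

namespace Mesh

variable {Ω : Set Plane} {M : Mesh Ω} {B : BoundarySplit M} {C0K : Finset Plane → ℝ}

theorem l2innerVec_congr {p q r s : Plane → Plane} (h : p =ᵐ[volume.restrict Ω] q)
    (h' : r =ᵐ[volume.restrict Ω] s) : l2innerVec Ω p r = l2innerVec Ω q s := by
  refine integral_congr_ae ?_
  filter_upwards [h, h'] with x h1 h2
  rw [h1, h2]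

theorem l2innerVec_sub_left {p q r : Plane → Plane} (hp : MemLp p 2 (volume.restrict Ω))
    (hq : MemLp q 2 (volume.restrict Ω)) (hr : MemLp r 2 (volume.restrict Ω)) :
    l2innerVec Ω (fun x => p x - q x) r = l2innerVec Ω p r - l2innerVec Ω q r := by
  unfold l2innerVec
  rw [← integral_sub (integrable_inner_of_memLp hp hr) (integrable_inner_of_memLp hq hr)]
  simp only [inner_sub_left]

/-- Green's formula for an equilibrated flux. -/
theorem RTData.l2innerVec_eq (hΩr : interior (closure Ω) = Ω) {p : Plane → Plane} {fh : Plane → ℝ}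
    {a : Finset Plane → Plane} {c : Finset Plane → ℝ} (h : RTData M p (fun x => -fh x) a c)
    {gN : Finset Plane → ℝ} (hN : NormalEq M B p gN) {v t : Plane → ℝ} {G : Plane → Plane}
    (hv : InV0 B v G) (ht : HasTraceOn M B.ΓN v t) :
    l2innerVec Ω p G = l2inner Ω fh v + edgePairing B.ΓN gN t := by
  have hg := h.green_split hΩr (fun K hK P hP he => h.flux_eq_of_normalEq hN hK hP he) hv.inH1
    hv.trace ht
  simp only [neg_mul, integral_neg] at hg
  rw [← hg, l2inner, l2innerVec]
  ring

/-- The local estimate for a function whose gradient is `D - Q`, where `D` is orthogonal to the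
gradients of `V₀`. -/
theorem InV0.l2norm_local_le (hΩ : IsConnected Ω) (hΩr : interior (closure Ω) = Ω)
    (hC : ∀ K ∈ M.tri, IsProjectionConstant K (C0K K)) {S : Set Plane} (hS : IsOpen S)
    (hSΩ : S ⊆ Ω) {ε : ℝ} {α : Plane → ℝ} (hα : IsWeight Ω S ε α) {e : Plane → ℝ}
    {E D Q : Plane → Plane} (he : InV0 B e E) (hD : MemLp D 2 (volume.restrict Ω))
    (hE : ∀ᵐ x ∂(volume.restrict Ω), D x - E x = Q x)
    (ho : ∀ v H, InV0 B v H → l2innerVec Ω D H = 0)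
    (hoh : ∀ vh, MemVh M B 0 vh → l2innerVec Ω (weakGrad Ω vh) E = 0) :
    l2norm S E ^ 2 ≤ weightedNorm Ω S ε α Q ^ 2 +
      2 * √2 * Ch M B C0K * gradSupNorm Ω α * l2norm Ω Q ^ 2 := by
  have hopen := isOpen_of_regular hΩr
  have hW := hα.inW1 hopen M.volume_ne_top
  set A := weakGrad Ω α with hA
  have hAle := ae_norm_weakGrad_le hW.memLp_grad
  have hγ := gradSupNorm_nonneg Ω α
  have hCh : 0 ≤ Ch M B C0K := Real.sqrt_nonneg _
  have mE := he.inH1.memLp_grad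
  have meA : MemLp (fun x => e x • A x) 2 (volume.restrict Ω) :=
    memLp_smul_of_bound hW.memLp_grad.1 hAle he.inH1.memLp
  have h1 : l2norm Ω e ≤ Ch M B C0K * l2norm Ω E := he.l2norm_le_Ch hΩ hΩr hC hoh
  have hDE : l2innerVec Ω D E = 0 := ho e E he
  -- The hypercircle identity: `D` and `E` are orthogonal and `Q = D - E`.
  have hsum : l2norm Ω Q ^ 2 = l2norm Ω D ^ 2 + l2norm Ω E ^ 2 := by
    have iD : Integrable (fun x => ‖D x‖ ^ 2) (volume.restrict Ω) := integrable_norm_sq_of_memLp hD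
    have iE : Integrable (fun x => ‖E x‖ ^ 2) (volume.restrict Ω) := integrable_norm_sq_of_memLp mE
    have iDE := integrable_inner_of_memLp hD mE
    have i1 : Integrable (fun x => ‖D x‖ ^ 2 + ‖E x‖ ^ 2) (volume.restrict Ω) := iD.add iE
    have : ∫ x in Ω, ‖Q x‖ ^ 2 =
        ((∫ x in Ω, ‖D x‖ ^ 2) + ∫ x in Ω, ‖E x‖ ^ 2) - 2 * ∫ x in Ω, inner ℝ (D x) (E x) := by
      rw [← integral_add iD iE, ← integral_const_mul, ← integral_sub i1 (iDE.const_mul 2)]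
      refine integral_congr_ae ?_
      filter_upwards [hE] with x hx
      rw [← hx, norm_sub_sq_real]
      ring
    rw [l2norm_sq, l2norm_sq, l2norm_sq, this]
    rw [l2innerVec] at hDE
    rw [hDE]; ring
  have hQ0 := l2norm_nonneg Ω Q
  have hEQ : l2norm Ω E ≤ l2norm Ω Q :=
    le_of_sq_le_sq (by linarith [sq_nonneg (l2norm Ω D)]) hQ0
  have hDQ : l2norm Ω D ≤ l2norm Ω Q :=
    le_of_sq_le_sq (by linarith [sq_nonneg (l2norm Ω E)]) hQ0
  obtain ⟨w, hw⟩ := he.mul_inW1 hΩr hW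
  have h2 := integral_weight_le hopen.measurableSet (fun x hx => (hα.mem_Icc hx).1)
    (fun x hx => (hα.mem_Icc hx).2) hW.inH1.memLp.1 hD mE meA (ho _ _ hw)
  -- The factor `√2` comes from the Euclidean norm of the gradient of `α`, the factor `C(h)` from
  -- the duality estimate for `e`; both `‖D‖` and `‖E‖` are bounded by `‖Q‖`.
  have h3 : |l2innerVec Ω D (fun x => e x • A x)| ≤
      √2 * Ch M B C0K * gradSupNorm Ω α * l2norm Ω Q ^ 2 := by
    have h4 := l2norm_smul_le he.inH1.memLp (mul_nonneg (Real.sqrt_nonneg 2) hγ) hAle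
    have h5 : l2norm Ω e ≤ Ch M B C0K * l2norm Ω Q := h1.trans (mul_le_mul_of_nonneg_left hEQ hCh)
    calc |l2innerVec Ω D (fun x => e x • A x)|
        ≤ l2norm Ω D * l2norm Ω (fun x => e x • A x) := abs_l2innerVec_le hD meA
      _ ≤ l2norm Ω Q * (√2 * gradSupNorm Ω α * (Ch M B C0K * l2norm Ω Q)) :=
          mul_le_mul hDQ (h4.trans (mul_le_mul_of_nonneg_left h5 (by positivity)))
            (l2norm_nonneg _ _) hQ0
      _ = _ := by ring
  have h6 : ∫ x in Ω, α x * ‖D x - E x‖ ^ 2 = weightedNorm Ω S ε α Q ^ 2 := by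
    rw [weightedNorm, integral_extendedDomain hopen hα, Real.sq_sqrt]
    · refine integral_congr_ae ?_
      filter_upwards [hE] with x hx
      rw [hx]
    · refine setIntegral_nonneg hopen.measurableSet fun x hx => ?_
      have := (hα.mem_Icc hx).1
      positivity
  -- The weight is one on `S` and nonnegative elsewhere.
  have h7 : l2norm S E ^ 2 ≤ ∫ x in Ω, α x * ‖E x‖ ^ 2 := by
    have i1 : IntegrableOn (fun x => α x * ‖E x‖ ^ 2) Ω := by
      refine ((integrable_norm_sq_of_memLp mE).bdd_mul (c := 1) hW.inH1.memLp.1 ?_)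
      exact hW.ae_norm_le hopen
    have e1 : l2norm S E ^ 2 = ∫ x in S, α x * ‖E x‖ ^ 2 := by
      rw [l2norm_sq]
      refine setIntegral_congr_fun hS.measurableSet fun x hx => ?_
      simp only [hα.2.1 x hx, one_mul]
    rw [e1]
    refine setIntegral_mono_set i1 ?_ (Eventually.of_forall fun x hx => hSΩ hx)
    filter_upwards [ae_restrict_mem hopen.measurableSet] with x hx
    have := (hα.mem_Icc hx).1
    simp only [Pi.zero_apply]
    positivity
  rw [h6] at h2
  linarith

end Mesh

end LocalFEM

/-! ### The local error estimate. -/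

open LocalFEM in
theorem theorem4p5
    -- the bounded polygonal domain, its triangulation, and the splitting of its boundary
    (Ω : Set LocalFEM.Plane) (hΩ : IsConnected Ω) (hΩr : interior (closure Ω) = Ω)
    (M : LocalFEM.Mesh Ω) (B : LocalFEM.BoundarySplit M)
    -- the subdomain of interest and the weight function
    (S : Set LocalFEM.Plane) (hS : IsOpen S) (hSΩ : S ⊆ Ω) (ε : ℝ) (hε : 0 < ε)
    (α : LocalFEM.Plane → ℝ) (hα : LocalFEM.IsWeight Ω S ε α)
    -- the projection error constants of the triangles
    (C0K : Finset LocalFEM.Plane → ℝ)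
    (hC0K : ∀ K ∈ M.tri, LocalFEM.IsProjectionConstant K (C0K K))
    -- the data
    (f : LocalFEM.Plane → ℝ) (hf : MemLp f 2 (volume.restrict Ω))
    (gD : LocalFEM.Plane → ℝ) (gN : Finset LocalFEM.Plane → ℝ)
    -- the exact solution, the projection of the data, and the finite element solution
    (u : LocalFEM.Plane → ℝ) (hu : LocalFEM.IsWeakSolution M B f gD gN u)
    (fh : LocalFEM.Plane → ℝ) (hfh : LocalFEM.IsProjection M B f fh)
    (uh : LocalFEM.Plane → ℝ) (huh : LocalFEM.IsFEMSolution M B fh gD gN uh)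
    -- the flux
    (p : LocalFEM.Plane → LocalFEM.Plane) (hp : LocalFEM.MemRT M p)
    (hpdiv : LocalFEM.HasWeakDiv Ω p (fun x => -fh x)) (hpN : LocalFEM.NormalEq M B p gN) :
    LocalFEM.l2norm S (fun x => LocalFEM.weakGrad Ω u x - LocalFEM.weakGrad Ω uh x) ≤
      √(LocalFEM.E1 Ω S ε α uh p ^ 2 + LocalFEM.E2 M B C0K α uh p ^ 2) +
        M.C0 C0K * M.size * LocalFEM.l2norm Ω (fun x => f x - fh x) := by
  have hopen := isOpen_of_regular hΩr
  have huV := hu.1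
  have huhV := Mesh.memV_of_memVh hΩr huh.1
  have hu1 := huV.1.inH1 hopen
  have huh1 := huhV.1.inH1 hopen
  obtain ⟨a, c, hdata⟩ := Mesh.exists_rtData hΩr hp hpdiv
  have mp := hdata.memLp hΩr
  have mf := hfh.1.1
  obtain ⟨C, hC0, hC⟩ := Mesh.exists_poincare hΩ hΩr hC0K B
  have mq : MemLp (fun x => weakGrad Ω u x - p x) 2 (volume.restrict Ω) := hu1.memLp_grad.sub mp
  -- `u - v₀` plays the role of the exact solution with right-hand side `π_h f`; the projection
  -- replaces a separate existence argument for it.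
  obtain ⟨v₀, G, hv₀, horth⟩ := Mesh.exists_gradient_projection (B := B) hΩr hC0 hC mq
  have mG := hv₀.inH1.memLp_grad
  have hG : l2norm Ω G ≤ M.C0 C0K * M.size * l2norm Ω (fun x => f x - fh x) := by
    obtain ⟨t, ht⟩ := Mesh.exists_hasTraceOn hΩr
      (fun e he => Mesh.boundaryEdge_of_mem_N (B := B) he) hv₀.inH1
    have e1 := hu.2 v₀ t hv₀.memV ht
    rw [Mesh.l2innerVec_congr (EventuallyEq.refl _ _) (hv₀.inH1.weakGrad_ae_eq hopen)] at e1
    have e2 := hdata.l2innerVec_eq hΩr hpN hv₀ ht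
    have e3 := horth v₀ G hv₀
    rw [Mesh.l2innerVec_sub_left mq mG mG, Mesh.l2innerVec_sub_left hu1.memLp_grad mp mG, e1, e2]
      at e3
    -- The piecewise mean of `v₀` is in `X_h` (its mean value vanishes when there is no Dirichlet
    -- part), so it may be subtracted from `v₀` for free.
    have e4 := hfh.2 _ (Mesh.memXh_avg (B := B) hΩr hv₀.inH1.memLp hv₀.mean)
    have ma := Mesh.memLp_avg (M := M) hΩr v₀
    have mff : MemLp (fun x => f x - fh x) 2 (volume.restrict Ω) := hf.sub mf
    have mva : MemLp (fun x => v₀ x - M.avg v₀ x) 2 (volume.restrict Ω) := hv₀.inH1.memLp.sub ma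
    have e5 : l2inner Ω (fun x => f x - fh x) (fun x => v₀ x - M.avg v₀ x) =
        l2inner Ω f v₀ - l2inner Ω fh v₀ := by
      have i1 : Integrable (fun x => f x * v₀ x) (volume.restrict Ω) :=
        integrable_smul_of_memLp hf hv₀.inH1.memLp
      have i2 : Integrable (fun x => fh x * v₀ x) (volume.restrict Ω) :=
        integrable_smul_of_memLp mf hv₀.inH1.memLp
      have i3 : Integrable (fun x => (f x - fh x) * M.avg v₀ x) (volume.restrict Ω) :=
        integrable_smul_of_memLp mff ma
      have i4 : Integrable (fun x => f x * v₀ x - fh x * v₀ x) (volume.restrict Ω) := i1.sub i2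
      rw [← sub_zero (l2inner Ω f v₀ - l2inner Ω fh v₀), ← e4]
      unfold l2inner
      rw [← integral_sub i1 i2, ← integral_sub i4 i3]
      refine integral_congr_ae (Eventually.of_forall fun x => ?_)
      ring
    have e6 : l2innerVec Ω G G = l2norm Ω G ^ 2 := by
      rw [l2norm_sq, l2innerVec]
      simp only [real_inner_self_eq_norm_sq]
    have e7 := (le_abs_self _).trans (abs_l2inner_le mff mva)
    have e8 := Mesh.l2norm_sub_avg_le hΩ hΩr hC0K hv₀.inH1
    have hG0 := l2norm_nonneg Ω G
    rcases hG0.eq_or_lt with h0 | h0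
    · rw [← h0]
      exact mul_nonneg (Mesh.C0_mul_size_nonneg hΩ hC0K) (l2norm_nonneg _ _)
    · refine le_of_mul_le_mul_right ?_ h0
      calc l2norm Ω G * l2norm Ω G = l2inner Ω f v₀ - l2inner Ω fh v₀ := by
            rw [← sq, ← e6]; linarith
        _ ≤ l2norm Ω (fun x => f x - fh x) * l2norm Ω (fun x => v₀ x - M.avg v₀ x) := e5 ▸ e7
        _ ≤ l2norm Ω (fun x => f x - fh x) * (M.C0 C0K * M.size * l2norm Ω G) :=
            mul_le_mul_of_nonneg_left e8 (l2norm_nonneg _ _)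
        _ = _ := by ring
  have he : Mesh.InV0 B (fun x => u x - uh x - v₀ x)
      (fun x => weakGrad Ω u x - weakGrad Ω uh x - G x) := by
    refine Mesh.InV0.sub (v := fun x => u x - uh x)
      (G := fun x => weakGrad Ω u x - weakGrad Ω uh x) ⟨hu1.sub huh1, ?_, fun h => ?_⟩ hv₀
    · have h := huV.2.1.sub huhV.2.1
      have e : (fun x => gD x - gD x) = 0 := by ext; simp
      rwa [e] at h
    · rw [integral_sub (M.integrableOn_of_memLp hu1.memLp) (M.integrableOn_of_memLp huh1.memLp),
        huV.2.2 h, huhV.2.2 h, sub_zero]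
  have mD : MemLp (fun x => weakGrad Ω u x - p x - G x) 2 (volume.restrict Ω) := mq.sub mG
  have mQ : MemLp (fun x => weakGrad Ω uh x - p x) 2 (volume.restrict Ω) := huh1.memLp_grad.sub mp
  -- Galerkin orthogonality: `E = D - Q`, where `D` is orthogonal to all gradients of `V₀`. `Q` is
  -- orthogonal to discrete ones because `uh` and `p` have the same data `fh` and `gN`.
  have hoh : ∀ vh, MemVh M B 0 vh → l2innerVec Ω (weakGrad Ω vh)
      (fun x => weakGrad Ω u x - weakGrad Ω uh x - G x) = 0 := by
    intro vh hvh
    have hvV := Mesh.inV0_of_memV hΩr (Mesh.memV_of_memVh hΩr hvh)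
    have mv := hvV.inH1.memLp_grad
    have e1 := huh.2 vh hvh
    have e2 := hdata.l2innerVec_eq hΩr hpN hvV (Mesh.hasTraceOn_of_memVh hvh)
    have e3 := horth vh _ hvV
    have e4 := Mesh.l2innerVec_sub_left mD mQ mv
    rw [Mesh.l2innerVec_sub_left huh1.memLp_grad mp mv, e1, e2, e3, sub_self, sub_zero] at e4
    rw [← e4]
    refine integral_congr_ae (Eventually.of_forall fun x => ?_)
    simp only
    rw [real_inner_comm]
    congr 1
    abel
  have hmain := he.l2norm_local_le (Q := fun x => weakGrad Ω uh x - p x) hΩ hΩr hC0K hS hSΩ hα mD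
    (Eventually.of_forall fun x => by abel) horth hoh
  have hγ := gradSupNorm_nonneg Ω α
  have hCh : 0 ≤ Ch M B C0K := Real.sqrt_nonneg _
  have hE2 : E2 M B C0K α uh p ^ 2 = 2 * √2 * Ch M B C0K * gradSupNorm Ω α *
      l2norm Ω (fun x => weakGrad Ω uh x - p x) ^ 2 := by
    rw [E2, mul_pow, Real.sq_sqrt (by positivity)]
  have hSle : l2norm S (fun x => weakGrad Ω u x - weakGrad Ω uh x - G x) ≤
      √(E1 Ω S ε α uh p ^ 2 + E2 M B C0K α uh p ^ 2) := by
    refine Real.le_sqrt_of_sq_le ?_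
    rw [hE2]
    exact hmain
  have hmono : volume.restrict S ≤ volume.restrict Ω := Measure.restrict_mono hSΩ le_rfl
  have hGS : l2norm S G ≤ l2norm Ω G := by
    refine Real.sqrt_le_sqrt (setIntegral_mono_set (integrable_norm_sq_of_memLp mG)
      (Eventually.of_forall fun x => by positivity) (Eventually.of_forall fun x hx => hSΩ hx))
  have htri := l2norm_add_le (he.inH1.memLp_grad.mono_measure hmono) (mG.mono_measure hmono)
  simp only [sub_add_cancel] at htri
  linarith
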